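/- Let $\Phi=\{\phi_0,\phi_1,\dots\}$ be one of the following orthonormal systems on an interval $[0,L]$: the trigonometric system $\frac1{\sqrt{2\pi}},\frac{\cos x}{\sqrt\pi},\frac{\sin x}{\sqrt\pi},\frac{\cos 2x}{\sqrt\pi},\dots$ ($L=2\pi$); the Walsh system in Paley order ($L=1$); the Haar system, whose value at a jump is the mean of the one-sided limits and at $0,1$ the one-sided limit ($L=1$); the Franklin system, i.e. the Gram–Schmidt orthonormalization of $1$ and the primitives $\int_0^x h$ of the Haar functions $h$ ($L=1$); the Vilenkin system generated by any integers $p_0,p_1,\dots\ge2$, bounded or not ($L=1$). Let $S_jf(x)=\int_0^L D_j(x,t)f(t)\,dt$, $j=0,1,2,\dots$, be the partial sums of the Fourier series of $f$ with respect to $\Phi$, where $D_j(x,t)=\sum_{k\le j}\phi_k(x)\overline{\phi_k(t)}$; for the trigonometric system $S_j$ may denote either these partial sums or the usual ones, which contain exactly the frequencies $\le j$ (with $D_j$ changed accordingly). Let $T=(a_{nj})_{n,j\ge0}$ be a complex matrix that defines a regular summation method: whenever $s_j\to s$, the series $\sum_j a_{nj}s_j$ converge for all $n$, and their sums tend to $s$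 as $n\to\infty$. Assume that the means are integral operators in the following sense: for each $n$, the kernels $\sum_{j<J}a_{nj}D_j(x,\cdot)$, with $J\in\mathbb N$ and $x\in[0,L]$, are uniformly integrable, i.e. for every $\varepsilon>0$ there is $\delta>0$ such that $\int_A\bigl|\sum_{j<J}a_{nj}D_j(x,t)\bigr|\,dt\le\varepsilon$ for all $J$, all $x\in[0,L]$ and all measurable $A\subseteq[0,L]$ with $|A|\le\delta$. (This holds, for example, if every row of $T$ has finitely many nonzero entries, or if for each $n$ these kernels are bounded by a constant $M_n$; it holds for every regular $T$ if $\Phi$ is the Haar or the Franklin system.) Then for every set $E\subseteq[0,L]$ of measure zero there is a measurable set $G\subseteq[0,L]$ such that the Fourier series of $\mathbb I_G$ with respect to $\Phi$ diverges by the method $T$ at every point of $E$: for each $x\in E$ the means $\sigma_n=\sum_{j}a_{nj}S_j\mathbb I_G(x)$ exist for all $n$, and $(\sigma_n)$ has no finite limit as $n\to\infty$. -/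

import Mathlib

open Filter Topology MeasureTheory

noncomputable section

namespace OrthoDiv

/-! ### The classical orthonormal systems -/

/-- The trigonometric system on `[0, 2π]`, in the order
`1/√(2π), cos x/√π, sin x/√π, cos 2x/√π, sin 2x/√π, …`. -/
def trig (n : ℕ) (x : ℝ) : ℝ :=
  if n = 0 then 1 / √(2 * Real.pi)
  else if n % 2 = 1 then Real.cos (((n + 1) / 2 : ℕ) * x) / √Real.pi
  else Real.sin ((n / 2 : ℕ) * x) / √Real.pi

/-- The Walsh system (in the Paley order) on `[0, 1]`: the product of the Rademacher functions
`r_k(x) = (-1) ^ ⌊2^(k+1) x⌋` over the binary digits `1` of `n`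
(all of them are at places `k < n`). -/
def walsh (n : ℕ) (x : ℝ) : ℝ :=
  ∏ k ∈ Finset.range n, if n.testBit k then (-1 : ℝ) ^ ⌊(2 : ℝ) ^ (k + 1) * x⌋ else 1

/-- The right-continuous Haar mother function. -/
def haarMotherRight (y : ℝ) : ℝ :=
  if 0 ≤ y ∧ y < 1 / 2 then 1 else if 1 / 2 ≤ y ∧ y < 1 then -1 else 0

/-- The left-continuous Haar mother function. -/
def haarMotherLeft (y : ℝ) : ℝ :=
  if 0 < y ∧ y ≤ 1 / 2 then 1 else if 1 / 2 < y ∧ y ≤ 1 then -1 else 0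

/-- The `L²`-normalized dilate and translate, with `n = 2^k + i`, `0 ≤ i < 2^k`, of a mother
function `ψ`. -/
def haarDilate (ψ : ℝ → ℝ) (n : ℕ) (x : ℝ) : ℝ :=
  √((2 : ℝ) ^ Nat.log 2 n) *
    ψ ((2 : ℝ) ^ Nat.log 2 n * x - ((n : ℝ) - (2 : ℝ) ^ Nat.log 2 n))

/-- The Haar system on `[0, 1]`, with the classical values at the jumps: the mean of the one-sided
limits inside `(0, 1)`, and the one-sided limit from inside at `0` and `1`. -/
def haar (n : ℕ) (x : ℝ) : ℝ :=
  if n = 0 then 1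
  else if x = 0 then haarDilate haarMotherRight n x
  else if x = 1 then haarDilate haarMotherLeft n x
  else (haarDilate haarMotherRight n x + haarDilate haarMotherLeft n x) / 2

/-- The Faber–Schauder functions: the constant `1`, followed by the primitives of the Haar
functions (the first of these primitives is `x`). -/
def schauder (n : ℕ) (x : ℝ) : ℝ :=
  if n = 0 then 1 else ∫ t in (0 : ℝ)..x, haar (n - 1) t

/-- One step of the Gram–Schmidt process in `L²[0, 1]`: remove from `s` its components along
`e 0, …, e (n-1)` and normalize the rest. -/
def gramSchmidtStep (s : ℝ → ℝ) (n : ℕ) (e : Fin n → ℝ → ℝ) (x : ℝ) : ℝ :=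
  (s x - ∑ k : Fin n, (∫ t in (0 : ℝ)..1, s t * e k t) * e k x) /
    √(∫ y in (0 : ℝ)..1, (s y - ∑ k : Fin n, (∫ t in (0 : ℝ)..1, s t * e k t) * e k y) ^ 2)

/-- The Franklin system on `[0, 1]`: the Gram–Schmidt orthonormalization of the Faber–Schauder
functions. -/
def franklin (n : ℕ) : ℝ → ℝ :=
  gramSchmidtStep (schauder n) n (fun k : Fin n => franklin k.1)
termination_by n
decreasing_by exact k.2

/-- The generalized powers `M_0 = 1`, `M_(k+1) = p_k M_k` of a sequence `p`. -/
def vilenkinBase (p : ℕ → ℕ) (k : ℕ) : ℕ := ∏ i ∈ Finset.range k, p i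

/-- The Vilenkin system on `[0, 1]` generated by a sequence `p` of integers `p_k ≥ 2`, bounded or
not: `ψ_n(x) = ∏_k exp (2πi n_k x_k / p_k)`, where `n = ∑ n_k M_k` and `x = ∑ x_k / M_(k+1)` are
the expansions in the mixed radix `p` (and `n_k = 0` for `k ≥ n`). -/
def vilenkin (p : ℕ → ℕ) (n : ℕ) (x : ℝ) : ℂ :=
  ∏ k ∈ Finset.range n,
    Complex.exp (2 * Real.pi * Complex.I * ((n / vilenkinBase p k % p k : ℕ) : ℂ) *
      ((⌊(vilenkinBase p (k + 1) : ℝ) * x⌋ % (p k : ℤ) : ℤ) : ℂ) / (p k : ℂ))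

/-- The classical orthonormal systems. The trigonometric system occurs twice: with the usual
partial sums, which add the cosine and the sine of the same frequency together, and with the
partial sums that add one function at a time. -/
inductive ClassicalSystem : Type
  | trigonometric
  | trigonometricTermwise
  | walsh
  | haar
  | franklin
  | vilenkin (p : ℕ → ℕ) (hp : ∀ k, 2 ≤ p k)

namespace ClassicalSystem

/-- The system lives on the interval `[0, length]`. -/
def length : ClassicalSystem → ℝ
  | trigonometric => 2 * Real.pi
  | trigonometricTermwise => 2 * Real.pi
  | _ => 1

/-- The functions `φ_0, φ_1, φ_2, …` of the system. -/
def fn : ClassicalSystem → ℕ → ℝ → ℂ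
  | trigonometric => fun n x => (OrthoDiv.trig n x : ℂ)
  | trigonometricTermwise => fun n x => (OrthoDiv.trig n x : ℂ)
  | walsh => fun n x => (OrthoDiv.walsh n x : ℂ)
  | haar => fun n x => (OrthoDiv.haar n x : ℂ)
  | franklin => fun n x => (OrthoDiv.franklin n x : ℂ)
  | vilenkin p _ => OrthoDiv.vilenkin p

/-- The number of functions of the system that the partial sum with index `j` uses. -/
def terms : ClassicalSystem → ℕ → ℕ
  | trigonometric => fun j => 2 * j + 1
  | _ => fun j => j + 1

/-- The Fourier coefficient of `f` with respect to `φ_k`. -/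
def coeff (Φ : ClassicalSystem) (f : ℝ → ℂ) (k : ℕ) : ℂ :=
  ∫ t in (0 : ℝ)..Φ.length, f t * (starRingEnd ℂ) (Φ.fn k t)

/-- The partial sum with index `j` of the Fourier series of `f`, at the point `x`. -/
def partialSum (Φ : ClassicalSystem) (f : ℝ → ℂ) (x : ℝ) (j : ℕ) : ℂ :=
  ∑ k ∈ Finset.range (Φ.terms j), Φ.coeff f k * Φ.fn k x

/-- The kernel `D_j(x, t)` of the operator `f ↦ partialSum f x j`. -/
def kernel (Φ : ClassicalSystem) (j : ℕ) (x t : ℝ) : ℂ :=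
  ∑ k ∈ Finset.range (Φ.terms j), Φ.fn k x * (starRingEnd ℂ) (Φ.fn k t)

end ClassicalSystem

/-! ### Linear summation methods -/

/-- `σ` is the sequence of means of `s` by the matrix `a`: for every `n` the series
`∑_j a_(n,j) s_j` converges and its sum is `σ_n`. -/
def IsMeans (a : ℕ → ℕ → ℂ) (s σ : ℕ → ℂ) : Prop :=
  ∀ n, Tendsto (fun J => ∑ j ∈ Finset.range J, a n j * s j) atTop (𝓝 (σ n))

/-- The method given by the matrix `a` is regular: it sums every convergent sequence to its
limit. -/
def IsRegularMethod (a : ℕ → ℕ → ℂ) : Prop :=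
  ∀ (s : ℕ → ℂ) (l : ℂ), Tendsto s atTop (𝓝 l) → ∃ σ, IsMeans a s σ ∧ Tendsto σ atTop (𝓝 l)

/-- For each row `n` of the matrix `a`, the kernels `∑_{j < J} a_(n,j) D_j(x, ·)`, with `J ∈ ℕ` and
`x` in the interval, are uniformly integrable. It holds when the row is finite and, more
generally, when these kernels are bounded by a constant `M_n`. -/
def HasIntegrableKernels (Φ : ClassicalSystem) (a : ℕ → ℕ → ℂ) : Prop :=
  ∀ n, ∀ ε > (0 : ℝ), ∃ δ > (0 : ℝ), ∀ J : ℕ, ∀ x ∈ Set.Icc 0 Φ.length,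
    ∀ A ⊆ Set.Icc 0 Φ.length, MeasurableSet A → volume A ≤ ENNReal.ofReal δ →
      ∫ t in A, ‖∑ j ∈ Finset.range J, a n j * Φ.kernel j x t‖ ≤ ε

end OrthoDiv

end

/-! The set is obtained by alternately deleting and adding ever thinner neighbourhoods of the null
set `E`. Suppose that the indicator of `F` equals a constant b (0 or 1) on an open set `G`
containing `E`. Partial sums reproduce constants, and by localization the partial sums of 1_F - b
tend to 0 at every point of `E`; so the regular means of 1_F tend to b there. At each x in `E` fix a
late row n whose mean is already close to b, and choose an open `G'` with `E` inside `G'` inside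
`G`, so thin that altering `F` within `G'` hardly changes this mean. Then make the indicator equal
to 1 - b on `G'` and repeat. The limit set differs from the k-th set only inside the next
neighbourhood, so at every point of `E` its means come close to 0 and to 1 along arbitrarily late
rows.

The difficulty is that the row depends on x, and `E` may be uncountable and come arbitrarily close
to the boundary of `G`. In `Localizing.exists_refinement` the set `G` is exhausted by cores, on
which the distance to the complement is bounded below; one row serves a whole core. `G'` is a union
of thin pieces, one near each core. For a point x first captured by the p-th core, all but finitely
many pieces were chosen after the p-th row was known and are small by uniform integrability of its
kernels. The remaining pieces lie at a definite distance from x, where the kernels of all rows are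
bounded at once, because the rows of a regular matrix are bounded in ℓ¹
(`IsRegularMethod.exists_row_bound`).

`Localizing.exists_divergence` thus needs only the three properties in `Localizing`: reproduction of
constants, kernels bounded off the diagonal of the circle, and localization uniform in the point.
Vilenkin kernels of order q·M_k vanish off the diagonal, and the fewer than M_k remaining terms are
handled by Bessel; Walsh is a special case. Haar kernels eventually vanish off the diagonal.
Franklin kernels are reproducing kernels of linear splines and decay geometrically away from the
diagonal. For the trigonometric system, a Riemann–Lebesgue lemma uniform in x is applied to the
Dirichlet kernel. -/

noncomputable section

namespace OrthoDiv

/-! ### Regular matrices: bounded rows and vanishing columns -/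

/-- Evaluation at `j`, as a functional on the null sequences. -/
def nullSeqEval (j : ℕ) : ZeroAtInftyContinuousMap ℕ ℂ →L[ℂ] ℂ :=
  LinearMap.mkContinuous
    { toFun := fun f => f j
      map_add' := fun _ _ => rfl
      map_smul' := fun _ _ => rfl } 1 fun f => by
    rw [one_mul, ← ZeroAtInftyContinuousMap.norm_toBCF_eq_norm]
    exact f.toBCF.norm_coe_le_norm j

@[simp] lemma nullSeqEval_apply (j : ℕ) (f : ZeroAtInftyContinuousMap ℕ ℂ) :
    nullSeqEval j f = f j := rfl

/-- A null sequence as an element of `C₀(ℕ, ℂ)`. -/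
def nullSeq (s : ℕ → ℂ) (hs : Tendsto s atTop (𝓝 0)) : ZeroAtInftyContinuousMap ℕ ℂ :=
  ⟨⟨s, continuous_of_discreteTopology⟩, by
    rw [cocompact_eq_cofinite, Nat.cofinite_eq_atTop]; exact hs⟩

lemma nullSeq_tendsto (f : ZeroAtInftyContinuousMap ℕ ℂ) : Tendsto (fun j => f j) atTop (𝓝 0) := by
  have := f.zero_at_infty'
  rwa [cocompact_eq_cofinite, Nat.cofinite_eq_atTop] at this

/-- The rows of a regular matrix are bounded in `ℓ¹`. -/
lemma IsRegularMethod.exists_row_bound {a : ℕ → ℕ → ℂ} (ha : IsRegularMethod a) :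
    ∃ M > 0, ∀ n J, ∑ j ∈ Finset.range J, ‖a n j‖ ≤ M := by
  choose! σ hσ hσl using fun (f : ZeroAtInftyContinuousMap ℕ ℂ) => ha f 0 (nullSeq_tendsto f)
  let Λ : ℕ → ℕ → ZeroAtInftyContinuousMap ℕ ℂ →L[ℂ] ℂ := fun n J =>
    ∑ j ∈ Finset.range J, a n j • nullSeqEval j
  have hΛ : ∀ n J f, Λ n J f = ∑ j ∈ Finset.range J, a n j * f j := by
    intro n J f
    simp [Λ]
  -- Banach–Steinhaus enters twice: here it makes each row a continuous functional on the null
  -- sequences, as a pointwise limit of finite sums, and below it bounds the norms of the rows.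
  let A : ℕ → ZeroAtInftyContinuousMap ℕ ℂ →L[ℂ] ℂ := fun n =>
    continuousLinearMapOfTendsto (Λ n) (f := fun f => σ f n) (by
      rw [tendsto_pi_nhds]
      intro f
      simp only [hΛ]
      exact hσ f n)
  have hA : ∀ n f, A n f = σ f n := fun n f => rfl
  obtain ⟨C, hC⟩ := banach_steinhaus (g := A) (by
    intro f
    obtain ⟨C, hC⟩ := (hσl f).norm.bddAbove_range
    exact ⟨C, fun n => hC ⟨n, rfl⟩⟩)
  refine ⟨max C 1, by positivity, fun n J => ?_⟩
  -- The conjugate phases of the first `J` entries turn the mean into the sum of absolute values. At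
  -- a zero entry the quotient is 0 by convention, which loses nothing.
  let s : ℕ → ℂ := fun j => if j < J then (starRingEnd ℂ) (a n j) / ‖a n j‖ else 0
  have hs : Tendsto s atTop (𝓝 0) := by
    refine tendsto_const_nhds.congr' ?_
    filter_upwards [eventually_ge_atTop J] with j hj
    simp [s, hj.not_gt]
  have hs1 : ‖nullSeq s hs‖ ≤ 1 := by
    rw [← ZeroAtInftyContinuousMap.norm_toBCF_eq_norm, BoundedContinuousFunction.norm_le one_pos.le]
    intro j
    change ‖s j‖ ≤ 1
    simp only [s]
    split_ifs
    · simp only [norm_div, RCLike.norm_conj, Complex.norm_real, norm_norm]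
      exact div_self_le_one _
    · simp
  have hval : σ (nullSeq s hs) n = ((∑ j ∈ Finset.range J, ‖a n j‖ : ℝ) : ℂ) := by
    refine tendsto_nhds_unique (hσ _ n) (tendsto_const_nhds.congr' ?_)
    filter_upwards [eventually_ge_atTop J] with K hK
    rw [← Finset.sum_subset (Finset.range_mono hK), Complex.ofReal_sum]
    · refine Finset.sum_congr rfl fun j hj => ?_
      change _ = a n j * s j
      simp only [s, Finset.mem_range.1 hj, if_true]
      by_cases h0 : a n j = 0
      · simp [h0]
      · have : (‖a n j‖ : ℂ) ≠ 0 := by simpa using h0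
        rw [← mul_div_assoc, Complex.mul_conj, Complex.normSq_eq_norm_sq]
        field_simp
        push_cast; ring
    · intro j _ hj
      have : ¬ j < J := by simpa using hj
      change a n j * s j = 0
      simp [s, this]
  have h1 := (A n).le_of_opNorm_le (hC n) (nullSeq s hs)
  rw [hA, hval, Complex.norm_real, Real.norm_of_nonneg (by positivity)] at h1
  have h2 : 0 ≤ C := (norm_nonneg _).trans (hC n)
  exact (h1.trans (mul_le_of_le_one_right h2 hs1)).trans (le_max_left _ _)

/-- The sequence with a single 1 at place `i` is a null sequence, and its means are the entries of
the column. -/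
lemma IsRegularMethod.tendsto_column {a : ℕ → ℕ → ℂ} (ha : IsRegularMethod a) (i : ℕ) :
    Tendsto (fun n => a n i) atTop (𝓝 0) := by
  let s : ℕ → ℂ := fun j => if j = i then 1 else 0
  obtain ⟨σ, hσ, hl⟩ := ha s 0 (tendsto_const_nhds.congr' (by
    filter_upwards [eventually_gt_atTop i] with j hj
    simp [s, hj.ne']))
  refine hl.congr fun n => tendsto_nhds_unique (hσ n) (tendsto_const_nhds.congr' ?_)
  filter_upwards [eventually_gt_atTop i] with J hJ
  simp [s, hJ]

/-- A regular method is uniform: it sums uniformly small sequences to small means. -/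
lemma IsRegularMethod.exists_mean_le {a : ℕ → ℕ → ℂ} (ha : IsRegularMethod a) {M : ℝ}
    (hM : 0 < M) (hM' : ∀ n J, ∑ j ∈ Finset.range J, ‖a n j‖ ≤ M) (J₀ : ℕ) (B : ℝ) {ε : ℝ}
    (hε : 0 < ε) :
    ∀ᶠ n in atTop, ∀ s : ℕ → ℂ, (∀ j, ‖s j‖ ≤ B) → (∀ j ≥ J₀, ‖s j‖ ≤ ε / M) →
      ∀ J, ‖∑ j ∈ Finset.range J, a n j * s j‖ ≤ 2 * ε := by
  have hcol : Tendsto (fun n => ∑ j ∈ Finset.range J₀, ‖a n j‖ * B) atTop (𝓝 0) := by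
    have := tendsto_finsetSum (Finset.range J₀)
      (fun j _ => ((ha.tendsto_column j).norm.mul_const B))
    simpa using this
  filter_upwards [hcol.eventually_le_const hε] with n hn s hB hs J
  have hB0 : 0 ≤ B := (norm_nonneg _).trans (hB 0)
  calc ‖∑ j ∈ Finset.range J, a n j * s j‖
      ≤ ∑ j ∈ Finset.range J, ‖a n j‖ * ‖s j‖ :=
        (norm_sum_le _ _).trans_eq (Finset.sum_congr rfl fun _ _ => norm_mul _ _)
    -- The head is controlled by the vanishing columns, the tail by the row bound. Adding the tail
    -- term for every `j` only enlarges the bound.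
    _ ≤ ∑ j ∈ Finset.range J, ((if j < J₀ then ‖a n j‖ * B else 0) + ‖a n j‖ * (ε / M)) := by
        refine Finset.sum_le_sum fun j _ => ?_
        have : 0 ≤ ‖a n j‖ * (ε / M) := by positivity
        split_ifs with h
        · have := mul_le_mul_of_nonneg_left (hB j) (norm_nonneg (a n j)); linarith
        · have := mul_le_mul_of_nonneg_left (hs j (not_lt.1 h)) (norm_nonneg (a n j)); linarith
    _ ≤ ε + ε := by
        rw [Finset.sum_add_distrib]
        refine add_le_add (le_trans ?_ hn) ?_
        · rw [← Finset.sum_filter]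
          refine Finset.sum_le_sum_of_subset_of_nonneg (fun j hj => ?_) fun _ _ _ => by positivity
          simpa using (Finset.mem_filter.1 hj).2
        · rw [← Finset.sum_mul]
          calc _ ≤ M * (ε / M) := by gcongr; exact hM' n J
            _ = ε := by field_simp
    _ = 2 * ε := by ring


/-! ### Localizing systems and the integral form of the means -/

/-- The distance on the circle obtained from `[0, L]` by gluing `0` and `L`. -/
def gap (L x t : ℝ) : ℝ := min |x - t| (L - |x - t|)

lemma gap_comm (L x t : ℝ) : gap L x t = gap L t x := by
  rw [gap, gap, abs_sub_comm]

lemma gap_triangle {L x s t : ℝ} (hx : x ∈ Set.Icc 0 L) (hs : s ∈ Set.Icc 0 L)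
    (ht : t ∈ Set.Icc 0 L) : gap L x s ≤ gap L x t + gap L t s := by
  obtain ⟨hx0, hx1⟩ := hx
  obtain ⟨hs0, hs1⟩ := hs
  obtain ⟨ht0, ht1⟩ := ht
  unfold gap
  rcases abs_cases (x - s) with h | h <;> rcases abs_cases (x - t) with h' | h' <;>
    rcases abs_cases (t - s) with h'' | h'' <;>
    rcases min_cases |x - s| (L - |x - s|) with k | k <;>
    rcases min_cases |x - t| (L - |x - t|) with k' | k' <;>
    rcases min_cases |t - s| (L - |t - s|) with k'' | k'' <;> linarith

lemma gap_le_abs (L x t : ℝ) : gap L x t ≤ |x - t| := min_le_left _ _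

namespace ClassicalSystem

/-- The functions of the system are measurable and bounded. -/
structure Tame (Φ : ClassicalSystem) : Prop where
  length_pos : 0 < Φ.length
  measurable : ∀ k, Measurable (Φ.fn k)
  bounded : ∀ k, ∃ B, ∀ x ∈ Set.Icc 0 Φ.length, ‖Φ.fn k x‖ ≤ B

/-- The localization properties of an orthonormal system on which the divergence theorem rests. -/
structure Localizing (Φ : ClassicalSystem) : Prop extends Tame Φ where
  partialSum_one : ∀ j, ∀ x ∈ Set.Icc 0 Φ.length, Φ.partialSum (fun _ => 1) x j = 1
  kernel_bounded : ∀ r > 0, ∃ C, ∀ j, ∀ x ∈ Set.Icc 0 Φ.length, ∀ t ∈ Set.Icc 0 Φ.length,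
    r ≤ gap Φ.length x t → ‖Φ.kernel j x t‖ ≤ C
  -- `J` depends on `g`, `r` and `ε` but not on `x`; this uniformity lets one row of the matrix
  -- serve a whole set of points.
  localization : ∀ g : ℝ → ℂ, Measurable g → (∀ t, ‖g t‖ ≤ 1) → ∀ r > 0, ∀ ε > 0,
    ∃ J, ∀ j ≥ J, ∀ x ∈ Set.Icc 0 Φ.length,
      (∀ t ∈ Set.Icc 0 Φ.length, gap Φ.length x t < r → g t = 0) → ‖Φ.partialSum g x j‖ ≤ ε

variable {Φ : ClassicalSystem}

lemma Tame.integrableOn_mul_conj (h : Φ.Tame) {f : ℝ → ℂ} (hf : Measurable f)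
    (hf1 : ∀ t, ‖f t‖ ≤ 1) (k : ℕ) :
    IntegrableOn (fun t => f t * (starRingEnd ℂ) (Φ.fn k t)) (Set.Icc 0 Φ.length) := by
  obtain ⟨B, hB⟩ := h.bounded k
  refine IntegrableOn.of_bound measure_Icc_lt_top
    (hf.mul (Complex.continuous_conj.measurable.comp (h.measurable k))).aestronglyMeasurable B ?_
  filter_upwards [ae_restrict_mem measurableSet_Icc] with t ht
  rw [norm_mul, RCLike.norm_conj]
  have := hB t ht
  have := hf1 t
  calc ‖f t‖ * ‖Φ.fn k t‖ ≤ 1 * ‖Φ.fn k t‖ := by gcongr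
    _ ≤ B := by linarith

lemma Tame.coeff_eq (h : Φ.Tame) (f : ℝ → ℂ) (k : ℕ) :
    Φ.coeff f k = ∫ t in Set.Icc 0 Φ.length, f t * (starRingEnd ℂ) (Φ.fn k t) := by
  rw [coeff, intervalIntegral.integral_of_le h.length_pos.le, integral_Icc_eq_integral_Ioc]

lemma Tame.integrableOn_mul_kernel (h : Φ.Tame) {f : ℝ → ℂ} (hf : Measurable f)
    (hf1 : ∀ t, ‖f t‖ ≤ 1) (j : ℕ) (x : ℝ) :
    IntegrableOn (fun t => f t * Φ.kernel j x t) (Set.Icc 0 Φ.length) := by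
  simp only [kernel, Finset.mul_sum]
  refine integrable_finsetSum _ fun k _ => ?_
  refine ((h.integrableOn_mul_conj hf hf1 k).const_mul (Φ.fn k x)).congr (ae_of_all _ fun t => ?_)
  simp only; ring

lemma Tame.partialSum_eq (h : Φ.Tame) {f : ℝ → ℂ} (hf : Measurable f)
    (hf1 : ∀ t, ‖f t‖ ≤ 1) (x : ℝ) (j : ℕ) :
    Φ.partialSum f x j = ∫ t in Set.Icc 0 Φ.length, f t * Φ.kernel j x t := by
  simp only [kernel, Finset.mul_sum]
  rw [integral_finsetSum]
  · refine Finset.sum_congr rfl fun k _ => ?_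
    rw [h.coeff_eq, ← integral_mul_const]
    refine integral_congr_ae (ae_of_all _ fun t => ?_)
    simp only; ring
  · intro k _
    refine ((h.integrableOn_mul_conj hf hf1 k).const_mul (Φ.fn k x)).congr
      (ae_of_all _ fun t => ?_)
    simp only; ring

/-- The kernel `∑_{j < J} a_(n,j) D_j(x, ·)` of the truncated means. -/
def meanKernel (Φ : ClassicalSystem) (a : ℕ → ℕ → ℂ) (n J : ℕ) (x t : ℝ) : ℂ :=
  ∑ j ∈ Finset.range J, a n j * Φ.kernel j x t

lemma Localizing.integrableOn_mul_meanKernel (h : Φ.Localizing) {f : ℝ → ℂ} (hf : Measurable f)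
    (hf1 : ∀ t, ‖f t‖ ≤ 1) (a : ℕ → ℕ → ℂ) (n J : ℕ) (x : ℝ) :
    IntegrableOn (fun t => f t * Φ.meanKernel a n J x t) (Set.Icc 0 Φ.length) := by
  simp only [meanKernel, Finset.mul_sum]
  refine integrable_finsetSum _ fun k _ => ?_
  refine ((h.integrableOn_mul_kernel hf hf1 k x).const_mul (a n k)).congr
    (ae_of_all _ fun t => ?_)
  simp only; ring

lemma Localizing.mean_eq (h : Φ.Localizing) {f : ℝ → ℂ} (hf : Measurable f)
    (hf1 : ∀ t, ‖f t‖ ≤ 1) (a : ℕ → ℕ → ℂ) (n J : ℕ) (x : ℝ) :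
    ∑ j ∈ Finset.range J, a n j * Φ.partialSum f x j =
      ∫ t in Set.Icc 0 Φ.length, f t * Φ.meanKernel a n J x t := by
  simp only [meanKernel, Finset.mul_sum]
  rw [integral_finsetSum]
  · refine Finset.sum_congr rfl fun k _ => ?_
    rw [h.partialSum_eq hf hf1, ← integral_const_mul]
    refine integral_congr_ae (ae_of_all _ fun t => ?_)
    simp only; ring
  · intro k _
    refine ((h.integrableOn_mul_kernel hf hf1 k x).const_mul (a n k)).congr
      (ae_of_all _ fun t => ?_)
    simp only; ring

/-- The partial sums of the Fourier series of an indicator function. -/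
abbrev setSum (Φ : ClassicalSystem) (F : Set ℝ) (x : ℝ) (j : ℕ) : ℂ :=
  Φ.partialSum (F.indicator fun _ => 1) x j

lemma measurable_indicator_one {F : Set ℝ} (hF : MeasurableSet F) :
    Measurable (F.indicator fun _ => (1 : ℂ)) := measurable_const.indicator hF

lemma norm_indicator_one_le (F : Set ℝ) (t : ℝ) : ‖F.indicator (fun _ => (1 : ℂ)) t‖ ≤ 1 := by
  by_cases h : t ∈ F <;> simp [h]

/-- Changing a set inside `A` changes the truncated means by at most the integral of the kernel
over `A`. -/
lemma Localizing.mean_sub_le (h : Φ.Localizing) {F F' A : Set ℝ} (hF : MeasurableSet F)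
    (hF' : MeasurableSet F') (hA : MeasurableSet A)
    (hFF' : ∀ t ∈ Set.Icc 0 Φ.length, t ∉ A → (t ∈ F ↔ t ∈ F')) (a : ℕ → ℕ → ℂ) (n J : ℕ) (x : ℝ) :
    ‖∑ j ∈ Finset.range J, a n j * Φ.setSum F x j -
      ∑ j ∈ Finset.range J, a n j * Φ.setSum F' x j‖ₑ ≤
      ∫⁻ t in A ∩ Set.Icc 0 Φ.length, ‖Φ.meanKernel a n J x t‖ₑ := by
  rw [h.mean_eq (measurable_indicator_one hF) (norm_indicator_one_le F),
    h.mean_eq (measurable_indicator_one hF') (norm_indicator_one_le F'),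
    ← integral_sub
      (h.integrableOn_mul_meanKernel (measurable_indicator_one hF) (norm_indicator_one_le F) ..)
      (h.integrableOn_mul_meanKernel (measurable_indicator_one hF') (norm_indicator_one_le F') ..)]
  refine (enorm_integral_le_lintegral_enorm _).trans ?_
  rw [← Measure.restrict_restrict hA, ← lintegral_indicator hA]
  refine lintegral_mono_ae ?_
  filter_upwards [ae_restrict_mem measurableSet_Icc] with t ht
  by_cases ht' : t ∈ A
  · rw [Set.indicator_of_mem ht', ← sub_mul, enorm_mul]
    refine mul_le_of_le_one_left' ?_
    by_cases h1 : t ∈ F <;> by_cases h2 : t ∈ F' <;> simp [h1, h2]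
  · have := hFF' t ht ht'
    by_cases h1 : t ∈ F
    · simp [h1, this.1 h1]
    · simp [h1, mt this.2 h1]

/-- The hypothesis on the kernels in terms of lower integrals, which are countably subadditive in
the domain without integrability side conditions. -/
lemma Localizing.lintegral_meanKernel_le (h : Φ.Localizing) {a : ℕ → ℕ → ℂ}
    (hK : HasIntegrableKernels Φ a) (n : ℕ) {ε : ℝ} (hε : 0 < ε) :
    ∃ δ > 0, ∀ J, ∀ x ∈ Set.Icc 0 Φ.length, ∀ A, MeasurableSet A →
      volume A ≤ ENNReal.ofReal δ →
      ∫⁻ t in A ∩ Set.Icc 0 Φ.length, ‖Φ.meanKernel a n J x t‖ₑ ≤ ENNReal.ofReal ε := by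
  obtain ⟨δ, hδ, H⟩ := hK n ε hε
  refine ⟨δ, hδ, fun J x hx A hA hAδ => ?_⟩
  have h1 := H J x hx (A ∩ Set.Icc 0 Φ.length) Set.inter_subset_right
    (hA.inter measurableSet_Icc) ((measure_mono Set.inter_subset_left).trans hAδ)
  have h2 : IntegrableOn (fun t => Φ.meanKernel a n J x t) (A ∩ Set.Icc 0 Φ.length) := by
    have := h.integrableOn_mul_meanKernel (f := fun _ => 1) measurable_const (by simp) a n J x
    simp only [one_mul] at this
    exact this.mono_set Set.inter_subset_right
  rw [← ofReal_integral_norm_eq_lintegral_enorm h2]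
  exact ENNReal.ofReal_le_ofReal h1

/-- Where `g` does not vanish, the kernel is evaluated only at distance at least `r` from the
diagonal, so its uniform bound there can be integrated. -/
lemma Localizing.norm_partialSum_le (h : Φ.Localizing) {r : ℝ} (hr : 0 < r) :
    ∃ C, ∀ g : ℝ → ℂ, Measurable g → (∀ t, ‖g t‖ ≤ 1) → ∀ j, ∀ x ∈ Set.Icc 0 Φ.length,
      (∀ t ∈ Set.Icc 0 Φ.length, gap Φ.length x t < r → g t = 0) → ‖Φ.partialSum g x j‖ ≤ C := by
  obtain ⟨C, hC⟩ := h.kernel_bounded r hr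
  -- If no two points are at distance `r`, the bound `C` carries no information and may be negative.
  refine ⟨max C 0 * volume.real (Set.Icc 0 Φ.length), fun g hg hg1 j x hx hgx => ?_⟩
  rw [h.partialSum_eq hg hg1]
  refine norm_setIntegral_le_of_norm_le_const measure_Icc_lt_top fun t ht => ?_
  rcases lt_or_ge (gap Φ.length x t) r with h1 | h1
  · simp [hgx t ht h1]
  · rw [norm_mul]
    calc ‖g t‖ * ‖Φ.kernel j x t‖ ≤ 1 * max C 0 :=
          mul_le_mul (hg1 t) ((hC j x hx t ht h1).trans (le_max_left _ _)) (norm_nonneg _) one_pos.le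
      _ = max C 0 := one_mul _

/-- The partial sums of an indicator function split off any constant `v`. -/
lemma Localizing.setSum_eq (h : Φ.Localizing) {F : Set ℝ} (hF : MeasurableSet F) (v : ℂ)
    (hv : ∀ t, ‖F.indicator (fun _ => (1 : ℂ)) t - v‖ ≤ 1) (hv1 : ‖v‖ ≤ 1)
    {x : ℝ} (hx : x ∈ Set.Icc 0 Φ.length) (j : ℕ) :
    Φ.setSum F x j = v + Φ.partialSum (fun t => F.indicator (fun _ => (1 : ℂ)) t - v) x j := by
  have hm := measurable_indicator_one hF
  have h1 := h.partialSum_one j x hx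
  rw [h.partialSum_eq measurable_const (by simp)] at h1
  rw [setSum, h.partialSum_eq hm (norm_indicator_one_le F),
    h.partialSum_eq (hm.sub_const v) hv]
  simp only [sub_mul]
  rw [integral_sub (h.integrableOn_mul_kernel hm (norm_indicator_one_le F) j x)
    (h.integrableOn_mul_kernel (f := fun _ => v) measurable_const (fun _ => hv1) j x),
    integral_const_mul]
  simp only [one_mul] at h1
  rw [h1]; ring

/-- The number `1` or `0`. -/
def bval (b : Bool) : ℂ := if b then 1 else 0

lemma norm_bval_le (b : Bool) : ‖bval b‖ ≤ 1 := by cases b <;> simp [bval]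

lemma norm_indicator_sub_bval_le (F : Set ℝ) (b : Bool) (t : ℝ) :
    ‖F.indicator (fun _ => (1 : ℂ)) t - bval b‖ ≤ 1 := by
  by_cases h : t ∈ F <;> cases b <;> simp [h, bval]

lemma indicator_sub_bval_eq_zero {F : Set ℝ} {b : Bool} {t : ℝ} (h : t ∈ F ↔ b = true) :
    F.indicator (fun _ => (1 : ℂ)) t - bval b = 0 := by
  cases b <;> simp_all [bval]

/-- The function 1_F - b vanishes near `x`, and the constant b is reproduced exactly, so
localization applies to the difference. -/
lemma Localizing.tendsto_setSum (h : Φ.Localizing) {F : Set ℝ} (hF : MeasurableSet F) (b : Bool)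
    {r : ℝ} (hr : 0 < r) {x : ℝ} (hx : x ∈ Set.Icc 0 Φ.length)
    (hxF : ∀ t ∈ Set.Icc 0 Φ.length, gap Φ.length x t < r → (t ∈ F ↔ b = true)) :
    Tendsto (Φ.setSum F x) atTop (𝓝 (bval b)) := by
  rw [Metric.tendsto_atTop]
  intro ε hε
  obtain ⟨J, hJ⟩ := h.localization _ ((measurable_indicator_one hF).sub_const (bval b))
    (norm_indicator_sub_bval_le F b) r hr (ε / 2) (half_pos hε)
  refine ⟨J, fun j hj => ?_⟩
  rw [h.setSum_eq hF (bval b) (norm_indicator_sub_bval_le F b) (norm_bval_le b) hx j,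
    dist_eq_norm, add_sub_cancel_left]
  exact (hJ j hj x hx fun t ht htr => indicator_sub_bval_eq_zero (hxF t ht htr)).trans_lt
    (half_lt_self hε)

/-- The threshold for `n` is independent of `x`: off the first `J₀` indices the partial sums of 1_F
- b are uniformly small, and on these indices they are uniformly bounded while the columns tend to
0. The truncation index `J` is eventual because rows may be infinite. -/
lemma Localizing.eventually_mean_le (h : Φ.Localizing) {a : ℕ → ℕ → ℂ} (ha : IsRegularMethod a)
    {F : Set ℝ} (hF : MeasurableSet F) (b : Bool) {r ε : ℝ} (hr : 0 < r) (hε : 0 < ε) :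
    ∀ᶠ n in atTop, ∀ x ∈ Set.Icc 0 Φ.length,
      (∀ t ∈ Set.Icc 0 Φ.length, gap Φ.length x t < r → (t ∈ F ↔ b = true)) →
      ∀ᶠ J in atTop, ‖∑ j ∈ Finset.range J, a n j * Φ.setSum F x j - bval b‖ ≤ ε := by
  obtain ⟨M, hM, hM'⟩ := ha.exists_row_bound
  obtain ⟨C, hC⟩ := h.norm_partialSum_le hr
  obtain ⟨J₀, hJ₀⟩ := h.localization _ ((measurable_indicator_one hF).sub_const (bval b))
    -- The budget: 2 · ε/4 for the difference 1_F - b, and ε/4 each for truncating the row and for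
    -- the row sum applied to b.
    (norm_indicator_sub_bval_le F b) r hr (ε / 4 / M) (by positivity)
  obtain ⟨σ, hσ, hσl⟩ := ha (fun _ => bval b) (bval b) tendsto_const_nhds
  have h1 : ∀ᶠ n in atTop, ‖σ n - bval b‖ < ε / 4 := by
    simpa [dist_eq_norm] using Metric.tendsto_nhds.1 hσl (ε / 4) (by positivity)
  filter_upwards [h1, ha.exists_mean_le hM hM' J₀ C (ε := ε / 4) (by positivity)] with n hn hs x hx hxF
  have hg : ∀ t ∈ Set.Icc 0 Φ.length, gap Φ.length x t < r →
      F.indicator (fun _ => (1 : ℂ)) t - bval b = 0 := fun t ht htr =>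
    indicator_sub_bval_eq_zero (hxF t ht htr)
  have h2 : ∀ᶠ J in atTop, ‖∑ j ∈ Finset.range J, a n j * bval b - σ n‖ < ε / 4 := by
    simpa [dist_eq_norm] using Metric.tendsto_nhds.1 (hσ n) (ε / 4) (by positivity)
  filter_upwards [h2] with J hJ
  have h3 := hs (fun j => Φ.partialSum (fun t => F.indicator (fun _ => (1 : ℂ)) t - bval b) x j)
    (fun j => hC _ ((measurable_indicator_one hF).sub_const (bval b))
      (norm_indicator_sub_bval_le F b) j x hx hg)
    (fun j hj => hJ₀ j hj x hx hg) J
  simp only [h.setSum_eq hF (bval b) (norm_indicator_sub_bval_le F b) (norm_bval_le b) hx,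
    mul_add, Finset.sum_add_distrib]
  calc _ = ‖(∑ j ∈ Finset.range J, a n j * bval b - σ n) + (σ n - bval b) +
        ∑ j ∈ Finset.range J, a n j *
          Φ.partialSum (fun t => F.indicator (fun _ => (1 : ℂ)) t - bval b) x j‖ := by
        congr 1; ring
    _ ≤ ε / 4 + ε / 4 + 2 * (ε / 4) := 
        norm_add_le_of_le (norm_add_le_of_le hJ.le hn.le) h3
    _ = ε := by ring


/-! ### Covering the null set by thin open sets -/

/-- The points whose neighbourhood of radius `1 / (m + 1)` on the circle is contained in `G`. -/
def core (Φ : ClassicalSystem) (G : Set ℝ) (m : ℕ) : Set ℝ :=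
  {x ∈ Set.Icc 0 Φ.length | ∀ t ∈ Set.Icc 0 Φ.length, gap Φ.length x t < 1 / (m + 1 : ℝ) → t ∈ G}

lemma exists_mem_core {G : Set ℝ} (hG : IsOpen G) (h0 : 0 ∈ G)
    (hL : Φ.length ∈ G) {x : ℝ} (hx : x ∈ Set.Icc 0 Φ.length) (hxG : x ∈ G) :
    ∃ m, x ∈ Φ.core G m := by
  obtain ⟨r₁, hr₁, h₁⟩ := Metric.isOpen_iff.1 hG x hxG
  obtain ⟨r₂, hr₂, h₂⟩ := Metric.isOpen_iff.1 hG 0 h0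
  obtain ⟨r₃, hr₃, h₃⟩ := Metric.isOpen_iff.1 hG _ hL
  obtain ⟨m, hm⟩ := exists_nat_one_div_lt (lt_min hr₁ (lt_min hr₂ hr₃))
  refine ⟨m, hx, fun t ht htx => ?_⟩
  have h4 := htx.trans hm
  have k1 : gap Φ.length x t < r₁ := h4.trans_le (min_le_left _ _)
  have k2 : gap Φ.length x t < r₂ := h4.trans_le ((min_le_right _ _).trans (min_le_left _ _))
  have k3 : gap Φ.length x t < r₃ := h4.trans_le ((min_le_right _ _).trans (min_le_right _ _))
  obtain ⟨hx0, hx1⟩ := hx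
  obtain ⟨ht0, ht1⟩ := ht
  unfold gap at k1 k2 k3
  rcases min_cases |x - t| (Φ.length - |x - t|) with k | k
  · refine h₁ ?_
    rw [Metric.mem_ball, Real.dist_eq, abs_sub_comm]
    linarith
  · rcases abs_cases (x - t) with k' | k'
    · refine h₂ ?_
      rw [Metric.mem_ball, Real.dist_eq, sub_zero, abs_of_nonneg ht0]
      linarith
    · refine h₃ ?_
      rw [Metric.mem_ball, Real.dist_eq, abs_of_nonpos (by linarith)]
      linarith

lemma gap_lt_imp_mem_core {G : Set ℝ} {m m' : ℕ} {x t : ℝ} (hx : x ∈ Φ.core G m)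
    (ht : t ∈ Set.Icc 0 Φ.length)
    (hxt : gap Φ.length x t ≤ 1 / (m + 1 : ℝ) - 1 / (m' + 1 : ℝ)) : t ∈ Φ.core G m' := by
  refine ⟨ht, fun s hs hts => hx.2 s hs ?_⟩
  have := gap_triangle hx.1 hs ht
  linarith

lemma one_div_sub_pos (m : ℕ) : 0 < 1 / (m + 1 : ℝ) - 1 / ((m + 1 : ℕ) + 1 : ℝ) := by
  rw [sub_pos]
  push_cast
  apply one_div_lt_one_div_of_lt <;> linarith [(Nat.cast_nonneg m : (0:ℝ) ≤ m)]

/-- The integral over `A` of the absolute value of the kernel of the truncated means. -/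
abbrev weight (Φ : ClassicalSystem) (a : ℕ → ℕ → ℂ) (n J : ℕ) (x : ℝ) (A : Set ℝ) : ENNReal :=
  ∫⁻ t in A ∩ Set.Icc 0 Φ.length, ‖Φ.meanKernel a n J x t‖ₑ

/-- Away from the diagonal the kernels of the means are bounded by (row bound) · (bound of the D_j),
so one `δ` works for all rows simultaneously. -/
lemma Localizing.weight_le_of_gap (h : Φ.Localizing) {a : ℕ → ℕ → ℂ} (ha : IsRegularMethod a)
    {r : ℝ} (hr : 0 < r) {e : ENNReal} (he : 0 < e) :
    ∃ δ > (0 : ENNReal), ∀ n J, ∀ x ∈ Set.Icc 0 Φ.length, ∀ A, MeasurableSet A → volume A ≤ δ →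
      (∀ t ∈ A ∩ Set.Icc 0 Φ.length, r ≤ gap Φ.length x t) → Φ.weight a n J x A ≤ e := by
  obtain ⟨M, hM, hM'⟩ := ha.exists_row_bound
  obtain ⟨C, hC⟩ := h.kernel_bounded r hr
  set B : ℝ := M * max C 1 with hB
  have hB0 : 0 < B := by positivity
  refine ⟨e / ENNReal.ofReal B, ENNReal.div_pos he.ne' ENNReal.ofReal_ne_top,
    fun n J x hx A hA hAδ hAr => ?_⟩
  calc Φ.weight a n J x A ≤ ∫⁻ t in A ∩ Set.Icc 0 Φ.length, ENNReal.ofReal B := by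
        refine setLIntegral_mono' (hA.inter measurableSet_Icc) fun t ht => ?_
        rw [← ofReal_norm]
        refine ENNReal.ofReal_le_ofReal ?_
        calc ‖Φ.meanKernel a n J x t‖ ≤ ∑ j ∈ Finset.range J, ‖a n j‖ * max C 1 := by
              refine (norm_sum_le _ _).trans (Finset.sum_le_sum fun j _ => ?_)
              rw [norm_mul]
              gcongr
              exact (hC j x hx t ht.2 (hAr t ht)).trans (le_max_left _ _)
          _ ≤ B := by 
              rw [← Finset.sum_mul]
              exact mul_le_mul_of_nonneg_right (hM' n J) (by positivity)
    _ = ENNReal.ofReal B * volume (A ∩ Set.Icc 0 Φ.length) := setLIntegral_const _ _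
    _ ≤ ENNReal.ofReal B * (e / ENNReal.ofReal B) := by
        gcongr
        exact (measure_mono Set.inter_subset_left).trans hAδ
    _ ≤ e := ENNReal.mul_div_le

/-- One refinement step: a null set is covered by a small open set which hardly influences
certain means of the given set `F`. -/
lemma Localizing.exists_refinement (h : Φ.Localizing) {a : ℕ → ℕ → ℂ} (ha : IsRegularMethod a)
    (hK : HasIntegrableKernels Φ a) {E : Set ℝ} (hE : E ⊆ Set.Icc 0 Φ.length)
    (hE0 : volume E = 0) (h0 : 0 ∈ E) (hL : Φ.length ∈ E) {G F : Set ℝ} (hG : IsOpen G)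
    (hEG : E ⊆ G) (hF : MeasurableSet F) (b : Bool) (hb : ∀ x ∈ G, x ∈ F ↔ b = true)
    {ε : ℝ} (hε : 0 < ε) (k : ℕ) :
    ∃ G', IsOpen G' ∧ E ⊆ G' ∧ G' ⊆ G ∧ volume G' ≤ ENNReal.ofReal ε ∧ ∀ x ∈ E, ∃ n ≥ k,
      (∀ᶠ J in atTop, ‖∑ j ∈ Finset.range J, a n j * Φ.setSum F x j - bval b‖ ≤ ε) ∧
      ∀ J, Φ.weight a n J x G' ≤ ENNReal.ofReal ε := by
  -- One row per core: on the `m`-th core `F` is constant in a neighbourhood of fixed radius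
  -- 1/(m+1).
  have hN : ∀ m : ℕ, ∃ n ≥ k, ∀ x ∈ Φ.core G m,
      ∀ᶠ J in atTop, ‖∑ j ∈ Finset.range J, a n j * Φ.setSum F x j - bval b‖ ≤ ε := by
    intro m
    obtain ⟨n, hn, hnk⟩ := ((h.eventually_mean_le ha hF b (r := 1 / (m + 1 : ℝ)) (by positivity)
      hε).and (eventually_ge_atTop k)).exists
    exact ⟨n, hnk, fun x hx => hn x hx.1 fun t ht htx => hb t (hx.2 t ht htx)⟩
  choose N hNk hN using hN
  obtain ⟨e, he, hesum⟩ := ENNReal.exists_pos_sum_of_countable'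
    (ENNReal.ofReal_pos.2 hε).ne' ℕ
  -- The `m`-th piece below lies in core m+1. A point outside core m+2 has at least the distance
  -- 1/(m+2) - 1/(m+3) from it.
  have hfar : ∀ m : ℕ, ∃ δ > (0 : ENNReal), ∀ n J, ∀ x ∈ Set.Icc 0 Φ.length, ∀ A,
      MeasurableSet A → volume A ≤ δ →
      (∀ t ∈ A ∩ Set.Icc 0 Φ.length,
        1 / ((m + 1 : ℕ) + 1 : ℝ) - 1 / ((m + 1 + 1 : ℕ) + 1 : ℝ) ≤ gap Φ.length x t) →
      Φ.weight a n J x A ≤ e m :=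
    fun m => h.weight_le_of_gap ha (one_div_sub_pos (m + 1)) (he m)
  choose δ hδ hfar using hfar
  have hnear : ∀ m i : ℕ, ∃ η > (0 : ENNReal), ∀ J, ∀ x ∈ Set.Icc 0 Φ.length, ∀ A,
      MeasurableSet A → volume A ≤ η → Φ.weight a (N i) J x A ≤ e m := by
    intro m i
    obtain ⟨c, hc0, hce⟩ := ENNReal.lt_iff_exists_nnreal_btwn.1 (he m)
    have hc0' : (0 : ℝ) < c := by exact_mod_cast hc0
    obtain ⟨d, hd, H⟩ := h.lintegral_meanKernel_le hK (N i) hc0'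
    refine ⟨ENNReal.ofReal d, ENNReal.ofReal_pos.2 hd, fun J x hx A hA hAd => ?_⟩
    refine (H J x hx A hA hAd).trans ?_
    rw [ENNReal.ofReal_coe_nnreal]
    exact hce.le
  choose η hη hnear using hnear
  -- The `m`-th piece has to be small for the finitely many rows `N i` with i < m+3, those whose
  -- points it may approach, and small enough for the distant estimate, which covers all other rows.
  let ρ : ℕ → ENNReal := fun m => min (min (e m) (δ m)) ((Finset.range (m + 3)).inf' ⟨0, by simp⟩ (η m))
  have hρ : ∀ m, 0 < ρ m := fun m => by
    exact lt_min (lt_min (he m) (hδ m)) ((Finset.lt_inf'_iff _).2 fun i _ => hη m i)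
  have hV : ∀ m : ℕ, ∃ U, E ⊆ U ∧ IsOpen U ∧ volume U ≤ ρ m := by
    intro m
    obtain ⟨U, hEU, hU, hUρ⟩ := E.exists_isOpen_lt_of_lt (ρ m) (by rw [hE0]; exact hρ m)
    exact ⟨U, hEU, hU, hUρ.le⟩
  choose U hEU hU hUρ using hV
  -- The thickening radius is the difference of the radii of cores m and m+1, so that within the
  -- interval the piece stays inside core m+1.
  let V : ℕ → Set ℝ := fun m =>
    U m ∩ (G ∩ Metric.thickening (1 / (m + 1 : ℝ) - 1 / ((m + 1 : ℕ) + 1 : ℝ)) (Φ.core G m))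
  have hVo : ∀ m, IsOpen (V m) := fun m => (hU m).inter (hG.inter Metric.isOpen_thickening)
  have hVρ : ∀ m, volume (V m) ≤ ρ m := fun m =>
    (measure_mono Set.inter_subset_left).trans (hUρ m)
  have hVcore : ∀ m, ∀ t ∈ V m ∩ Set.Icc 0 Φ.length, t ∈ Φ.core G (m + 1) := by
    rintro m t ⟨⟨-, -, ht⟩, ht'⟩
    obtain ⟨x, hx, hxt⟩ := Metric.mem_thickening_iff.1 ht
    refine gap_lt_imp_mem_core hx ht' ((gap_le_abs _ _ _).trans ?_)
    rw [dist_comm, Real.dist_eq] at hxt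
    exact hxt.le
  refine ⟨⋃ m, V m, isOpen_iUnion hVo, fun x hx => ?_, ?_, ?_, fun x hx => ?_⟩
  · obtain ⟨m, hm⟩ := exists_mem_core hG (hEG h0) (hEG hL) (hE hx) (hEG hx)
    exact Set.mem_iUnion.2 ⟨m, hEU m hx, hEG hx, Metric.self_subset_thickening (one_div_sub_pos m) _ hm⟩
  · exact Set.iUnion_subset fun m => Set.inter_subset_right.trans Set.inter_subset_left
  · calc volume (⋃ m, V m) ≤ ∑' m, volume (V m) := measure_iUnion_le _
      _ ≤ ∑' m, e m := ENNReal.tsum_le_tsum fun m =>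
        (hVρ m).trans ((min_le_left _ _).trans (min_le_left _ _))
      _ ≤ _ := hesum.le
  · have hex := exists_mem_core hG (hEG h0) (hEG hL) (hE hx) (hEG hx)
    classical
    -- The index of the first core containing `x` decides the row. Minimality keeps `x` away from
    -- the pieces with m+3 ≤ p, since a point too close to core m+1 would already lie in core m+2.
    let p := Nat.find hex
    have hp : x ∈ Φ.core G p := Nat.find_spec hex
    refine ⟨N p, hNk p, hN p x hp, fun J => ?_⟩
    calc Φ.weight a (N p) J x (⋃ m, V m) ≤ ∑' m, Φ.weight a (N p) J x (V m) := by
          unfold weight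
          rw [Set.iUnion_inter]
          exact lintegral_iUnion_le _ _
      _ ≤ ∑' m, e m := ENNReal.tsum_le_tsum fun m => ?_
      _ ≤ _ := hesum.le
    by_cases hpm : p < m + 3
    · refine hnear m p J x (hE hx) (V m) (hVo m).measurableSet ((hVρ m).trans ?_)
      exact (min_le_right _ _).trans (Finset.inf'_le _ (Finset.mem_range.2 hpm))
    · refine hfar m (N p) J x (hE hx) (V m) (hVo m).measurableSet ((hVρ m).trans
        ((min_le_left _ _).trans (min_le_right _ _))) fun t ht => ?_
      by_contra! hlt
      have hm2 : m + 1 + 1 < p := by omega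
      refine Nat.find_min hex hm2 (gap_lt_imp_mem_core (hVcore m t ht) (hE hx) ?_)
      rw [gap_comm]
      exact hlt.le

/-! ### The inductive construction and divergence -/

/-- The data of the inductive construction: an open set `G ⊇ E` on which membership in the
measurable set `F` is decided by `b`. -/
structure Stage (E : Set ℝ) where
  G : Set ℝ
  F : Set ℝ
  b : Bool
  isOpen : IsOpen G
  subset : E ⊆ G
  meas : MeasurableSet F
  iff : ∀ x ∈ G, x ∈ F ↔ b = true

/-- The refined neighbourhood is removed from the set if the current value is 1 and added to it if
the value is 0; the row estimates concern the set before this change. -/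
lemma Localizing.exists_stage (h : Φ.Localizing) {a : ℕ → ℕ → ℂ} (ha : IsRegularMethod a)
    (hK : HasIntegrableKernels Φ a) {E : Set ℝ} (hE : E ⊆ Set.Icc 0 Φ.length)
    (hE0 : volume E = 0) (h0 : 0 ∈ E) (hL : Φ.length ∈ E) (k : ℕ) (s : Stage E) :
    ∃ s' : Stage E, s'.G ⊆ s.G ∧ s'.b = !s.b ∧ (∀ x ∉ s'.G, x ∈ s'.F ↔ x ∈ s.F) ∧
      volume s'.G ≤ ENNReal.ofReal (1 / (k + 1 : ℝ)) ∧ ∀ x ∈ E, ∃ n ≥ k,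
      (∀ᶠ J in atTop, ‖∑ j ∈ Finset.range J, a n j * Φ.setSum s.F x j - bval s.b‖ ≤
        1 / (k + 1 : ℝ)) ∧
      ∀ J, Φ.weight a n J x s'.G ≤ ENNReal.ofReal (1 / (k + 1 : ℝ)) := by
  obtain ⟨G', hG', hEG', hG'G, hvol, H⟩ := h.exists_refinement ha hK hE hE0 h0 hL s.isOpen s.subset
    s.meas s.b s.iff (ε := 1 / (k + 1 : ℝ)) (by positivity) k
  refine ⟨⟨G', if s.b then s.F \ G' else s.F ∪ G', !s.b, hG', hEG', ?_, ?_⟩, hG'G, rfl, ?_, hvol, H⟩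
  · split_ifs
    · exact s.meas.diff hG'.measurableSet
    · exact s.meas.union hG'.measurableSet
  · intro x hx
    cases hb : s.b <;> simp [hx]
  · intro x hx
    cases hb : s.b <;> simp_all

/-- Iterating the stages gives a limit set whose means approach the alternating values at every
point of `E`. Convergence of each individual mean is a separate matter, since a row may be infinite
and the partial sums of the limit set need not converge. -/
theorem Localizing.exists_divergence (h : Φ.Localizing) {a : ℕ → ℕ → ℂ} (ha : IsRegularMethod a)
    (hK : HasIntegrableKernels Φ a) {E : Set ℝ} (hE : E ⊆ Set.Icc 0 Φ.length)
    (hE0 : volume E = 0) :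
    ∃ G : Set ℝ, G ⊆ Set.Icc 0 Φ.length ∧ MeasurableSet G ∧
      ∀ x ∈ E, ∃ σ : ℕ → ℂ, IsMeans a (Φ.partialSum (G.indicator fun _ => 1) x) σ ∧
        ¬ ∃ l : ℂ, Tendsto σ atTop (𝓝 l) := by
  -- The endpoints are adjoined so that every neighbourhood of `E` is also one on the circle.
  wlog hends : 0 ∈ E ∧ Φ.length ∈ E generalizing E
  · obtain ⟨G, hG, hGm, H⟩ := this (E := E ∪ {0, Φ.length}) (Set.union_subset hE (by
        rintro x (rfl | rfl)
        · exact ⟨le_rfl, h.length_pos.le⟩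
        · exact ⟨h.length_pos.le, le_rfl⟩))
      (measure_union_null hE0 (Set.Finite.measure_zero (by simp) _)) (by simp)
    exact ⟨G, hG, hGm, fun x hx => H x (Or.inl hx)⟩
  obtain ⟨h0, hL⟩ := hends
  choose next hnextG hnextb hnextF hnextvol hnext using
    fun k s => h.exists_stage ha hK hE hE0 h0 hL k s
  let s₀ : Stage E := ⟨Set.univ, ∅, false, isOpen_univ, Set.subset_univ _, MeasurableSet.empty,
    by simp⟩
  let S : ℕ → Stage E := fun k => Nat.rec s₀ (fun k s => next k s) k
  have hS : ∀ k, S (k + 1) = next k (S k) := fun k => rfl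
  have hanti : Antitone fun k => (S k).G := antitone_nat_of_succ_le fun k => hnextG k (S k)
  have hagree : ∀ k m, ∀ x ∉ (S (k + 1)).G, x ∈ (S (k + m)).F ↔ x ∈ (S k).F := by
    intro k m x hx
    induction m with
    | zero => rfl
    | succ m ih =>
      rw [← ih, ← add_assoc, hS]
      refine hnextF _ _ x fun hx' => hx (hanti (show k + 1 ≤ k + m + 1 by omega) ?_)
      exact hx'
  have hb : ∀ k, (S (k + 1)).b = !(S k).b := fun k => hnextb k (S k)
  -- Membership of a point outside the (k+1)-st neighbourhood is frozen from stage `k` on. The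
  -- points that are never frozen form a null set, on which the lower limit is one measurable
  -- choice.
  let F : Set ℝ := {x | ∀ᶠ k in atTop, x ∈ (S k).F}
  have hFm : MeasurableSet F := by
    have : F = ⋃ i, ⋂ k, ⋂ (_ : i ≤ k), (S k).F := by
      ext x; simp [F, eventually_atTop]
    rw [this]
    exact MeasurableSet.iUnion fun i => MeasurableSet.iInter fun k => MeasurableSet.iInter fun _ =>
      (S k).meas
  have hF : ∀ k, ∀ x ∉ (S (k + 1)).G, x ∈ F ↔ x ∈ (S k).F := by
    intro k x hx
    constructor
    · intro hxF
      obtain ⟨m, hm⟩ := eventually_atTop.1 hxF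
      exact (hagree k m x hx).1 (hm _ (by omega))
    · intro hxF
      refine eventually_atTop.2 ⟨k, fun m hm => ?_⟩
      obtain ⟨d, rfl⟩ := Nat.exists_eq_add_of_le hm
      exact (hagree k d x hx).2 hxF
  have hGm : MeasurableSet (F ∩ Set.Icc 0 Φ.length) := hFm.inter measurableSet_Icc
  have hdiff : ∀ n J k x, ‖∑ j ∈ Finset.range J, a n j * Φ.setSum (F ∩ Set.Icc 0 Φ.length) x j -
      ∑ j ∈ Finset.range J, a n j * Φ.setSum (S k).F x j‖ₑ ≤ Φ.weight a n J x (S (k + 1)).G := by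
    intro n J k x
    refine h.mean_sub_le hGm (S k).meas (S (k + 1)).isOpen.measurableSet (fun t ht ht' => ?_) a n J x
    rw [← hF k t ht']
    exact ⟨fun H => H.1, fun H => ⟨H, ht⟩⟩
  refine ⟨F ∩ Set.Icc 0 Φ.length, Set.inter_subset_right, hGm, fun x hx => ?_⟩
  have hdiff' : ∀ n J k, ∀ c > (0 : ℝ), Φ.weight a n J x (S (k + 1)).G ≤ ENNReal.ofReal c →
      ‖∑ j ∈ Finset.range J, a n j * Φ.setSum (F ∩ Set.Icc 0 Φ.length) x j -
        ∑ j ∈ Finset.range J, a n j * Φ.setSum (S k).F x j‖ ≤ c := by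
    intro n J k c hc hw
    have := (hdiff n J k x).trans hw
    rw [← ofReal_norm] at this
    exact (ENNReal.ofReal_le_ofReal_iff hc.le).1 this
  -- For a fixed row, uniform integrability makes the replacement of the limit set by a late stage
  -- cost at most ε/4 for all truncations `J` at once. At that stage the partial sums converge,
  -- hence so do the truncated means, and the Cauchy property carries over.
  have hconv : ∀ n, ∃ l, Tendsto (fun J => ∑ j ∈ Finset.range J,
      a n j * Φ.setSum (F ∩ Set.Icc 0 Φ.length) x j) atTop (𝓝 l) := by
    intro n
    refine cauchySeq_tendsto_of_complete (Metric.cauchySeq_iff'.2 fun ε hε => ?_)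
    obtain ⟨δ, hδ, H⟩ := h.lintegral_meanKernel_le hK n (ε := ε / 4) (by positivity)
    obtain ⟨k, hk⟩ := exists_nat_one_div_lt hδ
    have hw : ∀ J, Φ.weight a n J x (S (k + 1)).G ≤ ENNReal.ofReal (ε / 4) := fun J =>
      H J x (hE hx) _ (S (k + 1)).isOpen.measurableSet
        ((hnextvol k (S k)).trans (ENNReal.ofReal_le_ofReal hk.le))
    obtain ⟨m, hm⟩ := exists_mem_core (S k).isOpen ((S k).subset h0) ((S k).subset hL) (hE hx)
      ((S k).subset hx)
    have ht := h.tendsto_setSum (S k).meas (S k).b (r := 1 / (m + 1 : ℝ)) (by positivity) (hE hx)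
      fun t ht htx => (S k).iff t (hm.2 t ht htx)
    obtain ⟨σ, hσ, -⟩ := ha _ _ ht
    obtain ⟨J₀, hJ₀⟩ := Metric.cauchySeq_iff'.1 (hσ n).cauchySeq (ε / 4) (by positivity)
    refine ⟨J₀, fun J hJ => ?_⟩
    have k1 := hdiff' n J k _ (by positivity) (hw J)
    have k2 := hdiff' n J₀ k _ (by positivity) (hw J₀)
    have k3 := hJ₀ J hJ
    rw [← dist_eq_norm] at k1 k2
    rw [dist_comm] at k2
    calc _ ≤ _ := dist_triangle4 _ _ _ _
      _ < ε := by linarith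
  choose σ hσ using hconv
  refine ⟨σ, hσ, fun ⟨l, hl⟩ => ?_⟩
  -- One 1/(k+1) comes from the mean of the `k`-th stage, the other from all later changes.
  have hkey : ∀ k, ∃ n ≥ k, ‖σ n - bval (S k).b‖ ≤ 2 * (1 / (k + 1 : ℝ)) := by
    intro k
    obtain ⟨n, hn, h1, h2⟩ := hnext k (S k) x hx
    refine ⟨n, hn, ?_⟩
    refine le_of_tendsto ((hσ n).sub_const (bval (S k).b)).norm ?_
    filter_upwards [h1] with J hJ
    have k1 := hdiff' n J k _ (by positivity) (h2 J)
    calc _ = ‖_ + _‖ := by rw [sub_add_sub_cancel]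
      _ ≤ _ := norm_add_le_of_le k1 hJ
      _ = _ := by ring
  have hlim : Tendsto (fun k => bval (S k).b) atTop (𝓝 l) := by
    choose n hn hn' using hkey
    have h1 : Tendsto n atTop atTop := tendsto_atTop_mono hn tendsto_id
    have h2 : Tendsto (fun k => σ (n k) - bval (S k).b) atTop (𝓝 0) := by
      refine squeeze_zero_norm hn' ?_
      simpa using (tendsto_one_div_add_atTop_nhds_zero_nat (𝕜 := ℝ)).const_mul 2
    simpa using (hl.comp h1).sub h2
  have h3 : Tendsto (fun k => bval (S (k + 1)).b - bval (S k).b) atTop (𝓝 0) := by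
    simpa using (hlim.comp (tendsto_add_atTop_nat 1)).sub hlim
  have h4 : ∀ k, ‖bval (S (k + 1)).b - bval (S k).b‖ = 1 := by
    intro k
    rw [hb]
    cases (S k).b <;> simp [bval]
  have h5 := h3.norm
  simp only [h4, norm_zero] at h5
  exact one_ne_zero (tendsto_nhds_unique tendsto_const_nhds h5)

end ClassicalSystem

/-! ### The Vilenkin system: block structure of kernels and orthonormality -/

/-- Bessel: the Fourier coefficients with respect to a bounded orthonormal system tend to `0`. -/
lemma tendsto_integral_mul_conj_of_orthonormal {φ : ℕ → ℝ → ℂ} {s : Set ℝ}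
    (hs' : volume s ≠ ⊤) (hφ : ∀ n, Measurable (φ n)) (hφ1 : ∀ n t, ‖φ n t‖ ≤ 1)
    (horth : ∀ n m, ∫ t in s, φ n t * (starRingEnd ℂ) (φ m t) = if n = m then 1 else 0)
    {g : ℝ → ℂ} (hg : Measurable g) (hg1 : ∀ t, ‖g t‖ ≤ 1) :
    Tendsto (fun n => ∫ t in s, g t * (starRingEnd ℂ) (φ n t)) atTop (𝓝 0) := by
  have : IsFiniteMeasure (volume.restrict s) := ⟨by simpa using hs'.lt_top⟩
  have hmem : ∀ f : ℝ → ℂ, Measurable f → (∀ t, ‖f t‖ ≤ 1) → MemLp f 2 (volume.restrict s) :=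
    fun f hf hf1 => MemLp.of_bound hf.aestronglyMeasurable 1 (ae_of_all _ hf1)
  let v : ℕ → Lp ℂ 2 (volume.restrict s) := fun n => (hmem _ (hφ n) (hφ1 n)).toLp
  have hinner : ∀ (f : ℝ → ℂ) (hf : Measurable f) (hf1 : ∀ t, ‖f t‖ ≤ 1) n,
      inner ℂ (v n) (hmem f hf hf1).toLp = ∫ t in s, f t * (starRingEnd ℂ) (φ n t) := by
    intro f hf hf1 n
    rw [L2.inner_def]
    refine integral_congr_ae ?_
    filter_upwards [(hmem f hf hf1).coeFn_toLp, (hmem _ (hφ n) (hφ1 n)).coeFn_toLp] with t h1 h2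
    simp only [v]
    rw [h1, h2]
    simp
  have hv : Orthonormal ℂ v := by
    rw [orthonormal_iff_ite]
    intro n m
    rw [hinner _ (hφ m) (hφ1 m) n, horth]
    simp [eq_comm]
  have h1 := hv.inner_products_summable (x := (hmem g hg hg1).toLp)
  have h2 := h1.tendsto_atTop_zero
  have h3 := (h2.congr fun n => by rw [hinner g hg hg1 n]).sqrt
  rw [tendsto_zero_iff_norm_tendsto_zero]
  simpa [Real.sqrt_sq] using h3

lemma sum_range_mul_eq {M : Type*} [AddCommMonoid M] (f : ℕ → M) (q m : ℕ) :
    ∑ n ∈ Finset.range (q * m), f n =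
      ∑ b ∈ Finset.range q, ∑ l ∈ Finset.range m, f (b * m + l) := by
  induction q with
  | zero => simp
  | succ q ih => rw [Nat.succ_mul, Finset.sum_range_add, ih, Finset.sum_range_succ]

section Vilenkin

variable {p : ℕ → ℕ}

lemma vilenkinBase_succ (p : ℕ → ℕ) (k : ℕ) : vilenkinBase p (k + 1) = vilenkinBase p k * p k :=
  Finset.prod_range_succ _ _

lemma vilenkinBase_dvd (p : ℕ → ℕ) {k l : ℕ} (h : k ≤ l) : vilenkinBase p k ∣ vilenkinBase p l :=
  Finset.prod_dvd_prod_of_subset _ _ _ (Finset.range_mono h)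

lemma two_pow_le_vilenkinBase (hp : ∀ k, 2 ≤ p k) (k : ℕ) : 2 ^ k ≤ vilenkinBase p k := by
  calc 2 ^ k = ∏ _i ∈ Finset.range k, 2 := by simp
    _ ≤ _ := Finset.prod_le_prod' fun i _ => hp i

lemma vilenkinBase_pos (hp : ∀ k, 2 ≤ p k) (k : ℕ) : 0 < vilenkinBase p k :=
  (by positivity : 0 < 2 ^ k).trans_le (two_pow_le_vilenkinBase hp k)

/-- The factor of a Vilenkin function that belongs to the `k`-th digits. -/
def vilenkinFactor (p : ℕ → ℕ) (k d : ℕ) (x : ℝ) : ℂ :=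
  Complex.exp (2 * Real.pi * Complex.I * (d : ℂ) *
    ((⌊(vilenkinBase p (k + 1) : ℝ) * x⌋ % (p k : ℤ) : ℤ) : ℂ) / (p k : ℂ))

lemma vilenkinFactor_zero (k : ℕ) (x : ℝ) : vilenkinFactor p k 0 x = 1 := by
  simp [vilenkinFactor]

lemma vilenkinFactor_add (k d d' : ℕ) (x : ℝ) :
    vilenkinFactor p k (d + d') x = vilenkinFactor p k d x * vilenkinFactor p k d' x := by
  rw [vilenkinFactor, vilenkinFactor, vilenkinFactor, ← Complex.exp_add]
  congr 1
  push_cast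
  ring

lemma norm_vilenkinFactor (k d : ℕ) (x : ℝ) : ‖vilenkinFactor p k d x‖ = 1 := by
  have : (2 * Real.pi * Complex.I * (d : ℂ) *
    ((⌊(vilenkinBase p (k + 1) : ℝ) * x⌋ % (p k : ℤ) : ℤ) : ℂ) / (p k : ℂ)) =
    ((2 * Real.pi * d * (⌊(vilenkinBase p (k + 1) : ℝ) * x⌋ % (p k : ℤ) : ℤ) / p k : ℝ) : ℂ) *
      Complex.I := by
    push_cast; ring
  rw [vilenkinFactor, this, Complex.norm_exp_ofReal_mul_I]

/-- Digits beyond the leading one are 0 and give the factor 1, so the length of the product is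
immaterial. This frees the formula from the range `n` of the definition and lets several indices
share one range. -/
lemma vilenkin_eq_prod_factor (hp : ∀ k, 2 ≤ p k) {n K : ℕ} (hK : n < vilenkinBase p K) (x : ℝ) :
    vilenkin p n x =
      ∏ k ∈ Finset.range K, vilenkinFactor p k (n / vilenkinBase p k % p k) x := by
  -- Both lengths, `n` and `K`, are compared with their maximum; the second alternative is void in
  -- both uses.
  have key : ∀ K', n < vilenkinBase p K' →
      ∏ k ∈ Finset.range K', vilenkinFactor p k (n / vilenkinBase p k % p k) x =
      ∏ k ∈ Finset.range (max n K), vilenkinFactor p k (n / vilenkinBase p k % p k) x ∨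
      max n K < K' := by
    intro K' hK'
    by_cases h : max n K < K'
    · exact Or.inr h
    · refine Or.inl (Finset.prod_subset (Finset.range_mono (not_lt.1 h)) fun k _ hk => ?_)
      have h1 : K' ≤ k := by simpa using hk
      have : n < vilenkinBase p k :=
        hK'.trans_le (Nat.le_of_dvd (vilenkinBase_pos hp k) (vilenkinBase_dvd p h1))
      rw [Nat.div_eq_of_lt this, Nat.zero_mod, vilenkinFactor_zero]
  rw [(key K hK).resolve_right (by simp)]
  exact (key n (n.lt_two_pow_self.trans_le (two_pow_le_vilenkinBase hp n))).resolve_right (by simp)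

lemma norm_vilenkin (p : ℕ → ℕ) (n : ℕ) (x : ℝ) : ‖vilenkin p n x‖ = 1 := by
  change ‖∏ k ∈ Finset.range n, vilenkinFactor p k (n / vilenkinBase p k % p k) x‖ = 1
  rw [norm_prod]
  exact Finset.prod_eq_one fun k _ => norm_vilenkinFactor _ _ _

lemma measurable_vilenkin (p : ℕ → ℕ) (n : ℕ) : Measurable (vilenkin p n) := by
  unfold vilenkin
  refine Finset.measurable_fun_prod _ fun k _ => ?_
  refine Complex.measurable_exp.comp ?_
  refine Measurable.div_const (Measurable.const_mul ?_ _) _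
  have h1 : Measurable fun x : ℝ => ⌊(vilenkinBase p (k + 1) : ℝ) * x⌋ :=
    Int.measurable_floor.comp (measurable_const_mul _)
  exact (measurable_from_top (f := fun z : ℤ => ((z % (p k : ℤ) : ℤ) : ℂ))).comp h1

/-- No carries occur: the multiple of `M_k` occupies the places from `k` on and `l` those below `k`.
-/
lemma digit_add (hp : ∀ k, 2 ≤ p k) {k l : ℕ} (q : ℕ) (hl : l < vilenkinBase p k) (i : ℕ) :
    (q * vilenkinBase p k + l) / vilenkinBase p i % p i =
      q * vilenkinBase p k / vilenkinBase p i % p i + l / vilenkinBase p i % p i := by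
  have hi := vilenkinBase_pos hp i
  rcases lt_or_ge i k with h | h
  · obtain ⟨R, hR⟩ := vilenkinBase_dvd p (show i + 1 ≤ k from h)
    rw [vilenkinBase_succ] at hR
    have h1 : q * vilenkinBase p k = vilenkinBase p i * (p i * (q * R)) := by rw [hR]; ring
    rw [h1, Nat.mul_add_div hi, Nat.mul_div_cancel_left _ hi, Nat.mul_add_mod, Nat.mul_mod_right,
      zero_add]
  · obtain ⟨R, hR⟩ := vilenkinBase_dvd p h
    have hk := vilenkinBase_pos hp k
    rw [Nat.div_eq_of_lt (hl.trans_le (Nat.le_of_dvd hi ⟨R, hR⟩)), Nat.zero_mod, add_zero, hR,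
      ← Nat.div_div_eq_div_mul, ← Nat.div_div_eq_div_mul, mul_comm q, Nat.mul_add_div hk,
      Nat.div_eq_of_lt hl, add_zero, Nat.mul_div_cancel_left _ hk]

lemma vilenkin_add (hp : ∀ k, 2 ≤ p k) {k l : ℕ} (q : ℕ) (hl : l < vilenkinBase p k) (x : ℝ) :
    vilenkin p (q * vilenkinBase p k + l) x =
      vilenkin p (q * vilenkinBase p k) x * vilenkin p l x := by
  set N := q * vilenkinBase p k + l
  have hN : N < vilenkinBase p N := N.lt_two_pow_self.trans_le (two_pow_le_vilenkinBase hp N)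
  rw [vilenkin_eq_prod_factor hp hN, vilenkin_eq_prod_factor hp ((Nat.le_add_right _ _).trans_lt hN),
    vilenkin_eq_prod_factor hp ((Nat.le_add_left _ _).trans_lt hN), ← Finset.prod_mul_distrib]
  refine Finset.prod_congr rfl fun i _ => ?_
  rw [digit_add hp q hl, vilenkinFactor_add]

lemma vilenkin_mul_base (hp : ∀ k, 2 ≤ p k) {k b : ℕ} (hb : b < p k) (x : ℝ) :
    vilenkin p (b * vilenkinBase p k) x = vilenkinFactor p k b x := by
  have hk := vilenkinBase_pos hp k
  have h1 : b * vilenkinBase p k < vilenkinBase p (k + 1) := by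
    rw [vilenkinBase_succ, mul_comm]
    exact Nat.mul_lt_mul_of_pos_left hb hk
  rw [vilenkin_eq_prod_factor hp h1, Finset.prod_range_succ, Finset.prod_eq_one, one_mul,
    Nat.mul_div_cancel _ hk, Nat.mod_eq_of_lt hb]
  intro i hi
  obtain ⟨R, hR⟩ := vilenkinBase_dvd p (show i + 1 ≤ k from Finset.mem_range.1 hi)
  rw [vilenkinBase_succ] at hR
  have h1 : b * vilenkinBase p k = vilenkinBase p i * (p i * (b * R)) := by rw [hR]; ring
  rw [h1, Nat.mul_div_cancel_left _ (vilenkinBase_pos hp i), Nat.mul_mod_right,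
    vilenkinFactor_zero]

/-- The kernel of the first `N` Vilenkin functions. -/
def vilenkinKernel (p : ℕ → ℕ) (N : ℕ) (x t : ℝ) : ℂ :=
  ∑ n ∈ Finset.range N, vilenkin p n x * (starRingEnd ℂ) (vilenkin p n t)

/-- By the absence of carries, each block of `M_k` consecutive functions is the first block
multiplied by one function of modulus 1. Hence a zero of the kernel of order `M_k` is a zero of all
kernels of order q·M_k. -/
lemma vilenkinKernel_mul_base (hp : ∀ k, 2 ≤ p k) (q k : ℕ) (x t : ℝ) :
    vilenkinKernel p (q * vilenkinBase p k) x t =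
      (∑ b ∈ Finset.range q, vilenkin p (b * vilenkinBase p k) x *
        (starRingEnd ℂ) (vilenkin p (b * vilenkinBase p k) t)) *
        vilenkinKernel p (vilenkinBase p k) x t := by
  rw [vilenkinKernel, sum_range_mul_eq, Finset.sum_mul]
  refine Finset.sum_congr rfl fun b _ => ?_
  rw [vilenkinKernel, Finset.mul_sum]
  refine Finset.sum_congr rfl fun l hl => ?_
  rw [vilenkin_add hp b (Finset.mem_range.1 hl), vilenkin_add hp b (Finset.mem_range.1 hl), map_mul]
  ring

/-- A full geometric sum over the powers of a p_k-th root of unity, which differs from 1 because the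
two digits differ. -/
lemma sum_vilenkinFactor_eq_zero (hp : ∀ k, 2 ≤ p k) {k : ℕ} {x t : ℝ}
    (h : ⌊(vilenkinBase p (k + 1) : ℝ) * x⌋ % (p k : ℤ) ≠
      ⌊(vilenkinBase p (k + 1) : ℝ) * t⌋ % (p k : ℤ)) :
    ∑ b ∈ Finset.range (p k), vilenkinFactor p k b x *
      (starRingEnd ℂ) (vilenkinFactor p k b t) = 0 := by
  set u := ⌊(vilenkinBase p (k + 1) : ℝ) * x⌋ % (p k : ℤ) with hu
  set w := ⌊(vilenkinBase p (k + 1) : ℝ) * t⌋ % (p k : ℤ) with hw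
  have hp0 : (p k : ℂ) ≠ 0 := by
    have := hp k
    exact_mod_cast (by omega : p k ≠ 0)
  have hpz : (p k : ℤ) ≠ 0 := by have := hp k; omega
  set z : ℂ := Complex.exp (2 * Real.pi * Complex.I * ((u - w : ℤ) : ℂ) / (p k : ℂ)) with hz
  have hterm : ∀ b : ℕ, vilenkinFactor p k b x * (starRingEnd ℂ) (vilenkinFactor p k b t) =
      z ^ b := by
    intro b
    rw [vilenkinFactor, vilenkinFactor, ← Complex.exp_conj, ← Complex.exp_add, hz,
      ← Complex.exp_nat_mul]
    congr 1
    simp only [map_div₀, map_mul, Complex.conj_ofReal, Complex.conj_I, map_natCast, map_intCast,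
      map_ofNat, ← hu, ← hw]
    push_cast
    ring
  have hz1 : z ≠ 1 := by
    intro h1
    obtain ⟨n, hn⟩ := Complex.exp_eq_one_iff.1 h1
    have h2 : ((u - w : ℤ) : ℂ) = n * p k := by
      have : (2 * Real.pi * Complex.I : ℂ) ≠ 0 := Complex.two_pi_I_ne_zero
      field_simp at hn
      refine mul_left_cancel₀ this ?_
      linear_combination (2 * Real.pi * Complex.I : ℂ) * hn
    have h3 : u - w = n * p k := by exact_mod_cast h2
    have h4 : u % (p k : ℤ) = w % (p k : ℤ) := by
      rw [show u = w + n * p k by omega, Int.add_mul_emod_self_right]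
    rw [hu, hw, Int.emod_emod_of_dvd _ dvd_rfl, Int.emod_emod_of_dvd _ dvd_rfl] at h4
    exact h h4
  have hzp : z ^ p k = 1 := by
    rw [hz, ← Complex.exp_nat_mul, Complex.exp_eq_one_iff]
    refine ⟨u - w, ?_⟩
    field_simp
  simp only [hterm]
  rw [geom_sum_eq hz1, hzp, sub_self, zero_div]

lemma vilenkinKernel_base_eq_zero (hp : ∀ k, 2 ≤ p k) {k i : ℕ} (hi : i < k) {x t : ℝ}
    (h : ⌊(vilenkinBase p (i + 1) : ℝ) * x⌋ % (p i : ℤ) ≠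
      ⌊(vilenkinBase p (i + 1) : ℝ) * t⌋ % (p i : ℤ)) :
    vilenkinKernel p (vilenkinBase p k) x t = 0 := by
  induction k with
  | zero => omega
  | succ k ih =>
    rw [vilenkinBase_succ, mul_comm, vilenkinKernel_mul_base hp]
    rcases Nat.lt_succ_iff_lt_or_eq.1 hi with hik | rfl
    · rw [ih hik, mul_zero]
    · rw [Finset.sum_congr rfl fun b hb => by
        rw [vilenkin_mul_base hp (Finset.mem_range.1 hb), vilenkin_mul_base hp (Finset.mem_range.1 hb)],
        sum_vilenkinFactor_eq_zero hp h, zero_mul]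

lemma floor_vilenkinBase_div (hp : ∀ k, 2 ≤ p k) {i K : ℕ} (h : i ≤ K) (x : ℝ) :
    ⌊(vilenkinBase p i : ℝ) * x⌋ =
      ⌊(vilenkinBase p K : ℝ) * x⌋ / ((vilenkinBase p K / vilenkinBase p i : ℕ) : ℤ) := by
  obtain ⟨R, hR⟩ := vilenkinBase_dvd p h
  have hi := vilenkinBase_pos hp i
  have hK := vilenkinBase_pos hp K
  have hR0 : (R : ℝ) ≠ 0 := by
    rintro h0
    have : R = 0 := by exact_mod_cast h0
    simp [this] at hR; omega
  rw [hR, Nat.mul_div_cancel_left _ hi, ← Int.floor_div_natCast]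
  congr 1
  push_cast
  field_simp

/-- Passing from level k to k+1 multiplies the floor by `p k` and adds the digit. Only a congruence
results, not equality: 0 and 1, for instance, have the same digits, which is why distances are
measured on the circle. -/
lemma vilenkinBase_dvd_floor_sub (hp : ∀ k, 2 ≤ p k) {k : ℕ} {x t : ℝ}
    (h : ∀ i < k, ⌊(vilenkinBase p (i + 1) : ℝ) * x⌋ % (p i : ℤ) =
      ⌊(vilenkinBase p (i + 1) : ℝ) * t⌋ % (p i : ℤ)) :
    (vilenkinBase p k : ℤ) ∣ ⌊(vilenkinBase p k : ℝ) * x⌋ - ⌊(vilenkinBase p k : ℝ) * t⌋ := by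
  induction k with
  | zero => simp [vilenkinBase]
  | succ k ih =>
    obtain ⟨c, hc⟩ := ih fun i hi => h i (by omega)
    have h1 : vilenkinBase p (k + 1) / vilenkinBase p k = p k := by
      rw [vilenkinBase_succ, Nat.mul_div_cancel_left _ (vilenkinBase_pos hp k)]
    have hle : k ≤ k + 1 := by omega
    have hk := h k (by omega)
    have hs : (vilenkinBase p (k + 1) : ℤ) = vilenkinBase p k * p k := by
      rw [vilenkinBase_succ, Nat.cast_mul]
    rw [floor_vilenkinBase_div hp hle x, floor_vilenkinBase_div hp hle t, h1] at hc
    generalize ⌊(vilenkinBase p (k + 1) : ℝ) * x⌋ = X at hc hk ⊢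
    generalize ⌊(vilenkinBase p (k + 1) : ℝ) * t⌋ = Y at hc hk ⊢
    refine ⟨c, ?_⟩
    rw [hs]
    linear_combination (p k : ℤ) * hc - Int.mul_ediv_add_emod X (p k) +
      Int.mul_ediv_add_emod Y (p k) + hk

/-- The Vilenkin kernel of order `M_k` vanishes at a distance of at least `1 / M_k` from the
diagonal of the circle. -/
lemma vilenkinKernel_base_eq_zero_of_gap (hp : ∀ k, 2 ≤ p k) {k : ℕ} {x t : ℝ}
    (h : 1 / (vilenkinBase p k : ℝ) ≤ gap 1 x t) :
    vilenkinKernel p (vilenkinBase p k) x t = 0 := by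
  by_contra hne
  have hdig : ∀ i < k, ⌊(vilenkinBase p (i + 1) : ℝ) * x⌋ % (p i : ℤ) =
      ⌊(vilenkinBase p (i + 1) : ℝ) * t⌋ % (p i : ℤ) := by
    intro i hi
    by_contra h1
    exact hne (vilenkinKernel_base_eq_zero hp hi h1)
  obtain ⟨c, hc⟩ := vilenkinBase_dvd_floor_sub hp hdig
  have hM : (0 : ℝ) < vilenkinBase p k := by exact_mod_cast vilenkinBase_pos hp k
  set M : ℝ := (vilenkinBase p k : ℝ) with hMdef
  have hc' : (⌊M * x⌋ : ℝ) - ⌊M * t⌋ = M * c := by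
    rw [hMdef]; exact_mod_cast hc
  have fx1 := Int.floor_le (M * x)
  have fx2 := Int.lt_floor_add_one (M * x)
  have ft1 := Int.floor_le (M * t)
  have ft2 := Int.lt_floor_add_one (M * t)
  have h1 : 1 / M ≤ |x - t| := h.trans (min_le_left _ _)
  have h2 : 1 / M ≤ 1 - |x - t| := h.trans (min_le_right _ _)
  rw [div_le_iff₀ hM] at h1 h2
  have hM1 : 1 ≤ M := by
    rw [hMdef]; exact_mod_cast vilenkinBase_pos hp k
  have e1 : |x - t| * M = |M * x - M * t| := by
    rw [← mul_sub, abs_mul, abs_of_pos hM, mul_comm]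
  rw [sub_mul, e1, one_mul] at h2
  rw [e1] at h1
  -- If the floors agree, the points are less than 1/M apart; if they differ by a nonzero multiple
  -- of M, then |x - t| > 1 - 1/M. Either way the circular distance is below 1/M.
  rcases lt_trichotomy c 0 with hneg | rfl | hpos
  · have : (c : ℝ) ≤ -1 := by exact_mod_cast (by omega : c ≤ -1)
    have : M * c ≤ M * (-1) := by gcongr
    have := (abs_le.1 (le_of_eq (rfl : |M * x - M * t| = _))).1
    linarith
  · rw [Int.cast_zero, mul_zero] at hc'
    have : |M * x - M * t| < 1 := abs_lt.2 ⟨by linarith, by linarith⟩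
    linarith
  · have : (1 : ℝ) ≤ c := by exact_mod_cast hpos
    have : M * 1 ≤ M * c := by gcongr
    have := (abs_le.1 (le_of_eq (rfl : |M * x - M * t| = _))).2
    linarith

lemma vilenkinKernel_add (hp : ∀ k, 2 ≤ p k) {k s : ℕ} (q : ℕ) (hs : s ≤ vilenkinBase p k)
    (x t : ℝ) :
    vilenkinKernel p (q * vilenkinBase p k + s) x t =
      vilenkinKernel p (q * vilenkinBase p k) x t +
      vilenkin p (q * vilenkinBase p k) x * (starRingEnd ℂ) (vilenkin p (q * vilenkinBase p k) t) *
        vilenkinKernel p s x t := by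
  rw [vilenkinKernel, Finset.sum_range_add, ← vilenkinKernel, vilenkinKernel, vilenkinKernel,
    Finset.mul_sum]
  congr 1
  refine Finset.sum_congr rfl fun l hl => ?_
  have := (Finset.mem_range.1 hl).trans_le hs
  rw [vilenkin_add hp q this, vilenkin_add hp q this, map_mul]
  ring

lemma norm_vilenkinKernel_le (N : ℕ) (x t : ℝ) : ‖vilenkinKernel p N x t‖ ≤ N := by
  refine (norm_sum_le _ _).trans ?_
  simp [norm_vilenkin]

lemma vilenkinKernel_self (N : ℕ) (x : ℝ) : vilenkinKernel p N x x = N := by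
  simp [vilenkinKernel, Complex.mul_conj, Complex.normSq_eq_norm_sq, norm_vilenkin]

lemma vilenkin_eq_of_floor (hp : ∀ k, 2 ≤ p k) {n K : ℕ} (hn : n < vilenkinBase p K) {x t : ℝ}
    (h : ⌊(vilenkinBase p K : ℝ) * x⌋ = ⌊(vilenkinBase p K : ℝ) * t⌋) :
    vilenkin p n x = vilenkin p n t := by
  rw [vilenkin_eq_prod_factor hp hn, vilenkin_eq_prod_factor hp hn]
  refine Finset.prod_congr rfl fun i hi => ?_
  rw [vilenkinFactor, vilenkinFactor, floor_vilenkinBase_div hp (Finset.mem_range.1 hi) x,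
    floor_vilenkinBase_div hp (Finset.mem_range.1 hi) t, h]

/-- The values at the grid points q/M form a square matrix. Its rows are orthogonal because distinct
grid points have circular distance at least 1/M, where the kernel vanishes, while the kernel is M on
the diagonal. Orthogonality of the columns, which is the claim, follows since a one-sided inverse of
a square matrix is two-sided. -/
lemma sum_vilenkin_mul_conj (hp : ∀ k, 2 ≤ p k) {n m K : ℕ} (hn : n < vilenkinBase p K)
    (hm : m < vilenkinBase p K) :
    ∑ q ∈ Finset.range (vilenkinBase p K), vilenkin p n (q / vilenkinBase p K) *
      (starRingEnd ℂ) (vilenkin p m (q / vilenkinBase p K)) =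
      if n = m then (vilenkinBase p K : ℂ) else 0 := by
  set M := vilenkinBase p K with hM
  have hM0 : 0 < M := vilenkinBase_pos hp K
  have hMr : (0 : ℝ) < M := by exact_mod_cast hM0
  have hMc : (M : ℂ) ≠ 0 := by exact_mod_cast hM0.ne'
  let A : Matrix (Fin M) (Fin M) ℂ := Matrix.of fun q n => vilenkin p n ((q : ℕ) / M)
  have hA : ((M : ℂ)⁻¹ • A) * A.conjTranspose = 1 := by
    ext q q'
    rw [Matrix.smul_mul, Matrix.smul_apply, Matrix.mul_apply]
    have h1 : ∑ j, A q j * A.conjTranspose j q' =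
        vilenkinKernel p M ((q : ℕ) / M) ((q' : ℕ) / M) := by
      rw [vilenkinKernel, Finset.sum_range]
      rfl
    rw [h1]
    rcases eq_or_ne q q' with rfl | hqq
    · rw [vilenkinKernel_self, Matrix.one_apply_eq, smul_eq_mul, inv_mul_cancel₀ hMc]
    · rw [Matrix.one_apply_ne hqq, vilenkinKernel_base_eq_zero_of_gap hp, smul_zero]
      · rw [← hM, gap, ← sub_div, abs_div, abs_of_pos hMr, le_min_iff, div_le_div_iff_of_pos_right hMr,
          le_sub_iff_add_le, ← add_div, div_le_one hMr]
        have hz : (q : ℤ) ≠ (q' : ℤ) := fun h => hqq (Fin.ext (by exact_mod_cast h))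
        have hq := q.2
        have hq' := q'.2
        have k1 : (1 : ℤ) ≤ |(q : ℤ) - q'| := Int.one_le_abs (sub_ne_zero.2 hz)
        have k2 : 1 + |(q : ℤ) - q'| ≤ M := by
          rcases abs_cases ((q : ℤ) - q') with h | h <;> omega
        constructor
        · exact_mod_cast k1
        · exact_mod_cast k2
  have hA' := mul_eq_one_comm.1 hA
  have h2 := congrFun (congrFun hA' ⟨m, hm⟩) ⟨n, hn⟩
  rw [Matrix.mul_smul, Matrix.smul_apply, Matrix.mul_apply, smul_eq_mul, Matrix.one_apply,
    inv_mul_eq_iff_eq_mul₀ hMc] at h2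
  rw [Finset.sum_range]
  have h3 : ∀ q : Fin M, A.conjTranspose ⟨m, hm⟩ q * A q ⟨n, hn⟩ = vilenkin p n ((q : ℕ) / M) *
      (starRingEnd ℂ) (vilenkin p m ((q : ℕ) / M)) := fun q => mul_comm _ _
  simp only [h3, Fin.mk.injEq] at h2
  rw [h2]
  simp [eq_comm]

/-- Both functions are constant on the cells of length 1/M_K, which reduces the integral to the
discrete orthogonality relation. -/
lemma integral_vilenkin_mul_conj (hp : ∀ k, 2 ≤ p k) (n m : ℕ) :
    ∫ t in (0 : ℝ)..1, vilenkin p n t * (starRingEnd ℂ) (vilenkin p m t) =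
      if n = m then 1 else 0 := by
  set K := max n m
  have hK : K < vilenkinBase p K := K.lt_two_pow_self.trans_le (two_pow_le_vilenkinBase hp K)
  have hn : n < vilenkinBase p K := (le_max_left _ _).trans_lt hK
  have hm : m < vilenkinBase p K := (le_max_right _ _).trans_lt hK
  set M := vilenkinBase p K with hM
  have hM0 : 0 < M := vilenkinBase_pos hp K
  have hMr : (0 : ℝ) < M := by exact_mod_cast hM0
  have hMc : (M : ℂ) ≠ 0 := by exact_mod_cast hM0.ne'
  set F : ℝ → ℂ := fun t => vilenkin p n t * (starRingEnd ℂ) (vilenkin p m t) with hF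
  have hint : ∀ a b, IntervalIntegrable F volume a b := by
    intro a b
    refine (intervalIntegrable_const (c := (1 : ℝ))).mono_fun ?_ (ae_of_all _ fun t => ?_)
    · exact ((measurable_vilenkin p n).mul
        (Complex.continuous_conj.measurable.comp (measurable_vilenkin p m))).aestronglyMeasurable
    · simp [hF, norm_vilenkin]
  have hpiece : ∀ q : ℕ, ∫ t in ((q : ℝ) / M)..((q + 1 : ℕ) : ℝ) / M, F t = F (q / M) / M := by
    intro q
    have hle : (q : ℝ) / M ≤ ((q + 1 : ℕ) : ℝ) / M := by
      gcongr; simp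
    rw [intervalIntegral.integral_of_le hle, integral_Ioc_eq_integral_Ioo,
      setIntegral_congr_fun (g := fun _ => F (q / M)) measurableSet_Ioo]
    · rw [setIntegral_const, Measure.real, Real.volume_Ioo, ENNReal.toReal_ofReal (sub_nonneg.2 hle)]
      rw [Complex.real_smul]
      push_cast
      field_simp
      ring
    · intro t ht
      have h1 : ⌊(M : ℝ) * t⌋ = ⌊(M : ℝ) * (q / M)⌋ := by
        rw [mul_div_cancel₀ _ hMr.ne', Int.floor_natCast, Int.floor_eq_iff]
        have h2 := ht.1
        have h3 := ht.2
        rw [div_lt_iff₀ hMr] at h2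
        rw [lt_div_iff₀ hMr] at h3
        push_cast at h3 ⊢
        constructor <;> linarith
      simp only [hF]
      rw [vilenkin_eq_of_floor hp hn h1, vilenkin_eq_of_floor hp hm h1]
  have hsum := intervalIntegral.sum_integral_adjacent_intervals (f := F) (μ := volume)
    (a := fun q : ℕ => (q : ℝ) / M) (n := M) fun q _ => hint _ _
  rw [Nat.cast_zero, zero_div, div_self hMr.ne'] at hsum
  rw [← hsum, Finset.sum_congr rfl fun q _ => hpiece q, ← Finset.sum_div,
    sum_vilenkin_mul_conj hp hn hm]
  split_ifs
  · exact div_self hMc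
  · exact zero_div _

end Vilenkin

/-! ### Localization for the Vilenkin and Walsh systems -/

namespace ClassicalSystem

lemma tame_vilenkin (p : ℕ → ℕ) (hp : ∀ k, 2 ≤ p k) : (vilenkin p hp).Tame where
  length_pos := one_pos
  measurable := measurable_vilenkin p
  bounded k := ⟨1, fun x _ => (norm_vilenkin p k x).le⟩

/-- Fix `k` with 1/M_k ≤ r and write j+1 = q·M_k + s with s < M_k. The first q·M_k functions
contribute nothing at distance at least `r`. The remaining fewer than M_k terms are bounded, and
their coefficients tend to 0 by Bessel. Since `k` depends on `r` alone, unbounded `p` do no harm. -/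
theorem localizing_vilenkin (p : ℕ → ℕ) (hp : ∀ k, 2 ≤ p k) : (vilenkin p hp).Localizing where
  toTame := tame_vilenkin p hp
  partialSum_one j x _ := by
    have h0 : ∀ t, OrthoDiv.vilenkin p 0 t = 1 := fun t => by simp [OrthoDiv.vilenkin]
    have hc : ∀ k, (vilenkin p hp).coeff (fun _ => 1) k = if 0 = k then 1 else 0 := by
      intro k
      rw [← integral_vilenkin_mul_conj hp 0 k]
      simp only [h0]
      rfl
    rw [partialSum]
    simp only [hc, ite_mul, one_mul, zero_mul]
    rw [Finset.sum_ite_eq]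
    simp only [Finset.mem_range]
    exact (if_pos (Nat.succ_pos j)).trans (h0 x)
  kernel_bounded r hr := by
    obtain ⟨k, hk⟩ := exists_pow_lt_of_lt_one hr (show (1 / 2 : ℝ) < 1 by norm_num)
    have hM : (2 : ℝ) ^ k ≤ vilenkinBase p k := by exact_mod_cast two_pow_le_vilenkinBase hp k
    have hM0 := vilenkinBase_pos hp k
    refine ⟨vilenkinBase p k, fun j x hx t ht hxt => ?_⟩
    change ‖vilenkinKernel p (j + 1) x t‖ ≤ _
    have h0 : vilenkinKernel p (vilenkinBase p k) x t = 0 := by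
      refine vilenkinKernel_base_eq_zero_of_gap hp (le_trans ?_ hxt)
      calc 1 / (vilenkinBase p k : ℝ) ≤ 1 / 2 ^ k := by gcongr
        _ = (1 / 2) ^ k := by rw [one_div_pow]
        _ ≤ r := hk.le
    rw [← Nat.div_add_mod' (j + 1) (vilenkinBase p k),
      vilenkinKernel_add hp _ (Nat.mod_lt _ hM0).le, vilenkinKernel_mul_base hp, h0, mul_zero,
      zero_add, norm_mul, norm_mul, RCLike.norm_conj, norm_vilenkin, norm_vilenkin, one_mul,
      one_mul]
    refine (norm_vilenkinKernel_le _ _ _).trans ?_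
    exact_mod_cast (Nat.mod_lt _ hM0).le
  localization g hg hg1 r hr ε hε := by
    have hT := tame_vilenkin p hp
    obtain ⟨k, hk⟩ := exists_pow_lt_of_lt_one hr (show (1 / 2 : ℝ) < 1 by norm_num)
    have hM : (2 : ℝ) ^ k ≤ vilenkinBase p k := by exact_mod_cast two_pow_le_vilenkinBase hp k
    have hM0 := vilenkinBase_pos hp k
    set M := vilenkinBase p k with hMdef
    have hMr : (0 : ℝ) < M := by exact_mod_cast hM0
    have hc : Tendsto (fun n => (vilenkin p hp).coeff g n) atTop (𝓝 0) := by
      simp only [hT.coeff_eq]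
      refine tendsto_integral_mul_conj_of_orthonormal measure_Icc_lt_top.ne
        (measurable_vilenkin p) (fun n t => (norm_vilenkin p n t).le) (fun n m => ?_) hg hg1
      rw [← integral_vilenkin_mul_conj hp n m, intervalIntegral.integral_of_le zero_le_one,
        ← integral_Icc_eq_integral_Ioc]
      rfl
    have hc' : ∀ᶠ n in atTop, ‖(vilenkin p hp).coeff g n‖ < ε / M := by
      simpa [dist_eq_norm] using Metric.tendsto_nhds.1 hc (ε / M) (by positivity)
    obtain ⟨n₀, hn₀⟩ := eventually_atTop.1 hc'
    -- The last incomplete block starts no earlier than j+1-M, hence beyond n₀.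
    refine ⟨n₀ + M, fun j hj x hx hgx => ?_⟩
    set q := (j + 1) / M with hq
    have hdiv : (j + 1) = q * M + (j + 1) % M := (Nat.div_add_mod' (j + 1) M).symm
    have hmod : (j + 1) % M < M := Nat.mod_lt _ hM0
    change ‖∑ n ∈ Finset.range (j + 1), _‖ ≤ ε
    rw [hdiv, Finset.sum_range_add]
    have h1 : ∑ n ∈ Finset.range (q * M), (vilenkin p hp).coeff g n * (vilenkin p hp).fn n x = 0 := by
      have h2 : ∑ n ∈ Finset.range (q * M), (vilenkin p hp).coeff g n * (vilenkin p hp).fn n x =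
          ∫ t in Set.Icc 0 (vilenkin p hp).length, g t * vilenkinKernel p (q * M) x t := by
        simp only [vilenkinKernel, Finset.mul_sum]
        rw [integral_finsetSum]
        · refine Finset.sum_congr rfl fun n _ => ?_
          rw [hT.coeff_eq, ← integral_mul_const]
          refine integral_congr_ae (ae_of_all _ fun t => ?_)
          simp only [fn]; ring
        · intro n _
          refine ((hT.integrableOn_mul_conj hg hg1 n).const_mul
            ((vilenkin p hp).fn n x)).congr (ae_of_all _ fun t => ?_)
          simp only [fn]; ring
      rw [h2]
      refine setIntegral_eq_zero_of_forall_eq_zero fun t ht => ?_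
      rcases lt_or_ge (gap 1 x t) r with h3 | h3
      · rw [hgx t ht h3, zero_mul]
      · have h0 : vilenkinKernel p M x t = 0 := by
          refine vilenkinKernel_base_eq_zero_of_gap hp (le_trans ?_ h3)
          calc 1 / (M : ℝ) ≤ 1 / 2 ^ k := by gcongr
            _ = (1 / 2) ^ k := by rw [one_div_pow]
            _ ≤ r := hk.le
        rw [hMdef, vilenkinKernel_mul_base hp, ← hMdef, h0, mul_zero, mul_zero]
    rw [h1, zero_add]
    calc _ ≤ ∑ l ∈ Finset.range ((j + 1) % M), ε / M := by
          refine (norm_sum_le _ _).trans (Finset.sum_le_sum fun l _ => ?_)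
          rw [norm_mul]
          have h3 : ‖(vilenkin p hp).fn (q * M + l) x‖ = 1 := norm_vilenkin p _ x
          rw [h3, mul_one]
          exact (hn₀ _ (by omega)).le
      _ = ((j + 1) % M : ℕ) * (ε / M) := by simp
      _ ≤ M * (ε / M) := by gcongr
      _ = ε := by field_simp

lemma Localizing.congr {Φ Ψ : ClassicalSystem} (h : Φ.Localizing) (hl : Φ.length = Ψ.length)
    (hf : Φ.fn = Ψ.fn) (ht : Φ.terms = Ψ.terms) : Ψ.Localizing := by
  have hk : Φ.kernel = Ψ.kernel := by unfold kernel; rw [hf, ht]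
  have hs : Φ.partialSum = Ψ.partialSum := by unfold partialSum coeff; rw [hf, ht, hl]
  exact ⟨⟨hl ▸ h.length_pos, hf ▸ h.measurable, by rw [← hf, ← hl]; exact h.bounded⟩,
    by rw [← hs, ← hl]; exact h.partialSum_one, by rw [← hk, ← hl]; exact h.kernel_bounded,
    by rw [← hs, ← hl]; exact h.localization⟩

/-- This is the Vilenkin system with all `p k` equal to 2: the digits of n are its bits, and the
factor exp(πi) = -1 records the parity of the floor. -/
theorem localizing_walsh : walsh.Localizing := by
  refine (localizing_vilenkin (fun _ => 2) fun _ => le_rfl).congr rfl ?_ rfl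
  funext n x
  simp only [fn, OrthoDiv.vilenkin, OrthoDiv.walsh]
  rw [Complex.ofReal_prod]
  refine Finset.prod_congr rfl fun k _ => ?_
  have hb : ∀ k, vilenkinBase (fun _ => 2) k = 2 ^ k := fun k => by simp [vilenkinBase]
  rw [hb, hb, Nat.testBit_eq_decide_div_mod_eq]
  push_cast
  generalize ⌊(2 : ℝ) ^ (k + 1) * x⌋ = z
  rcases Nat.mod_two_eq_zero_or_one (n / 2 ^ k) with h | h
  · simp [h]
  · rw [h]
    rcases Int.even_or_odd z with hz | hz
    · rw [Int.even_iff.1 hz]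
      simp [hz.neg_one_zpow]
    · rw [Int.odd_iff.1 hz]
      simp only [decide_true, if_true, hz.neg_one_zpow]
      push_cast
      rw [show (2 * Real.pi * Complex.I * 1 * 1 / 2 : ℂ) = Real.pi * Complex.I by ring,
        Complex.exp_pi_mul_I]

end ClassicalSystem

/-! ### The Haar system: kernels and primitives -/

section Haar

/-- The right-continuous indicator function of the unit interval. -/
def unitRight (y : ℝ) : ℝ := if 0 ≤ y ∧ y < 1 then 1 else 0

/-- The left-continuous indicator function of the unit interval. -/
def unitLeft (y : ℝ) : ℝ := if 0 < y ∧ y ≤ 1 then 1 else 0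

/-- One-sided versions of the indicator function of the unit interval. -/
structure IsUnit01 (B : ℝ → ℝ) : Prop where
  refine_eq : ∀ y, B y = B (2 * y) + B (2 * y - 1)
  support : ∀ y, B y ≠ 0 → 0 ≤ y ∧ y ≤ 1
  abs_le : ∀ y, |B y| ≤ 1
  measurable : Measurable B
  integral : ∀ y, ∫ t in (0 : ℝ)..y, B t = max 0 (min y 1)

lemma integral_unitLeft (y : ℝ) : ∫ t in (0 : ℝ)..y, unitLeft t = max 0 (min y 1) := by
  have h : unitLeft = (Set.Ioc (0 : ℝ) 1).indicator fun _ => (1 : ℝ) := by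
    funext t; simp [unitLeft, Set.indicator_apply]
  rw [h]
  rcases le_total 0 y with hy | hy
  · rw [intervalIntegral.integral_of_le hy, setIntegral_indicator measurableSet_Ioc,
      Set.Ioc_inter_Ioc, setIntegral_const]
    have h1 : (0 : ℝ) ≤ min y 1 := le_min hy zero_le_one
    change volume.real (Set.Ioc (max 0 0) (min y 1)) • (1 : ℝ) = _
    rw [max_self, Measure.real, Real.volume_Ioc, sub_zero, ENNReal.toReal_ofReal h1,
      max_eq_right h1, smul_eq_mul, mul_one]
  · rw [intervalIntegral.integral_of_ge hy, setIntegral_indicator measurableSet_Ioc,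
      Set.Ioc_inter_Ioc]
    simp [hy]

lemma unitRight_ae_eq : unitRight =ᵐ[volume] unitLeft := by
  have h0 : ∀ᵐ t : ℝ, t ≠ 0 := by simp [ae_iff]
  have h1 : ∀ᵐ t : ℝ, t ≠ 1 := by simp [ae_iff]
  filter_upwards [h0, h1] with t ht0 ht1
  unfold unitRight unitLeft
  congr 1
  exact propext ⟨fun h => ⟨lt_of_le_of_ne h.1 ht0.symm, h.2.le⟩,
    fun h => ⟨h.1.le, lt_of_le_of_ne h.2 ht1⟩⟩

lemma isUnit01_unitLeft : IsUnit01 unitLeft where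
  refine_eq y := by
    unfold unitLeft
    split_ifs <;> first | (norm_num; done) | (exfalso; grind)
  support y h := by
    unfold unitLeft at h
    split_ifs at h with h'
    · exact ⟨h'.1.le, h'.2⟩
    · exact absurd rfl h
  abs_le y := by unfold unitLeft; split_ifs <;> simp
  measurable := Measurable.ite measurableSet_Ioc measurable_const measurable_const
  integral := integral_unitLeft

lemma isUnit01_unitRight : IsUnit01 unitRight where
  refine_eq y := by
    unfold unitRight
    split_ifs <;> first | (norm_num; done) | (exfalso; grind)
  support y h := by
    unfold unitRight at h
    split_ifs at h with h'
    · exact ⟨h'.1, h'.2.le⟩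
    · exact absurd rfl h
  abs_le y := by unfold unitRight; split_ifs <;> simp
  measurable := Measurable.ite measurableSet_Ico measurable_const measurable_const
  integral y := by
    rw [← integral_unitLeft]
    exact intervalIntegral.integral_congr_ae (unitRight_ae_eq.mono fun t ht _ => ht)

lemma haarMotherRight_eq (y : ℝ) :
    haarMotherRight y = unitRight (2 * y) - unitRight (2 * y - 1) := by
  unfold haarMotherRight unitRight
  split_ifs <;> first | (norm_num; done) | (exfalso; grind)

lemma haarMotherLeft_eq (y : ℝ) : haarMotherLeft y = unitLeft (2 * y) - unitLeft (2 * y - 1) := by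
  unfold haarMotherLeft unitLeft
  split_ifs <;> first | (norm_num; done) | (exfalso; grind)

/-- The Haar function built from a one-sided indicator function of the unit interval. -/
def haarSide (B : ℝ → ℝ) (n : ℕ) (x : ℝ) : ℝ :=
  if n = 0 then B x else haarDilate (fun y => B (2 * y) - B (2 * y - 1)) n x

lemma haarSide_pow_add {B : ℝ → ℝ} {k i : ℕ} (hi : i < 2 ^ k) (x : ℝ) :
    haarSide B (2 ^ k + i) x = √((2 : ℝ) ^ k) *
      (B (2 * ((2 : ℝ) ^ k * x - i)) - B (2 * ((2 : ℝ) ^ k * x - i) - 1)) := by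
  have h1 : 2 ^ k + i ≠ 0 := by positivity
  have h2 : Nat.log 2 (2 ^ k + i) = k := by
    rw [Nat.log_eq_iff (Or.inr ⟨by norm_num, h1⟩)]
    constructor
    · omega
    · rw [pow_succ]; omega
  rw [haarSide, if_neg h1, haarDilate, h2]
  push_cast
  simp only [add_sub_cancel_left]

lemma exists_eq_two_pow_add {n : ℕ} (hn : n ≠ 0) : ∃ k i, i < 2 ^ k ∧ n = 2 ^ k + i := by
  refine ⟨Nat.log 2 n, n - 2 ^ Nat.log 2 n, ?_, ?_⟩
  · have := Nat.lt_pow_succ_log_self (b := 2) (by norm_num) n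
    rw [pow_succ] at this
    omega
  · have := Nat.pow_log_le_self 2 hn
    omega

/-- The weight of the right-hand version in the classical Haar functions. -/
def rightWeight (x : ℝ) : ℝ := if x = 0 then 1 else if x = 1 then 0 else 1 / 2

/-- The values at jumps are averages of the two one-sided versions with a weight independent of `n`,
so kernel identities for the one-sided versions extend by bilinearity. -/
lemma haar_eq_side {x : ℝ} (hx : x ∈ Set.Icc (0 : ℝ) 1) (n : ℕ) :
    haar n x = rightWeight x * haarSide unitRight n x +
      (1 - rightWeight x) * haarSide unitLeft n x := by
  have hR : (fun y => unitRight (2 * y) - unitRight (2 * y - 1)) = haarMotherRight :=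
    funext fun y => (haarMotherRight_eq y).symm
  have hL : (fun y => unitLeft (2 * y) - unitLeft (2 * y - 1)) = haarMotherLeft :=
    funext fun y => (haarMotherLeft_eq y).symm
  unfold haar haarSide rightWeight
  rw [hR, hL]
  rcases eq_or_ne n 0 with rfl | hn
  · simp only [if_true]
    obtain ⟨h0, h1⟩ := hx
    rcases eq_or_lt_of_le h0 with rfl | h0
    · simp [unitRight]
    · rcases eq_or_lt_of_le h1 with rfl | h1
      · simp [unitLeft]
      · simp [unitRight, unitLeft, h0.ne', h1.ne, h0, h1, h0.le, h1.le]
  · simp only [if_neg hn]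
    split_ifs <;> ring

/-- The kernel of order 2^m is 2^m times the indicator of the diagonal dyadic squares. Two different
one-sided versions are allowed in the two variables, because the mixed products occur when the
classical values are expanded. -/
lemma sum_haarSide_mul {B B' : ℝ → ℝ} (hB : IsUnit01 B) (hB' : IsUnit01 B') (m : ℕ) (x t : ℝ) :
    ∑ n ∈ Finset.range (2 ^ m), haarSide B n x * haarSide B' n t =
      2 ^ m * ∑ i ∈ Finset.range (2 ^ m), B ((2 : ℝ) ^ m * x - i) * B' ((2 : ℝ) ^ m * t - i) := by
  induction m with
  | zero => simp [haarSide]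
  | succ m ih =>
    conv_lhs => rw [pow_succ, mul_comm, two_mul, Finset.sum_range_add, ih]
    rw [pow_succ (2 : ℕ) m, sum_range_mul_eq, pow_succ (2 : ℝ) m]
    simp only [Finset.mul_sum]
    rw [← Finset.sum_add_distrib]
    refine Finset.sum_congr rfl fun i hi => ?_
    have hi' := Finset.mem_range.1 hi
    rw [haarSide_pow_add hi', haarSide_pow_add hi', Finset.sum_range_succ, Finset.sum_range_one]
    push_cast
    have hs : √((2 : ℝ) ^ m) * √((2 : ℝ) ^ m) = 2 ^ m := Real.mul_self_sqrt (by positivity)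
    have e : ∀ z : ℝ, (2 : ℝ) ^ m * 2 * z - i * 2 = 2 * ((2 : ℝ) ^ m * z - i) := fun z => by ring
    have e' : ∀ z : ℝ, (2 : ℝ) ^ m * 2 * z - (i * 2 + 1) = 2 * ((2 : ℝ) ^ m * z - i) - 1 :=
      fun z => by ring
    rw [hB.refine_eq ((2 : ℝ) ^ m * x - i), hB'.refine_eq ((2 : ℝ) ^ m * t - i)]
    simp only [e, e', add_zero]
    -- With a, b the two halves of a dyadic interval: (a+b)(a'+b') + (a-b)(a'-b') = 2(aa' + bb').
    linear_combination ((B (2 * ((2 : ℝ) ^ m * x - i)) - B (2 * ((2 : ℝ) ^ m * x - i) - 1)) *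
      (B' (2 * ((2 : ℝ) ^ m * t - i)) - B' (2 * ((2 : ℝ) ^ m * t - i) - 1))) * hs

lemma IsUnit01.mul_eq_zero {B B' : ℝ → ℝ} (hB : IsUnit01 B) (hB' : IsUnit01 B') {y z : ℝ}
    (h : 1 < |y - z|) : B y * B' z = 0 := by
  by_contra hne
  obtain ⟨h1, h2⟩ := mul_ne_zero_iff.1 hne
  obtain ⟨a1, a2⟩ := hB.support _ h1
  obtain ⟨b1, b2⟩ := hB'.support _ h2
  have : |y - z| ≤ 1 := _root_.abs_le.2 ⟨by linarith, by linarith⟩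
  linarith

lemma haarSide_support {B : ℝ → ℝ} (hB : IsUnit01 B) {k i : ℕ} (hi : i < 2 ^ k) {x : ℝ}
    (h : haarSide B (2 ^ k + i) x ≠ 0) : 0 ≤ (2 : ℝ) ^ k * x - i ∧ (2 : ℝ) ^ k * x - i ≤ 1 := by
  rw [haarSide_pow_add hi] at h
  have h1 := right_ne_zero_of_mul h
  by_cases h2 : B (2 * ((2 : ℝ) ^ k * x - i)) = 0
  · have h3 : B (2 * ((2 : ℝ) ^ k * x - i) - 1) ≠ 0 := by
      intro h3; rw [h2, h3, sub_zero] at h1; exact h1 rfl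
    have := hB.support _ h3
    constructor <;> linarith
  · have := hB.support _ h2
    constructor <;> linarith

/-- From the index 2^m on, every support lies in a closed dyadic interval of length at most 2^(-m),
too short to contain both points. -/
lemma haarSide_mul_eq_zero {B B' : ℝ → ℝ} (hB : IsUnit01 B) (hB' : IsUnit01 B') {m n : ℕ}
    (hn : 2 ^ m ≤ n) {x t : ℝ} (h : 1 < (2 : ℝ) ^ m * |x - t|) :
    haarSide B n x * haarSide B' n t = 0 := by
  obtain ⟨k, i, hi, rfl⟩ := exists_eq_two_pow_add (n := n) (by
    have : 0 < 2 ^ m := by positivity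
    omega)
  by_contra hne
  obtain ⟨h1, h2⟩ := mul_ne_zero_iff.1 hne
  obtain ⟨a1, a2⟩ := haarSide_support hB hi h1
  obtain ⟨b1, b2⟩ := haarSide_support hB' hi h2
  have hmk : m ≤ k := by
    by_contra! hkm
    have := Nat.pow_le_pow_right (n := 2) (by norm_num) (show k + 1 ≤ m from hkm)
    rw [pow_succ] at this
    omega
  have h3 : (2 : ℝ) ^ m * |x - t| ≤ (2 : ℝ) ^ k * |x - t| := by
    gcongr
    norm_num
  have h4 : (2 : ℝ) ^ k * |x - t| ≤ 1 := by
    have h5 : (2 : ℝ) ^ k * |x - t| = |(2 : ℝ) ^ k * x - (2 : ℝ) ^ k * t| := by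
      rw [← mul_sub, abs_mul, abs_of_pos (show (0 : ℝ) < 2 ^ k by positivity)]
    rw [h5]
    exact abs_le.2 ⟨by linarith, by linarith⟩
  linarith

lemma sum_haarSide_mul_eq_zero {B B' : ℝ → ℝ} (hB : IsUnit01 B) (hB' : IsUnit01 B') {m N : ℕ}
    (hN : 2 ^ m ≤ N) {x t : ℝ} (h : 1 < (2 : ℝ) ^ m * |x - t|) :
    ∑ n ∈ Finset.range N, haarSide B n x * haarSide B' n t = 0 := by
  obtain ⟨d, rfl⟩ := Nat.exists_eq_add_of_le hN
  rw [Finset.sum_range_add, sum_haarSide_mul hB hB',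
    Finset.sum_eq_zero fun i _ => hB.mul_eq_zero hB' ?_,
    Finset.sum_eq_zero fun i _ => haarSide_mul_eq_zero hB hB' (Nat.le_add_right _ i) h]
  · simp
  · rw [sub_sub_sub_cancel_right, ← mul_sub, abs_mul, abs_of_pos (by positivity)]
    exact h

lemma sum_haar_mul_eq_zero {m N : ℕ} (hN : 2 ^ m ≤ N) {x t : ℝ} (hx : x ∈ Set.Icc (0 : ℝ) 1)
    (ht : t ∈ Set.Icc (0 : ℝ) 1) (h : 1 < (2 : ℝ) ^ m * |x - t|) :
    ∑ n ∈ Finset.range N, haar n x * haar n t = 0 := by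
  have key : ∀ n, haar n x * haar n t =
      rightWeight x * rightWeight t * (haarSide unitRight n x * haarSide unitRight n t) +
      rightWeight x * (1 - rightWeight t) * (haarSide unitRight n x * haarSide unitLeft n t) +
      (1 - rightWeight x) * rightWeight t * (haarSide unitLeft n x * haarSide unitRight n t) +
      (1 - rightWeight x) * (1 - rightWeight t) *
        (haarSide unitLeft n x * haarSide unitLeft n t) := by
    intro n
    rw [haar_eq_side hx, haar_eq_side ht]
    ring
  simp only [key, Finset.sum_add_distrib, ← Finset.mul_sum]
  rw [sum_haarSide_mul_eq_zero isUnit01_unitRight isUnit01_unitRight hN h,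
    sum_haarSide_mul_eq_zero isUnit01_unitRight isUnit01_unitLeft hN h,
    sum_haarSide_mul_eq_zero isUnit01_unitLeft isUnit01_unitRight hN h,
    sum_haarSide_mul_eq_zero isUnit01_unitLeft isUnit01_unitLeft hN h]
  simp

lemma measurable_haarDilate {ψ : ℝ → ℝ} (hψ : Measurable ψ) (n : ℕ) :
    Measurable (haarDilate ψ n) := by
  unfold haarDilate
  exact (hψ.comp ((measurable_const_mul _).sub_const _)).const_mul _

lemma measurable_haar (n : ℕ) : Measurable (haar n) := by
  have hR : Measurable haarMotherRight := by
    rw [funext haarMotherRight_eq]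
    have := isUnit01_unitRight.measurable
    fun_prop
  have hL : Measurable haarMotherLeft := by
    rw [funext haarMotherLeft_eq]
    have := isUnit01_unitLeft.measurable
    fun_prop
  have h1 := measurable_haarDilate hR n
  have h2 := measurable_haarDilate hL n
  unfold haar
  split_ifs
  · exact measurable_const
  · exact Measurable.ite (measurableSet_singleton 0) h1
      (Measurable.ite (measurableSet_singleton 1) h2 ((h1.add h2).div_const 2))

lemma abs_haar_le (n : ℕ) (x : ℝ) : |haar n x| ≤ 1 + √((2 : ℝ) ^ Nat.log 2 n) := by
  have hR : ∀ y, |haarMotherRight y| ≤ 1 := fun y => by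
    unfold haarMotherRight; split_ifs <;> simp
  have hL : ∀ y, |haarMotherLeft y| ≤ 1 := fun y => by
    unfold haarMotherLeft; split_ifs <;> simp
  have hd : ∀ ψ : ℝ → ℝ, (∀ y, |ψ y| ≤ 1) → |haarDilate ψ n x| ≤ √((2 : ℝ) ^ Nat.log 2 n) := by
    intro ψ hψ
    rw [haarDilate, abs_mul, abs_of_nonneg (Real.sqrt_nonneg _)]
    exact mul_le_of_le_one_right (Real.sqrt_nonneg _) (hψ _)
  have h1 := abs_le.1 (hd _ hR)
  have h2 := abs_le.1 (hd _ hL)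
  have h3 := Real.sqrt_nonneg ((2 : ℝ) ^ Nat.log 2 n)
  unfold haar
  split_ifs
  · rw [abs_one]; linarith
  all_goals exact abs_le.2 ⟨by linarith, by linarith⟩

lemma intervalIntegrable_haar (n : ℕ) (a b : ℝ) : IntervalIntegrable (haar n) volume a b :=
  (intervalIntegrable_const (c := 1 + √((2 : ℝ) ^ Nat.log 2 n))).mono_fun
    (measurable_haar n).aestronglyMeasurable (ae_of_all _ fun t =>
      (abs_haar_le n t).trans (le_abs_self _))

/-- The tent function with peak `1` at `1 / 2` and support `[0, 1]`. -/
def tent (y : ℝ) : ℝ := max 0 (min (2 * y) 1) - max 0 (min (2 * y - 1) 1)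

lemma tent_of_nonpos {y : ℝ} (h : y ≤ 0) : tent y = 0 := by
  rw [tent, max_eq_left, max_eq_left, sub_zero] <;> refine (min_le_left _ _).trans (by linarith)

lemma tent_of_one_le {y : ℝ} (h : 1 ≤ y) : tent y = 0 := by
  rw [tent, min_eq_right (by linarith), min_eq_right (by linarith), sub_self]

lemma tent_of_le_half {y : ℝ} (h0 : 0 ≤ y) (h : y ≤ 1 / 2) : tent y = 2 * y := by
  rw [tent, min_eq_left (by linarith), max_eq_right (by linarith), min_eq_left (by linarith),
    max_eq_left (by linarith), sub_zero]

lemma tent_of_half_le {y : ℝ} (h : 1 / 2 ≤ y) (h1 : y ≤ 1) : tent y = 2 - 2 * y := by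
  rw [tent, min_eq_right (by linarith), max_eq_right (by linarith), min_eq_left (by linarith),
    max_eq_right (by linarith)]
  ring

lemma IsUnit01.integral_comp {B : ℝ → ℝ} (hB : IsUnit01 B) {a : ℝ} (ha : 0 < a) {c : ℝ} (hc : 0 ≤ c)
    (x : ℝ) : ∫ t in (0 : ℝ)..x, B (a * t - c) = a⁻¹ * max 0 (min (a * x - c) 1) := by
  have hint : ∀ u v, IntervalIntegrable B volume u v := fun u v =>
    (intervalIntegrable_const (c := (1 : ℝ))).mono_fun hB.measurable.aestronglyMeasurable
      (ae_of_all _ fun t => by simpa using hB.abs_le t)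
  have h0 : ∫ t in (0 : ℝ)..(a * 0 - c), B t = 0 := by
    rw [hB.integral, max_eq_left]
    exact (min_le_left _ _).trans (by linarith)
  rw [intervalIntegral.integral_comp_mul_sub _ ha.ne', smul_eq_mul,
    ← intervalIntegral.integral_add_adjacent_intervals (hint _ 0) (hint 0 _),
    intervalIntegral.integral_symm, h0, hB.integral]
  ring

lemma integral_haarSide {B : ℝ → ℝ} (hB : IsUnit01 B) {k i : ℕ} (hi : i < 2 ^ k) (x : ℝ) :
    ∫ t in (0 : ℝ)..x, haarSide B (2 ^ k + i) t =
      √((2 : ℝ) ^ k) / 2 ^ (k + 1) * tent ((2 : ℝ) ^ k * x - i) := by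
  have hint : ∀ c : ℝ, IntervalIntegrable (fun t => B ((2 : ℝ) ^ (k + 1) * t - c)) volume 0 x :=
    fun c => (intervalIntegrable_const (c := (1 : ℝ))).mono_fun
      (hB.measurable.comp ((measurable_const_mul _).sub_const _)).aestronglyMeasurable
      (ae_of_all _ fun t => by simpa using hB.abs_le _)
  have e1 : ∀ t : ℝ, 2 * ((2 : ℝ) ^ k * t - i) = (2 : ℝ) ^ (k + 1) * t - 2 * i := fun t => by ring
  have e2 : ∀ t : ℝ, (2 : ℝ) ^ (k + 1) * t - 2 * i - 1 = (2 : ℝ) ^ (k + 1) * t - (2 * i + 1) :=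
    fun t => by ring
  simp only [haarSide_pow_add hi, e1, e2]
  rw [intervalIntegral.integral_const_mul, intervalIntegral.integral_sub (hint _) (hint _),
    hB.integral_comp (by positivity) (by positivity), hB.integral_comp (by positivity) (by positivity),
    tent, e1, e2]
  ring

/-- Inside (0, 1) both one-sided versions enter with weight 1/2, and both have the same primitive, a
multiple of a tent. -/
lemma schauder_succ {k i : ℕ} (hi : i < 2 ^ k) {x : ℝ} (hx : x ∈ Set.Icc (0 : ℝ) 1) :
    schauder (2 ^ k + i + 1) x = √((2 : ℝ) ^ k) / 2 ^ (k + 1) * tent ((2 : ℝ) ^ k * x - i) := by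
  have hside : ∀ B : ℝ → ℝ, IsUnit01 B → IntegrableOn (haarSide B (2 ^ k + i)) (Set.Ioo 0 x) := by
    intro B hB
    refine IntegrableOn.of_bound measure_Ioo_lt_top ?_ (√((2 : ℝ) ^ k) * 2) (ae_of_all _ fun t => ?_)
    · have hm := hB.measurable
      have h1 : haarSide B (2 ^ k + i) = fun t => _ := funext fun t => haarSide_pow_add hi t
      rw [h1]
      exact Measurable.aestronglyMeasurable (by fun_prop)
    · rw [haarSide_pow_add hi, norm_mul, Real.norm_of_nonneg (Real.sqrt_nonneg _)]
      gcongr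
      refine (norm_sub_le _ _).trans ?_
      have h1 := hB.abs_le (2 * ((2 : ℝ) ^ k * t - i))
      have h2 := hB.abs_le (2 * ((2 : ℝ) ^ k * t - i) - 1)
      rw [Real.norm_eq_abs, Real.norm_eq_abs]
      linarith
  rw [schauder, if_neg (by omega), Nat.add_sub_cancel, intervalIntegral.integral_of_le hx.1,
    integral_Ioc_eq_integral_Ioo, setIntegral_congr_fun (g := fun t =>
      (1 / 2) * haarSide unitRight (2 ^ k + i) t + (1 / 2) * haarSide unitLeft (2 ^ k + i) t)
      measurableSet_Ioo]
  · rw [integral_add ((hside _ isUnit01_unitRight).const_mul _)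
      ((hside _ isUnit01_unitLeft).const_mul _), integral_const_mul, integral_const_mul,
      ← integral_Ioc_eq_integral_Ioo, ← integral_Ioc_eq_integral_Ioo,
      ← intervalIntegral.integral_of_le hx.1, ← intervalIntegral.integral_of_le hx.1,
      integral_haarSide isUnit01_unitRight hi, integral_haarSide isUnit01_unitLeft hi]
    ring
  · intro t ht
    have h0 : t ≠ 0 := ht.1.ne'
    have h1 : t ≠ 1 := (ht.2.trans_le hx.2).ne
    simp only
    rw [haar_eq_side ⟨ht.1.le, (ht.2.trans_le hx.2).le⟩, rightWeight, if_neg h0, if_neg h1]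
    ring

lemma integral_haar (n : ℕ) : ∫ t in (0 : ℝ)..1, haar n t = if n = 0 then 1 else 0 := by
  split_ifs with h
  · simp [h, haar]
  · obtain ⟨k, i, hi, rfl⟩ := exists_eq_two_pow_add h
    have h1 := schauder_succ hi (x := 1) ⟨zero_le_one, le_rfl⟩
    rw [schauder, if_neg (by omega), Nat.add_sub_cancel, tent_of_one_le, mul_zero] at h1
    · exact h1
    · have : (i : ℝ) + 1 ≤ 2 ^ k := by exact_mod_cast hi
      linarith

end Haar

/-! ### Localization from small kernels, and the Haar system -/

namespace ClassicalSystem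

/-- Systems whose kernels eventually become uniformly small off the diagonal. -/
lemma Tame.localizing_of_kernel_small {Φ : ClassicalSystem} (h : Φ.Tame)
    (hone : ∀ j, ∀ x ∈ Set.Icc 0 Φ.length, Φ.partialSum (fun _ => 1) x j = 1)
    (hsmall : ∀ r > 0, ∀ ε > 0, ∃ J, ∀ j ≥ J, ∀ x ∈ Set.Icc 0 Φ.length,
      ∀ t ∈ Set.Icc 0 Φ.length, r ≤ gap Φ.length x t → ‖Φ.kernel j x t‖ ≤ ε) :
    Φ.Localizing where
  toTame := h
  partialSum_one := hone
  kernel_bounded r hr := by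
    obtain ⟨J, hJ⟩ := hsmall r hr 1 one_pos
    choose B hB using h.bounded
    have hB0 : ∀ k, 0 ≤ B k := fun k =>
      (norm_nonneg _).trans (hB k 0 ⟨le_rfl, h.length_pos.le⟩)
    let D : ℕ → ℝ := fun j => ∑ k ∈ Finset.range (Φ.terms j), B k * B k
    have hD0 : ∀ j, 0 ≤ D j := fun j => Finset.sum_nonneg fun k _ => mul_self_nonneg _
    -- From `J` on the kernels are at most 1; the finitely many earlier ones are bounded through the
    -- bounds of the functions.
    refine ⟨1 + ∑ j ∈ Finset.range J, D j, fun j x hx t ht hxt => ?_⟩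
    have hD1 : 0 ≤ ∑ j ∈ Finset.range J, D j := Finset.sum_nonneg fun j _ => hD0 j
    rcases le_or_gt J j with hj | hj
    · exact (hJ j hj x hx t ht hxt).trans (by linarith)
    · have h1 : ‖Φ.kernel j x t‖ ≤ D j := by
        refine (norm_sum_le _ _).trans (Finset.sum_le_sum fun k _ => ?_)
        rw [norm_mul, RCLike.norm_conj]
        exact mul_le_mul (hB k x hx) (hB k t ht) (norm_nonneg _) (hB0 k)
      have h2 : D j ≤ ∑ j ∈ Finset.range J, D j :=
        Finset.single_le_sum (fun j _ => hD0 j) (Finset.mem_range.2 hj)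
      linarith
  localization g hg hg1 r hr ε hε := by
    obtain ⟨J, hJ⟩ := hsmall r hr (ε / Φ.length) (div_pos hε h.length_pos)
    refine ⟨J, fun j hj x hx hgx => ?_⟩
    rw [h.partialSum_eq hg hg1]
    have hε' : 0 ≤ ε / Φ.length := (div_pos hε h.length_pos).le
    refine (norm_setIntegral_le_of_norm_le_const (C := ε / Φ.length) measure_Icc_lt_top
      fun t ht => ?_).trans_eq ?_
    · rcases lt_or_ge (gap Φ.length x t) r with h1 | h1
      · simpa [hgx t ht h1] using hε'
      · rw [norm_mul]
        calc ‖g t‖ * ‖Φ.kernel j x t‖ ≤ 1 * (ε / Φ.length) :=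
              mul_le_mul (hg1 t) (hJ j hj x hx t ht h1) (norm_nonneg _) one_pos.le
          _ = _ := one_mul _
    · rw [Measure.real, Real.volume_Icc, sub_zero, ENNReal.toReal_ofReal h.length_pos.le]
      exact div_mul_cancel₀ _ h.length_pos.ne'

theorem localizing_haar : haar.Localizing := by
  refine Tame.localizing_of_kernel_small ⟨one_pos, fun k => ?_, fun k => ?_⟩ (fun j x _ => ?_)
    fun r hr ε hε => ?_
  · exact Complex.measurable_ofReal.comp (measurable_haar k)
  · refine ⟨1 + √((2 : ℝ) ^ Nat.log 2 k), fun x _ => ?_⟩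
    change ‖((OrthoDiv.haar k x : ℝ) : ℂ)‖ ≤ _
    rw [Complex.norm_real]
    exact abs_haar_le k x
  · have hc : ∀ k, haar.coeff (fun _ => 1) k = if 0 = k then 1 else 0 := by
      intro k
      change (∫ t in (0 : ℝ)..1, 1 * (starRingEnd ℂ) ((OrthoDiv.haar k t : ℝ) : ℂ)) = _
      simp only [one_mul, Complex.conj_ofReal]
      rw [intervalIntegral.integral_ofReal, integral_haar]
      by_cases h : k = 0
      · simp [h]
      · simp [h, Ne.symm h]
    rw [partialSum]
    simp only [hc, ite_mul, one_mul, zero_mul]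
    rw [Finset.sum_ite_eq]
    simp only [Finset.mem_range]
    refine (if_pos (Nat.succ_pos j)).trans ?_
    simp [fn, OrthoDiv.haar]
  · obtain ⟨m, hm⟩ := exists_pow_lt_of_lt_one hr (show (1 / 2 : ℝ) < 1 by norm_num)
    refine ⟨2 ^ m, fun j hj x hx t ht hxt => ?_⟩
    have h1 : haar.kernel j x t =
        ((∑ n ∈ Finset.range (j + 1), OrthoDiv.haar n x * OrthoDiv.haar n t : ℝ) : ℂ) := by
      push_cast
      simp only [kernel, fn, Complex.conj_ofReal, terms]
    rw [h1, sum_haar_mul_eq_zero (m := m) (by omega) hx ht]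
    · simpa using hε.le
    · have h2 : r ≤ |x - t| := hxt.trans (min_le_left _ _)
      have h3 : (1 / 2 : ℝ) ^ m < |x - t| := hm.trans_le h2
      rw [one_div_pow, div_lt_iff₀ (by positivity)] at h3
      linarith

end ClassicalSystem

/-! ### Linear splines on dyadic partitions and the Faber–Schauder functions -/

section Splines

/-- The function `v` is affine on `[a, b]`. -/
def AffineOn (v : ℝ → ℝ) (a b : ℝ) : Prop := ∃ α β : ℝ, ∀ t ∈ Set.Icc a b, v t = α + β * t

lemma AffineOn.mono {v : ℝ → ℝ} {a b a' b' : ℝ} (h : AffineOn v a b) (ha : a ≤ a') (hb : b' ≤ b) :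
    AffineOn v a' b' := by
  obtain ⟨α, β, h⟩ := h
  exact ⟨α, β, fun t ht => h t ⟨ha.trans ht.1, ht.2.trans hb⟩⟩

lemma AffineOn.congr {v w : ℝ → ℝ} {a b : ℝ} (h : AffineOn v a b)
    (hvw : ∀ t ∈ Set.Icc a b, w t = v t) : AffineOn w a b := by
  obtain ⟨α, β, h⟩ := h
  exact ⟨α, β, fun t ht => (hvw t ht).trans (h t ht)⟩

lemma affineOn_of_eq_zero {v : ℝ → ℝ} {a b : ℝ} (h : ∀ t ∈ Set.Icc a b, v t = 0) :
    AffineOn v a b := ⟨0, 0, fun t ht => by rw [h t ht]; ring⟩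

lemma AffineOn.add {v w : ℝ → ℝ} {a b : ℝ} (hv : AffineOn v a b) (hw : AffineOn w a b) :
    AffineOn (fun t => v t + w t) a b := by
  obtain ⟨α, β, hv⟩ := hv
  obtain ⟨α', β', hw⟩ := hw
  exact ⟨α + α', β + β', fun t ht => by simp only [hv t ht, hw t ht]; ring⟩

lemma AffineOn.const_mul {v : ℝ → ℝ} {a b : ℝ} (c : ℝ) (hv : AffineOn v a b) :
    AffineOn (fun t => c * v t) a b := by
  obtain ⟨α, β, hv⟩ := hv
  exact ⟨c * α, c * β, fun t ht => by simp only [hv t ht]; ring⟩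

lemma AffineOn.abs_le {u : ℝ → ℝ} {a b t : ℝ} (hu : AffineOn u a b) (ht : t ∈ Set.Icc a b)
    {C : ℝ} (ha : |u a| ≤ C) (hb : |u b| ≤ C) : |u t| ≤ C := by
  obtain ⟨α, β, h⟩ := hu
  have hab := ht.1.trans ht.2
  rw [h a ⟨le_rfl, hab⟩, abs_le'] at ha
  rw [h b ⟨hab, le_rfl⟩, abs_le'] at hb
  rw [h t ht, abs_le']
  rcases le_total 0 β with hβ | hβ
  · have h1 := mul_le_mul_of_nonneg_left ht.1 hβ
    have h2 := mul_le_mul_of_nonneg_left ht.2 hβ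
    constructor <;> linarith
  · have h1 := mul_le_mul_of_nonpos_left ht.1 hβ
    have h2 := mul_le_mul_of_nonpos_left ht.2 hβ
    constructor <;> linarith

/-- The linear splines on `[0, 1]` whose knots are the multiples of `2 ^ (-k)` and the first `i`
midpoints between them. -/
structure IsSpline (k i : ℕ) (v : ℝ → ℝ) : Prop where
  fine : ∀ l < 2 * i, AffineOn v (l / 2 ^ (k + 1)) ((l + 1) / 2 ^ (k + 1))
  coarse : ∀ l, i ≤ l → l < 2 ^ k → AffineOn v (l / 2 ^ k) ((l + 1) / 2 ^ k)

lemma IsSpline.add {k i : ℕ} {v w : ℝ → ℝ} (hv : IsSpline k i v) (hw : IsSpline k i w) :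
    IsSpline k i fun t => v t + w t :=
  ⟨fun l hl => (hv.fine l hl).add (hw.fine l hl),
    fun l hl hl' => (hv.coarse l hl hl').add (hw.coarse l hl hl')⟩

lemma IsSpline.const_mul {k i : ℕ} {v : ℝ → ℝ} (c : ℝ) (hv : IsSpline k i v) :
    IsSpline k i fun t => c * v t :=
  ⟨fun l hl => (hv.fine l hl).const_mul c, fun l hl hl' => (hv.coarse l hl hl').const_mul c⟩

lemma isSpline_zero (k i : ℕ) : IsSpline k i fun _ => 0 :=
  ⟨fun _ _ => affineOn_of_eq_zero fun _ _ => rfl, fun _ _ _ => affineOn_of_eq_zero fun _ _ => rfl⟩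

lemma IsSpline.sum {k i : ℕ} {ι : Type*} (s : Finset ι) {v : ι → ℝ → ℝ}
    (hv : ∀ m ∈ s, IsSpline k i (v m)) : IsSpline k i fun t => ∑ m ∈ s, v m t := by
  classical
  induction s using Finset.induction_on with
  | empty => simpa using isSpline_zero k i
  | insert a s ha ih =>
    simp only [Finset.sum_insert ha]
    exact (hv a (Finset.mem_insert_self _ _)).add (ih fun m hm => hv m (Finset.mem_insert_of_mem hm))

lemma IsSpline.refine {k i : ℕ} (hi : i < 2 ^ k) {v : ℝ → ℝ} (hv : IsSpline k i v) :
    IsSpline k (i + 1) v := by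
  refine ⟨fun l hl => ?_, fun l hl hl' => hv.coarse l (by omega) hl'⟩
  by_cases h : l < 2 * i
  · exact hv.fine l h
  · have h2 : (0 : ℝ) < 2 ^ k := by positivity
    have h1 : (2 * i : ℝ) ≤ l := by exact_mod_cast not_lt.1 h
    have h3 : (l + 1 : ℝ) ≤ 2 * i + 2 := by exact_mod_cast (by omega : l + 1 ≤ 2 * i + 2)
    refine (hv.coarse i le_rfl hi).mono ?_ ?_
    · rw [pow_succ, div_le_div_iff₀ h2 (by positivity)]
      nlinarith
    · rw [pow_succ, div_le_div_iff₀ (by positivity) h2]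
      nlinarith

/-- Once all 2^k midpoints have been inserted, the partition is the uniform one of the next level;
this links the levels in `dyadic_induction`. -/
lemma isSpline_succ_zero_iff {k : ℕ} {v : ℝ → ℝ} :
    IsSpline (k + 1) 0 v ↔ IsSpline k (2 ^ k) v := by
  have e : 2 ^ (k + 1) = 2 * 2 ^ k := by ring
  constructor
  · intro h
    exact ⟨fun l hl => h.coarse l (Nat.zero_le _) (by omega), fun l hl hl' => by omega⟩
  · intro h
    exact ⟨fun l hl => by omega, fun l _ hl => h.fine l (by omega)⟩

lemma two_pow_mul_le_of_le_div {k : ℕ} {t : ℝ} {c d : ℝ} (h : t ≤ c / 2 ^ (k + 1)) (hc : c ≤ 2 * d) :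
    (2 : ℝ) ^ k * t ≤ d := by
  have h2 : (0 : ℝ) < 2 ^ k := by positivity
  rw [pow_succ, le_div_iff₀ (by positivity)] at h
  linarith

lemma le_two_pow_mul_of_div_le {k : ℕ} {t : ℝ} {c d : ℝ} (h : c / 2 ^ (k + 1) ≤ t) (hc : 2 * d ≤ c) :
    d ≤ (2 : ℝ) ^ k * t := by
  have h2 : (0 : ℝ) < 2 ^ k := by positivity
  rw [pow_succ, div_le_iff₀ (by positivity)] at h
  linarith

lemma isSpline_tent (k i : ℕ) :
    IsSpline k (i + 1) fun t => tent ((2 : ℝ) ^ k * t - i) := by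
  have h2 : (0 : ℝ) < 2 ^ k := by positivity
  refine ⟨fun l hl => ?_, fun l hl hl' => affineOn_of_eq_zero fun t ht => tent_of_one_le ?_⟩
  · by_cases h : l < 2 * i
    · have h1 : (l + 1 : ℝ) ≤ 2 * i := by exact_mod_cast h
      refine affineOn_of_eq_zero fun t ht => tent_of_nonpos ?_
      have := two_pow_mul_le_of_le_div ht.2 h1
      linarith
    · obtain rfl | rfl : l = 2 * i ∨ l = 2 * i + 1 := by omega
      · refine ⟨-2 * i, 2 * 2 ^ k, fun t ht => ?_⟩
        push_cast at ht
        have h1 := le_two_pow_mul_of_div_le ht.1 (d := i) le_rfl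
        have h3 := two_pow_mul_le_of_le_div ht.2 (d := i + 1 / 2) (by linarith)
        beta_reduce
        rw [tent_of_le_half (by linarith) (by linarith)]
        ring
      · refine ⟨2 + 2 * i, -2 * 2 ^ k, fun t ht => ?_⟩
        push_cast at ht
        have h1 := le_two_pow_mul_of_div_le ht.1 (d := i + 1 / 2) (by linarith)
        have h3 := two_pow_mul_le_of_le_div ht.2 (d := i + 1) (by linarith)
        beta_reduce
        rw [tent_of_half_le (by linarith) (by linarith)]
        ring
  · have h1 : (i + 1 : ℝ) ≤ l := by exact_mod_cast hl
    have := ht.1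
    rw [div_le_iff₀ h2] at this
    linarith

/-- Every spline is the sum of a coarser spline and a multiple of a tent function. -/
lemma IsSpline.exists_sub_tent {k i : ℕ} {v : ℝ → ℝ} (hv : IsSpline k (i + 1) v) :
    ∃ c, IsSpline k i fun t => v t + c * tent ((2 : ℝ) ^ k * t - i) := by
  have h2 : (0 : ℝ) < 2 ^ k := by positivity
  obtain ⟨α₁, β₁, h₁⟩ := hv.fine (2 * i) (by omega)
  obtain ⟨α₂, β₂, h₂⟩ := hv.fine (2 * i + 1) (by omega)
  push_cast at h₁ h₂
  have hm : α₁ + β₁ * ((2 * i + 1) / 2 ^ (k + 1)) = α₂ + β₂ * ((2 * i + 1) / 2 ^ (k + 1)) := by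
    rw [← h₁ _ ⟨by gcongr; linarith, le_rfl⟩, ← h₂ _ ⟨le_rfl, by gcongr; linarith⟩]
  -- The slope of the tent drops by 4·2^k at the midpoint, so this multiple cancels the jump β₂ - β₁
  -- of the slope of `v`.
  set c : ℝ := -((β₁ - β₂) / 2 ^ (k + 2)) with hc
  have hm' : α₁ - α₂ = 2 * c * (2 * i + 1) := by
    rw [hc]
    field_simp at hm ⊢
    rw [pow_succ, pow_succ] at *
    linear_combination 2 * hm
  have hβ : β₁ - β₂ = -(4 * 2 ^ k * c) := by
    rw [hc, pow_add]
    field_simp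
    norm_num
  refine ⟨c, fun l hl => ?_, fun l hl hl' => ?_⟩
  · refine (hv.fine l (by omega)).congr fun t ht => ?_
    have h1 : (l + 1 : ℝ) ≤ 2 * i := by exact_mod_cast hl
    have := two_pow_mul_le_of_le_div ht.2 h1
    rw [tent_of_nonpos (by linarith), mul_zero, add_zero]
  · rcases eq_or_lt_of_le hl with rfl | hl
    · refine ⟨α₁ - 2 * c * i, β₁ + 2 * 2 ^ k * c, fun t ht => ?_⟩
      have ht1 := ht.1
      have ht2 := ht.2
      rw [div_le_iff₀ h2] at ht1
      rw [le_div_iff₀ h2] at ht2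
      beta_reduce
      rcases le_total ((2 : ℝ) ^ k * t) (i + 1 / 2) with h | h
      · rw [tent_of_le_half (by linarith) (by linarith), h₁ t ⟨?_, ?_⟩]
        · ring
        · rw [pow_succ, div_le_iff₀ (by positivity)]; linarith
        · rw [pow_succ, le_div_iff₀ (by positivity)]; linarith
      · rw [tent_of_half_le (by linarith) (by linarith), h₂ t ⟨?_, ?_⟩]
        · linear_combination -hm' - t * hβ
        · rw [pow_succ, div_le_iff₀ (by positivity)]; linarith
        · rw [pow_succ, le_div_iff₀ (by positivity)]; linarith
    · refine (hv.coarse l hl hl').congr fun t ht => ?_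
      have h1 : (i + 1 : ℝ) ≤ l := by exact_mod_cast hl
      have := ht.1
      rw [div_le_iff₀ h2] at this
      rw [tent_of_one_le (by linarith), mul_zero, add_zero]

lemma IsSpline.congr {k i : ℕ} (hi : i ≤ 2 ^ k) {v w : ℝ → ℝ} (hv : IsSpline k i v)
    (h : ∀ t ∈ Set.Icc (0 : ℝ) 1, w t = v t) : IsSpline k i w := by
  refine ⟨fun l hl => (hv.fine l hl).congr fun t ht => h t ⟨?_, ?_⟩,
    fun l hl hl' => (hv.coarse l hl hl').congr fun t ht => h t ⟨?_, ?_⟩⟩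
  · exact le_trans (by positivity) ht.1
  · refine ht.2.trans ((div_le_one (by positivity)).2 ?_)
    have : l + 1 ≤ 2 ^ (k + 1) := by rw [pow_succ]; omega
    exact_mod_cast this
  · exact le_trans (by positivity) ht.1
  · refine ht.2.trans ((div_le_one (by positivity)).2 ?_)
    exact_mod_cast hl'

/-- Induction along the refinements of the dyadic partitions. -/
lemma dyadic_induction {P : ℕ → ℕ → Prop} (h0 : P 0 0) (hstep : ∀ k i, i < 2 ^ k → P k i → P k (i + 1))
    (hnext : ∀ k, P k (2 ^ k) → P (k + 1) 0) (k i : ℕ) (hi : i ≤ 2 ^ k) : P k i := by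
  have h1 : ∀ k, P k 0 → ∀ i ≤ 2 ^ k, P k i := by
    intro k hk i
    induction i with
    | zero => exact fun _ => hk
    | succ i ih => exact fun hi => hstep k i hi (ih (by omega))
  have h2 : ∀ k, P k 0 := by
    intro k
    induction k with
    | zero => exact h0
    | succ k ih => exact hnext k (h1 k ih _ le_rfl)
  exact h1 k (h2 k) i hi

lemma schauder_zero (x : ℝ) : schauder 0 x = 1 := by simp [schauder]

lemma schauder_one (x : ℝ) : schauder 1 x = x := by simp [schauder, haar]

lemma isSpline_schauder (k i : ℕ) (hi : i ≤ 2 ^ k) :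
    ∀ n ≤ 2 ^ k + i, IsSpline k i (schauder n) := by
  refine dyadic_induction (P := fun k i => ∀ n ≤ 2 ^ k + i, IsSpline k i (schauder n)) ?_ ?_ ?_ k i hi
  · intro n hn
    refine ⟨fun l hl => by omega, fun l _ hl => ?_⟩
    obtain rfl | rfl : n = 0 ∨ n = 1 := by simp at hn; omega
    · exact ⟨1, 0, fun t _ => by rw [schauder_zero]; ring⟩
    · exact ⟨0, 1, fun t _ => by rw [schauder_one]; ring⟩
  · intro k i hi ih n hn
    rcases Nat.lt_or_ge (2 ^ k + i) n with h | h
    · obtain rfl : n = 2 ^ k + i + 1 := by omega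
      exact ((isSpline_tent k i).const_mul (√((2 : ℝ) ^ k) / 2 ^ (k + 1))).congr hi
        fun t ht => schauder_succ hi ht
    · exact (ih n h).refine hi
  · intro k ih n hn
    rw [isSpline_succ_zero_iff]
    exact ih n (by rw [pow_succ] at hn; omega)

/-- The Faber–Schauder functions span the linear splines. -/
lemma IsSpline.exists_eq_sum (k i : ℕ) (hi : i ≤ 2 ^ k) : ∀ v, IsSpline k i v →
    ∃ c : ℕ → ℝ, ∀ t ∈ Set.Icc (0 : ℝ) 1,
      v t = ∑ n ∈ Finset.range (2 ^ k + i + 1), c n * schauder n t := by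
  refine dyadic_induction (P := fun k i => ∀ v, IsSpline k i v → ∃ c : ℕ → ℝ,
    ∀ t ∈ Set.Icc (0 : ℝ) 1, v t = ∑ n ∈ Finset.range (2 ^ k + i + 1), c n * schauder n t)
    ?_ ?_ ?_ k i hi
  · intro v hv
    obtain ⟨α, β, h⟩ := hv.coarse 0 le_rfl (by norm_num)
    refine ⟨fun n => if n = 0 then α else β, fun t ht => ?_⟩
    rw [h t (by simpa using ht)]
    simp [Finset.sum_range_succ, schauder_zero, schauder_one]
  · intro k i hi ih v hv
    obtain ⟨c, hc⟩ := hv.exists_sub_tent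
    obtain ⟨d, hd⟩ := ih _ hc
    set κ : ℝ := √((2 : ℝ) ^ k) / 2 ^ (k + 1) with hκ
    have hκ0 : κ ≠ 0 := by positivity
    -- The tent is the new Faber–Schauder function divided by κ, and -c times the tent restores `v`
    -- from the coarser spline.
    refine ⟨fun n => if n = 2 ^ k + i + 1 then -c / κ else d n, fun t ht => ?_⟩
    beta_reduce
    rw [← add_assoc, Finset.sum_range_succ, if_pos rfl, schauder_succ hi ht, ← hκ,
      Finset.sum_congr rfl (g := fun n => d n * schauder n t), ← hd t ht]
    · field_simp
      ring
    · intro n hn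
      rw [if_neg (Finset.mem_range.1 hn).ne]
  · intro k ih v hv
    obtain ⟨c, hc⟩ := ih v (isSpline_succ_zero_iff.1 hv)
    refine ⟨c, fun t ht => ?_⟩
    rw [hc t ht, add_zero, pow_succ, mul_two]

end Splines

/-! ### Enumeration of the knots -/

section Knots

/-- The `l`-th knot of the dyadic partition with parameters `k` and `i`. -/
def knot (k i l : ℕ) : ℝ := max (l : ℝ) (2 * l - 2 * i) / 2 ^ (k + 1)

lemma knot_of_le {k i l : ℕ} (h : l ≤ 2 * i) : knot k i l = l / 2 ^ (k + 1) := by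
  have : (l : ℝ) ≤ 2 * i := by exact_mod_cast h
  rw [knot, max_eq_left (by linarith)]

lemma knot_of_ge {k i l : ℕ} (h : 2 * i ≤ l) : knot k i l = (l - i) / 2 ^ k := by
  have : (2 * i : ℝ) ≤ l := by exact_mod_cast h
  rw [knot, max_eq_right (by linarith), pow_succ]
  field_simp

lemma knot_zero (k i : ℕ) : knot k i 0 = 0 := by
  rw [knot_of_le (Nat.zero_le _)]; simp

lemma knot_last {k i : ℕ} (hi : i ≤ 2 ^ k) : knot k i (2 ^ k + i) = 1 := by
  rw [knot_of_ge (by omega)]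
  push_cast
  field_simp
  ring

lemma knot_succ_sub (k i l : ℕ) : 1 / 2 ^ (k + 1) ≤ knot k i (l + 1) - knot k i l ∧
    knot k i (l + 1) - knot k i l ≤ 1 / 2 ^ k := by
  have h2 : (0 : ℝ) < 2 ^ k := by positivity
  have e : (1 : ℝ) / 2 ^ k = 2 / 2 ^ (k + 1) := by rw [pow_succ]; field_simp
  rw [e, knot, knot, ← sub_div]
  push_cast
  rcases max_cases ((l : ℝ) + 1) (2 * (l + 1) - 2 * i) with h | h <;>
    rcases max_cases (l : ℝ) (2 * l - 2 * i) with h' | h' <;>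
    constructor <;> gcongr <;> linarith

lemma knot_strictMono (k i : ℕ) : StrictMono (knot k i) := by
  refine strictMono_nat_of_lt_succ fun l => ?_
  have h1 := (knot_succ_sub k i l).1
  have : (0 : ℝ) < 1 / 2 ^ (k + 1) := by positivity
  linarith

lemma knot_sub_le (k i : ℕ) {l m : ℕ} (h : l ≤ m) :
    knot k i m - knot k i l ≤ (m - l : ℕ) * (1 / 2 ^ k) := by
  obtain ⟨d, rfl⟩ := Nat.exists_eq_add_of_le h
  rw [Nat.add_sub_cancel_left]
  clear h
  induction d with
  | zero => simp
  | succ d ih =>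
    have := (knot_succ_sub k i (l + d)).2
    rw [← add_assoc]
    push_cast
    linarith

/-- Numbering all the knots consecutively merges the fine and the coarse intervals into one family,
as the recurrence along the knots requires. -/
lemma isSpline_iff_knot {k i : ℕ} (hi : i ≤ 2 ^ k) {v : ℝ → ℝ} :
    IsSpline k i v ↔ ∀ l < 2 ^ k + i, AffineOn v (knot k i l) (knot k i (l + 1)) := by
  constructor
  · intro h l hl
    rcases lt_or_ge l (2 * i) with h1 | h1
    · rw [knot_of_le h1.le, knot_of_le h1]
      simpa using h.fine l h1
    · obtain ⟨m, rfl⟩ := Nat.exists_eq_add_of_le (show i ≤ l by omega)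
      rw [knot_of_ge h1, knot_of_ge (by omega)]
      have := h.coarse m (by omega) (by omega)
      push_cast
      convert this using 2 <;> ring
  · intro h
    constructor
    · intro l hl
      have := h l (by omega)
      rw [knot_of_le hl.le, knot_of_le hl] at this
      simpa using this
    · intro l hl hl'
      have := h (l + i) (by omega)
      rw [knot_of_ge (by omega), knot_of_ge (by omega)] at this
      push_cast at this
      convert this using 2 <;> ring

lemma exists_mem_knot {k i : ℕ} (hi : i ≤ 2 ^ k) {t : ℝ} (ht0 : 0 < t) (ht1 : t ≤ 1) :
    ∃ l < 2 ^ k + i, knot k i l < t ∧ t ≤ knot k i (l + 1) := by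
  classical
  have hex : ∃ l, t ≤ knot k i l := ⟨2 ^ k + i, by rw [knot_last hi]; exact ht1⟩
  have h1 := Nat.find_spec hex
  have h2 : Nat.find hex ≤ 2 ^ k + i := Nat.find_le (by rw [knot_last hi]; exact ht1)
  rcases hm : Nat.find hex with _ | l
  · rw [hm, knot_zero] at h1; linarith
  · rw [hm] at h1 h2
    exact ⟨l, h2, not_le.1 (Nat.find_min hex (by omega)), h1⟩

/-- The ramp functions at the knots are splines. -/
lemma isSpline_ramp {k i : ℕ} (hi : i ≤ 2 ^ k) (l : ℕ) :
    IsSpline k i fun t => max 0 (t - knot k i l) := by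
  rw [isSpline_iff_knot hi]
  intro m _
  rcases Nat.lt_or_ge m l with h | h
  · refine affineOn_of_eq_zero fun t ht => max_eq_left ?_
    have := (knot_strictMono k i).monotone (show m + 1 ≤ l from h)
    linarith [ht.2]
  · refine ⟨-knot k i l, 1, fun t ht => ?_⟩
    have := (knot_strictMono k i).monotone h
    beta_reduce
    rw [max_eq_right (by linarith [ht.1])]
    ring

end Knots

/-! ### Geometric decay of splines orthogonal to ramps -/

section Decay

lemma integral_affine_mul_affine (α β γ δ a b : ℝ) :
    ∫ t in a..b, (α + β * t) * (γ + δ * t) = α * γ * (b - a) + (α * δ + β * γ) * (b ^ 2 - a ^ 2) / 2 +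
      β * δ * (b ^ 3 - a ^ 3) / 3 := by
  have hd : ∀ t ∈ Set.uIcc a b, HasDerivAt
      (fun t : ℝ => α * γ * t + (α * δ + β * γ) / 2 * t ^ 2 + β * δ / 3 * t ^ 3)
      ((α + β * t) * (γ + δ * t)) t := by
    intro t _
    have h1 := ((hasDerivAt_id t).const_mul (α * γ)).add
      (((hasDerivAt_pow 2 t).const_mul ((α * δ + β * γ) / 2)).add
        ((hasDerivAt_pow 3 t).const_mul (β * δ / 3)))
    refine (h1.congr_deriv ?_).congr_of_eventuallyEq (Eventually.of_forall fun s => ?_)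
    · push_cast; ring
    · simp only [Pi.add_apply, id]; ring
  rw [intervalIntegral.integral_eq_sub_of_hasDerivAt hd (by
    apply Continuous.intervalIntegrable; fun_prop)]
  ring

/-- A function affine on `[a, b]` is bounded by its mean square. -/
lemma AffineOn.sq_le {u : ℝ → ℝ} {a b t : ℝ} (hab : a < b) (hu : AffineOn u a b)
    (ht : t ∈ Set.Icc a b) : (b - a) * u t ^ 2 ≤ 4 * ∫ s in a..b, u s ^ 2 := by
  obtain ⟨α, β, h⟩ := hu
  have h1 : ∫ s in a..b, u s ^ 2 = ∫ s in a..b, (α + β * s) * (α + β * s) := by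
    refine intervalIntegral.integral_congr fun s hs => ?_
    rw [Set.uIcc_of_le hab.le] at hs
    rw [h s hs, sq]
  rw [h1, integral_affine_mul_affine, h t ht]
  obtain ⟨h2, h3⟩ := ht
  have hba : 0 < b - a := sub_pos.2 hab
  have key : (α + β * t) ^ 2 ≤ 4 * (α * α + (α * β + β * α) * (a + b) / 2 +
      β * β * (a ^ 2 + a * b + b ^ 2) / 3) := by
    set p := α + β * a with hp
    set q := α + β * b with hq
    have e : 4 * (α * α + (α * β + β * α) * (a + b) / 2 + β * β * (a ^ 2 + a * b + b ^ 2) / 3) =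
        4 / 3 * (p ^ 2 + p * q + q ^ 2) := by rw [hp, hq]; ring
    rw [e]
    -- With end values p and q the mean square is (p² + pq + q²)/3, and 4/3 (p² + pq + q²) - p² = (p
    -- + 2q)²/3.
    have hp2 : p ^ 2 ≤ 4 / 3 * (p ^ 2 + p * q + q ^ 2) := by nlinarith [sq_nonneg (p + 2 * q)]
    have hq2 : q ^ 2 ≤ 4 / 3 * (p ^ 2 + p * q + q ^ 2) := by nlinarith [sq_nonneg (2 * p + q)]
    have haff : AffineOn (fun s => α + β * s) a b := ⟨α, β, fun _ _ => rfl⟩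
    have h4 := haff.abs_le ⟨h2, h3⟩ (C := √(4 / 3 * (p ^ 2 + p * q + q ^ 2)))
      (Real.abs_le_sqrt hp2) (Real.abs_le_sqrt hq2)
    calc (α + β * t) ^ 2 = |α + β * t| ^ 2 := (sq_abs _).symm
      _ ≤ √(4 / 3 * (p ^ 2 + p * q + q ^ 2)) ^ 2 := by gcongr
      _ = _ := Real.sq_sqrt ((sq_nonneg p).trans hp2)
  calc _ ≤ (b - a) * (4 * (α * α + (α * β + β * α) * (a + b) / 2 +
      β * β * (a ^ 2 + a * b + b ^ 2) / 3)) := by gcongr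
    _ = _ := by ring

/-- A spline that is orthogonal to the ramp functions at the knots from `p` on decays
geometrically from there. -/
lemma abs_knot_succ_le {k i p : ℕ} (hi : i ≤ 2 ^ k) {u : ℝ → ℝ} (hu : Continuous u)
    (hus : IsSpline k i u)
    (horth : ∀ l, p ≤ l → l ≤ 2 ^ k + i →
      ∫ t in (0 : ℝ)..1, u t * max 0 (t - knot k i l) = 0) :
    ∀ l, p ≤ l → l < 2 ^ k + i → |u (knot k i (l + 1))| ≤ |u (knot k i l)| / 2 := by
  set τ := knot k i with hτ
  set q := 2 ^ k + i with hq
  have hmono := knot_strictMono k i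
  have hτq : τ q = 1 := knot_last hi
  have hτ0 : ∀ l, 0 ≤ τ l := fun l => by
    rw [← knot_zero k i]; exact hmono.monotone (Nat.zero_le l)
  have hτ1 : ∀ l ≤ q, τ l ≤ 1 := fun l hl => by
    rw [← hτq]; exact hmono.monotone hl
  have hint : ∀ (f : ℝ → ℝ), Continuous f → ∀ a b, IntervalIntegrable f volume a b :=
    fun f hf a b => hf.intervalIntegrable a b
  -- Through these tail integrals, orthogonality to consecutive ramps becomes a relation between the
  -- values of `u` at adjacent knots.
  let W : ℕ → ℝ := fun l => ∫ t in τ l..1, u t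
  have hramp : ∀ l, p ≤ l → l ≤ q → ∫ t in τ l..1, u t * (t - τ l) = 0 := by
    intro l hl hlq
    rw [← horth l hl hlq, ← intervalIntegral.integral_add_adjacent_intervals
      (hint _ (by fun_prop) 0 (τ l)) (hint _ (by fun_prop) (τ l) 1)]
    have h1 : ∫ t in (0 : ℝ)..τ l, u t * max 0 (t - τ l) = 0 := by
      rw [intervalIntegral.integral_congr (g := fun _ => 0), intervalIntegral.integral_zero]
      intro t ht
      rw [Set.uIcc_of_le (hτ0 l)] at ht
      simp only
      rw [max_eq_left (by linarith [ht.2]), mul_zero]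
    rw [h1, zero_add]
    refine intervalIntegral.integral_congr fun t ht => ?_
    rw [Set.uIcc_of_le (hτ1 l hlq)] at ht
    rw [max_eq_right (by linarith [ht.1])]
  have hval : ∀ l < q, ∃ α β : ℝ, u (τ l) = α + β * τ l ∧ u (τ (l + 1)) = α + β * τ (l + 1) ∧
      ∀ t ∈ Set.Icc (τ l) (τ (l + 1)), u t = α + β * t := by
    intro l hl
    obtain ⟨α, β, h⟩ := (isSpline_iff_knot hi).1 hus l hl
    have := (hmono (Nat.lt_succ_self l)).le
    exact ⟨α, β, h _ ⟨le_rfl, this⟩, h _ ⟨this, le_rfl⟩, h⟩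
  have hW1 : ∀ l < q, W l - W (l + 1) = (τ (l + 1) - τ l) * (u (τ l) + u (τ (l + 1))) / 2 := by
    intro l hl
    obtain ⟨α, β, h1, h2, h⟩ := hval l hl
    have h3 : W l = (∫ t in τ l..τ (l + 1), u t) + W (l + 1) :=
      (intervalIntegral.integral_add_adjacent_intervals (hint u hu _ _) (hint u hu _ _)).symm
    have h4 : ∫ t in τ l..τ (l + 1), u t = ∫ t in τ l..τ (l + 1), (α + β * t) * (1 + 0 * t) := by
      refine intervalIntegral.integral_congr fun t ht => ?_
      rw [Set.uIcc_of_le (hmono (Nat.lt_succ_self l)).le] at ht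
      rw [h t ht]; ring
    rw [h3, h4, integral_affine_mul_affine, h1, h2]
    ring
  -- The difference of two consecutive ramps is a constant right of the second knot, which isolates
  -- the tail integral from the integral over one affine piece.
  have hW2 : ∀ l, p ≤ l → l < q →
      W (l + 1) = -((τ (l + 1) - τ l) * (u (τ l) + 2 * u (τ (l + 1))) / 6) := by
    intro l hl hlq
    obtain ⟨α, β, h1, h2, h⟩ := hval l hlq
    have hlt := hmono (Nat.lt_succ_self l)
    have hpos : 0 < τ (l + 1) - τ l := sub_pos.2 hlt
    have h3 := hramp l hl hlq.le
    rw [← intervalIntegral.integral_add_adjacent_intervals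
      (hint _ (by fun_prop) (τ l) (τ (l + 1))) (hint _ (by fun_prop) (τ (l + 1)) 1)] at h3
    have h4 : ∫ t in τ (l + 1)..1, u t * (t - τ l) = (τ (l + 1) - τ l) * W (l + 1) := by
      have h5 := hramp (l + 1) (by omega) hlq
      rw [← intervalIntegral.integral_const_mul]
      have h6 : ∫ t in τ (l + 1)..1, u t * (t - τ l) =
          (∫ t in τ (l + 1)..1, u t * (t - τ (l + 1))) +
            ∫ t in τ (l + 1)..1, (τ (l + 1) - τ l) * u t := by
        rw [← intervalIntegral.integral_add (hint _ (by fun_prop) _ _) (hint _ (by fun_prop) _ _)]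
        refine intervalIntegral.integral_congr fun t _ => ?_
        ring
      rw [h6, h5, zero_add]
    have h7 : ∫ t in τ l..τ (l + 1), u t * (t - τ l) =
        ∫ t in τ l..τ (l + 1), (α + β * t) * (-τ l + 1 * t) := by
      refine intervalIntegral.integral_congr fun t ht => ?_
      rw [Set.uIcc_of_le hlt.le] at ht
      rw [h t ht]; ring
    rw [h4, h7, integral_affine_mul_affine] at h3
    refine mul_left_cancel₀ hpos.ne' ?_
    rw [h1, h2]
    linear_combination h3
  -- Induction from the right end, where the empty tail integral makes the last value exactly minus
  -- half the one before.
  have hmain : ∀ d l, p ≤ l → l + 1 + d = q → |u (τ (l + 1))| ≤ |u (τ l)| / 2 := by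
    intro d
    induction d with
    | zero =>
      intro l hl hlq
      have h1 := hW2 l hl (by omega)
      have h2 : W (l + 1) = 0 := by
        have : l + 1 = q := by omega
        simp only [W]
        rw [this, hτq, intervalIntegral.integral_same]
      have hpos : 0 < τ (l + 1) - τ l := sub_pos.2 (hmono (Nat.lt_succ_self l))
      have h3 : u (τ (l + 1)) = -(u (τ l) / 2) := by
        refine mul_left_cancel₀ hpos.ne' ?_
        linear_combination 3 * h1 - 3 * h2
      rw [h3, abs_neg, abs_div, abs_two]
    | succ d ih =>
      intro l hl hlq
      have h1 := hW2 l hl (by omega)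
      have h2 := hW2 (l + 1) (by omega) (by omega)
      have h3 := hW1 (l + 1) (by omega)
      have h4 := ih (l + 1) (by omega) (by omega)
      have hpos : 0 < τ (l + 1) - τ l := sub_pos.2 (hmono (Nat.lt_succ_self l))
      have hpos' : 0 < τ (l + 1 + 1) - τ (l + 1) := sub_pos.2 (hmono (Nat.lt_succ_self (l + 1)))
      set A := τ (l + 1) - τ l
      set B := τ (l + 1 + 1) - τ (l + 1)
      -- Eliminating the tail integrals leaves the orthogonality to the hat function at the middle
      -- knot. If the right neighbour is at most half the middle value, then (2A + 3B/2)|u(τ(l+1))|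
      -- ≤ A|u(τ l)|, which gives the factor 1/2.
      have h5 : 2 * (A + B) * u (τ (l + 1)) = -(A * u (τ l) + B * u (τ (l + 1 + 1))) := by
        linear_combination 6 * h1 - 6 * h2 - 6 * h3
      have h6 : 2 * (A + B) * |u (τ (l + 1))| ≤ A * |u (τ l)| + B * |u (τ (l + 1 + 1))| := by
        calc 2 * (A + B) * |u (τ (l + 1))| = |2 * (A + B) * u (τ (l + 1))| := by
              rw [abs_mul, abs_of_pos (show 0 < 2 * (A + B) by positivity)]
          _ ≤ |A * u (τ l)| + |B * u (τ (l + 1 + 1))| := by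
              rw [h5, abs_neg]; exact abs_add_le _ _
          _ = _ := by rw [abs_mul, abs_mul, abs_of_pos hpos, abs_of_pos hpos']
      have h7 : B * |u (τ (l + 1 + 1))| ≤ B * (|u (τ (l + 1))| / 2) := by gcongr
      have h8 : 0 ≤ B * |u (τ (l + 1))| := by positivity
      have h9 : A * (2 * |u (τ (l + 1))|) ≤ A * |u (τ l)| := by linarith
      have := le_of_mul_le_mul_left h9 hpos
      linarith
  intro l hl hlq
  exact hmain (q - (l + 1)) l hl (by omega)

end Decay

/-! ### The Franklin system as an orthonormal basis of splines -/

section Franklin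

lemma continuous_schauder (n : ℕ) : Continuous (schauder n) := by
  rcases eq_or_ne n 0 with rfl | hn
  · rw [funext schauder_zero]
    exact continuous_const
  · have h : schauder n = fun x => ∫ t in (0 : ℝ)..x, haar (n - 1) t :=
      funext fun x => by rw [schauder, if_neg hn]
    rw [h]
    exact intervalIntegral.continuous_primitive (intervalIntegrable_haar _) 0

/-- The part of the Faber–Schauder function that is orthogonal to the previous Franklin
functions. -/
def franklinRest (n : ℕ) (x : ℝ) : ℝ :=
  schauder n x - ∑ k ∈ Finset.range n, (∫ t in (0 : ℝ)..1, schauder n t * franklin k t) * franklin k x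

lemma franklin_eq (n : ℕ) (x : ℝ) :
    franklin n x = franklinRest n x / √(∫ y in (0 : ℝ)..1, franklinRest n y ^ 2) := by
  have h : ∀ y, schauder n y - ∑ k : Fin n, (∫ t in (0 : ℝ)..1, schauder n t * franklin k t) *
      franklin k y = franklinRest n y := fun y => by rw [franklinRest, Finset.sum_range]
  rw [franklin, gramSchmidtStep]
  simp only [h]

lemma continuous_franklin (n : ℕ) : Continuous (franklin n) := by
  induction n using Nat.strong_induction_on with
  | _ n ih =>
    rw [funext (franklin_eq n)]
    unfold franklinRest
    refine ((continuous_schauder n).sub (continuous_finsetSum _ fun k hk => ?_)).div_const _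
    exact (ih k (Finset.mem_range.1 hk)).const_mul _

lemma continuous_franklinRest (n : ℕ) : Continuous (franklinRest n) := by
  unfold franklinRest
  exact (continuous_schauder n).sub (continuous_finsetSum _ fun k _ =>
    (continuous_franklin k).const_mul _)

/-- Either `franklinRest n` vanishes on `[0, 1]`, or its `L²` norm is positive. -/
lemma franklinRest_cases (n : ℕ) : (∀ t ∈ Set.Icc (0 : ℝ) 1, franklinRest n t = 0) ∨
    0 < ∫ y in (0 : ℝ)..1, franklinRest n y ^ 2 := by
  by_cases h : ∀ t ∈ Set.Icc (0 : ℝ) 1, franklinRest n t = 0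
  · exact Or.inl h
  · push Not at h
    obtain ⟨t, ht, hne⟩ := h
    refine Or.inr (intervalIntegral.integral_pos one_pos
      ((continuous_franklinRest n).pow 2).continuousOn (fun s _ => sq_nonneg _) ⟨t, ht, ?_⟩)
    positivity

/-- The Gram–Schmidt process, with the alternative of a vanishing function left open. This makes the
linear independence of the Faber–Schauder functions unnecessary: a vanishing function affects
neither the spans nor the kernels. -/
lemma franklin_orthogonal (n : ℕ) :
    (∀ m < n, ∫ t in (0 : ℝ)..1, franklin n t * franklin m t = 0) ∧
    ((∀ t ∈ Set.Icc (0 : ℝ) 1, franklin n t = 0) ∨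
      ∫ t in (0 : ℝ)..1, franklin n t * franklin n t = 1) := by
  induction n using Nat.strong_induction_on with
  | _ n ih =>
    have hint : ∀ f : ℝ → ℝ, Continuous f → IntervalIntegrable f volume 0 1 :=
      fun f hf => hf.intervalIntegrable _ _
    have horth : ∀ m < n, ∫ t in (0 : ℝ)..1, franklinRest n t * franklin m t = 0 := by
      intro m hm
      have hcs := continuous_schauder n
      have hcf := continuous_franklin
      have h1 : ∀ t, franklinRest n t * franklin m t = schauder n t * franklin m t -
          ∑ k ∈ Finset.range n, (∫ s in (0 : ℝ)..1, schauder n s * franklin k s) *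
            (franklin k t * franklin m t) := by
        intro t
        rw [franklinRest, sub_mul, Finset.sum_mul]
        simp only [mul_assoc]
      have k1 : IntervalIntegrable (fun t => schauder n t * franklin m t) volume 0 1 :=
        hint _ (hcs.mul (hcf m))
      have k2 : ∀ k ∈ Finset.range n, IntervalIntegrable
          (fun t => (∫ s in (0 : ℝ)..1, schauder n s * franklin k s) *
            (franklin k t * franklin m t)) volume 0 1 :=
        fun k _ => hint _ (((hcf k).mul (hcf m)).const_mul _)
      have k3 : IntervalIntegrable (fun t => ∑ k ∈ Finset.range n,
          (∫ s in (0 : ℝ)..1, schauder n s * franklin k s) *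
            (franklin k t * franklin m t)) volume 0 1 :=
        hint _ (continuous_finsetSum _ fun k _ => ((hcf k).mul (hcf m)).const_mul _)
      simp only [h1]
      rw [intervalIntegral.integral_sub k1 k3, intervalIntegral.integral_finsetSum k2]
      simp only [intervalIntegral.integral_const_mul]
      rw [Finset.sum_eq_single_of_mem m (Finset.mem_range.2 hm)]
      · rcases (ih m hm).2 with h0 | h1
        · have h2 : ∫ t in (0 : ℝ)..1, schauder n t * franklin m t = 0 := by
            rw [intervalIntegral.integral_congr (g := fun _ => 0), intervalIntegral.integral_zero]
            intro t ht
            rw [Set.uIcc_of_le zero_le_one] at ht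
            simp only [h0 t ht, mul_zero]
          rw [h2, zero_mul, sub_zero]
        · rw [h1, mul_one, sub_self]
      · intro k hk hkm
        rcases lt_or_gt_of_ne hkm with h | h
        · simp only [mul_comm (franklin k _)]
          rw [(ih m hm).1 k h, mul_zero]
        · rw [(ih k (Finset.mem_range.1 hk)).1 m h, mul_zero]
    refine ⟨fun m hm => ?_, ?_⟩
    · simp only [franklin_eq n, div_mul_eq_mul_div]
      rw [intervalIntegral.integral_div, horth m hm, zero_div]
    · rcases franklinRest_cases n with h | h
      · exact Or.inl fun t ht => by rw [franklin_eq, h t ht, zero_div]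
      · refine Or.inr ?_
        simp only [franklin_eq n, ← sq, div_pow, Real.sq_sqrt h.le]
        rw [intervalIntegral.integral_div, div_self h.ne']

lemma schauder_eq_sum_franklin (n : ℕ) : ∃ c : ℕ → ℝ, ∀ t ∈ Set.Icc (0 : ℝ) 1,
    schauder n t = ∑ k ∈ Finset.range (n + 1), c k * franklin k t := by
  -- If the remainder vanishes on the interval, the coefficient of the last function is irrelevant
  -- there.
  refine ⟨fun k => if k = n then √(∫ y in (0 : ℝ)..1, franklinRest n y ^ 2) else
    ∫ t in (0 : ℝ)..1, schauder n t * franklin k t, fun t ht => ?_⟩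
  have h1 : √(∫ y in (0 : ℝ)..1, franklinRest n y ^ 2) * franklin n t = franklinRest n t := by
    rw [franklin_eq]
    rcases franklinRest_cases n with h | h
    · rw [h t ht, zero_div, mul_zero]
    · have := (Real.sqrt_pos.2 h).ne'
      field_simp
  beta_reduce
  rw [Finset.sum_range_succ, if_pos rfl, h1, franklinRest, Finset.sum_congr rfl (g := fun k =>
    (∫ t in (0 : ℝ)..1, schauder n t * franklin k t) * franklin k t)]
  · ring
  · intro k hk
    rw [if_neg (Finset.mem_range.1 hk).ne]

/-- The kernel of the first `N` Franklin functions. -/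
def franklinKernel (N : ℕ) (x t : ℝ) : ℝ := ∑ n ∈ Finset.range N, franklin n x * franklin n t

lemma continuous_franklinKernel (N : ℕ) (x : ℝ) : Continuous (franklinKernel N x) :=
  continuous_finsetSum _ fun n _ => (continuous_franklin n).const_mul _

lemma franklinKernel_comm (N : ℕ) (x t : ℝ) : franklinKernel N x t = franklinKernel N t x :=
  Finset.sum_congr rfl fun _ _ => mul_comm _ _

/-- The function `v` is reproduced by the kernel of the first `N` Franklin functions. -/
def Reproduced (N : ℕ) (v : ℝ → ℝ) : Prop :=
  ∀ x ∈ Set.Icc (0 : ℝ) 1, ∫ t in (0 : ℝ)..1, franklinKernel N x t * v t = v x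

lemma Reproduced.congr {N : ℕ} {v w : ℝ → ℝ} (hv : Reproduced N v)
    (h : ∀ t ∈ Set.Icc (0 : ℝ) 1, w t = v t) : Reproduced N w := by
  intro x hx
  rw [h x hx, ← hv x hx]
  refine intervalIntegral.integral_congr fun t ht => ?_
  rw [Set.uIcc_of_le zero_le_one] at ht
  simp only [h t ht]

lemma Reproduced.sum {N M : ℕ} {v : ℕ → ℝ → ℝ} (hc : ∀ m, Continuous (v m)) (c : ℕ → ℝ)
    (hv : ∀ m < M, Reproduced N (v m)) :
    Reproduced N fun t => ∑ m ∈ Finset.range M, c m * v m t := by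
  intro x hx
  simp only [Finset.mul_sum]
  rw [intervalIntegral.integral_finsetSum]
  · refine Finset.sum_congr rfl fun m hm => ?_
    rw [← hv m (Finset.mem_range.1 hm) x hx, ← intervalIntegral.integral_const_mul]
    refine intervalIntegral.integral_congr fun t _ => ?_
    ring
  · intro m _
    exact Continuous.intervalIntegrable
      ((continuous_franklinKernel N x).mul ((hc m).const_mul _)) _ _

lemma reproduced_franklin {N m : ℕ} (hm : m < N) : Reproduced N (franklin m) := by
  intro x hx
  simp only [franklinKernel, Finset.sum_mul]
  rw [intervalIntegral.integral_finsetSum]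
  · simp only [mul_assoc, intervalIntegral.integral_const_mul]
    rw [Finset.sum_eq_single_of_mem m (Finset.mem_range.2 hm)]
    · rcases (franklin_orthogonal m).2 with h | h
      · rw [h x hx, zero_mul]
      · rw [h, mul_one]
    · intro k _ hkm
      rcases lt_or_gt_of_ne hkm with h | h
      · simp only [mul_comm (franklin k _) (franklin m _)]
        rw [(franklin_orthogonal m).1 k h, mul_zero]
      · rw [(franklin_orthogonal k).1 m h, mul_zero]
  · intro k _
    exact Continuous.intervalIntegrable
      (((continuous_franklin k).const_mul _).mul (continuous_franklin m)) _ _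

lemma reproduced_schauder {N n : ℕ} (hn : n < N) : Reproduced N (schauder n) := by
  obtain ⟨c, hc⟩ := schauder_eq_sum_franklin n
  refine (Reproduced.sum continuous_franklin c fun m hm => ?_).congr hc
  exact reproduced_franklin (by omega)

/-- Splines are combinations of Faber–Schauder functions, these of Franklin functions, and the
kernel reproduces the latter by orthogonality. -/
lemma IsSpline.reproduced {k i : ℕ} (hi : i ≤ 2 ^ k) {v : ℝ → ℝ} (hv : IsSpline k i v) :
    Reproduced (2 ^ k + i + 1) v := by
  obtain ⟨c, hc⟩ := IsSpline.exists_eq_sum k i hi v hv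
  exact (Reproduced.sum continuous_schauder c fun m hm => reproduced_schauder hm).congr hc

lemma isSpline_franklin {k i : ℕ} (hi : i ≤ 2 ^ k) (n : ℕ) (hn : n ≤ 2 ^ k + i) :
    IsSpline k i (franklin n) := by
  induction n using Nat.strong_induction_on with
  | _ n ih =>
    have h : franklin n = fun x => (√(∫ y in (0 : ℝ)..1, franklinRest n y ^ 2))⁻¹ *
        (schauder n x + (-1) * ∑ k ∈ Finset.range n,
          (∫ t in (0 : ℝ)..1, schauder n t * franklin k t) * franklin k x) := by
      funext x
      rw [franklin_eq, div_eq_inv_mul, franklinRest]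
      ring
    rw [h]
    refine ((isSpline_schauder k i hi n hn).add (IsSpline.const_mul (-1) (IsSpline.sum _
      fun m hm => IsSpline.const_mul _ (ih m ?_ ?_)))).const_mul _
    · exact Finset.mem_range.1 hm
    · have := Finset.mem_range.1 hm; omega

lemma isSpline_franklinKernel {k i : ℕ} (hi : i ≤ 2 ^ k) (x : ℝ) :
    IsSpline k i (franklinKernel (2 ^ k + i + 1) x) :=
  IsSpline.sum _ fun n hn => (isSpline_franklin hi n (by
    have := Finset.mem_range.1 hn; omega)).const_mul _

/-- For u = K(x, ·), reproduction gives ∫ u² = u(x). On an affine piece of length at least 2^(-k-1),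
a value squared is at most 4·2^(k+1) times the integral of u², so u(y)² ≤ 8·2^k u(x). Taking y = x
bounds u(x), and then all values. -/
lemma abs_franklinKernel_le {k i : ℕ} (hi : i ≤ 2 ^ k) {x t : ℝ} (hx : x ∈ Set.Icc (0 : ℝ) 1)
    (ht : t ∈ Set.Icc (0 : ℝ) 1) : |franklinKernel (2 ^ k + i + 1) x t| ≤ 8 * 2 ^ k := by
  set u := franklinKernel (2 ^ k + i + 1) x with hu
  have hus : IsSpline k i u := isSpline_franklinKernel hi x
  have huc : Continuous u := continuous_franklinKernel _ x
  have hnorm : ∫ s in (0 : ℝ)..1, u s ^ 2 = u x := by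
    rw [← hus.reproduced hi x hx]
    refine intervalIntegral.integral_congr fun s _ => ?_
    exact sq _
  have hsq : ∀ y ∈ Set.Icc (0 : ℝ) 1, u y ^ 2 ≤ 8 * 2 ^ k * u x := by
    have hpos : ∀ y, 0 < y → y ≤ 1 → u y ^ 2 ≤ 8 * 2 ^ k * u x := by
      intro y hy0 hy1
      obtain ⟨l, hl, h1, h2⟩ := exists_mem_knot hi hy0 hy1
      have hlt := knot_strictMono k i (Nat.lt_succ_self l)
      have h3 := ((isSpline_iff_knot hi).1 hus l hl).sq_le hlt ⟨h1.le, h2⟩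
      have h4 := (knot_succ_sub k i l).1
      have h5 : ∫ s in knot k i l..knot k i (l + 1), u s ^ 2 ≤ u x := by
        rw [← hnorm]
        refine intervalIntegral.integral_mono_interval ?_ hlt.le ?_
          (ae_of_all _ fun s => sq_nonneg (u s)) ((huc.pow 2).intervalIntegrable _ _)
        · rw [← knot_zero k i]; exact (knot_strictMono k i).monotone (Nat.zero_le l)
        · rw [← knot_last hi]; exact (knot_strictMono k i).monotone hl
      have h6 : 1 / 2 ^ (k + 1) * u y ^ 2 ≤ 4 * u x := by
        have := mul_le_mul_of_nonneg_right h4 (sq_nonneg (u y))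
        linarith
      rw [one_div_mul_eq_div, div_le_iff₀ (by positivity), pow_succ (2 : ℝ) k] at h6
      linarith
    intro y hy
    rcases eq_or_lt_of_le hy.1 with h | h
    · have hcl : IsClosed {y | u y ^ 2 ≤ 8 * 2 ^ k * u x} :=
        isClosed_le (huc.pow 2) continuous_const
      have hmem : Set.Ioc (0 : ℝ) 1 ⊆ {y | u y ^ 2 ≤ 8 * 2 ^ k * u x} :=
        fun y hy => hpos y hy.1 hy.2
      have := closure_minimal hmem hcl
      rw [closure_Ioc zero_ne_one] at this
      exact this hy
    · exact hpos y h hy.2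
  have hux : u x ≤ 8 * 2 ^ k := by
    have h1 := hsq x hx
    by_contra! h2
    have h3 : (0 : ℝ) < 8 * 2 ^ k := by positivity
    nlinarith
  refine abs_le_of_sq_le_sq ((hsq t ht).trans ?_) (by positivity)
  rw [sq]
  gcongr

/-- The kernels of the Franklin system decay geometrically away from the diagonal. -/
lemma abs_franklinKernel_le_of_lt {k i : ℕ} (hi : i ≤ 2 ^ k) {x t r : ℝ}
    (hx : x ∈ Set.Icc (0 : ℝ) 1) (ht : t ∈ Set.Icc (0 : ℝ) 1) (hr : r ≤ t - x)
    (hrk : 2 < r * 2 ^ k) :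
    ∃ d : ℕ, r * 2 ^ k - 2 ≤ d ∧
      |franklinKernel (2 ^ k + i + 1) x t| ≤ (1 / 2) ^ d * (8 * 2 ^ k) := by
  have h2 : (0 : ℝ) < 2 ^ k := by positivity
  set u := franklinKernel (2 ^ k + i + 1) x with hu
  have hus : IsSpline k i u := isSpline_franklinKernel hi x
  have huc : Continuous u := continuous_franklinKernel _ x
  have hmono := knot_strictMono k i
  have hmesh : r - 2 * (1 / 2 ^ k) > 0 := by
    have : r * 2 ^ k * (1 / 2 ^ k) = r := by field_simp
    have h3 : 2 * (1 / 2 ^ k : ℝ) < r * 2 ^ k * (1 / 2 ^ k) := by gcongr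
    linarith
  have hmesh0 : (0 : ℝ) < 1 / 2 ^ k := by positivity
  -- A knot to the right of x, at most one mesh width away. Another mesh width is lost at t, whence
  -- the -2 in the count of knots between.
  obtain ⟨p, hxp, hpx, hpq⟩ : ∃ p, x ≤ knot k i p ∧ knot k i p ≤ x + 1 / 2 ^ k ∧ p ≤ 2 ^ k + i := by
    rcases eq_or_lt_of_le hx.1 with h | h
    · refine ⟨0, ?_, ?_, Nat.zero_le _⟩ <;> rw [knot_zero] <;> linarith
    · obtain ⟨l, hl, h3, h4⟩ := exists_mem_knot hi h hx.2
      have := (knot_succ_sub k i l).2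
      exact ⟨l + 1, h4, by linarith, hl⟩
  obtain ⟨l, hl, htl, htl'⟩ := exists_mem_knot hi (t := t) (by linarith [hx.1]) ht.2
  have hlt := (knot_succ_sub k i l).2
  have hpl : p ≤ l := by
    by_contra! h
    have := hmono.monotone h
    simp only [Nat.succ_eq_add_one] at this
    linarith
  refine ⟨l - p, ?_, ?_⟩
  · have h3 := knot_sub_le k i hpl
    have h4 : r - 2 * (1 / 2 ^ k) ≤ (l - p : ℕ) * (1 / 2 ^ k) := by linarith
    have h5 : (r - 2 * (1 / 2 ^ k)) * 2 ^ k ≤ (l - p : ℕ) * (1 / 2 ^ k) * 2 ^ k := by gcongr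
    have h6 : (1 / 2 ^ k : ℝ) * 2 ^ k = 1 := by field_simp
    rw [mul_assoc, h6, mul_one, sub_mul, mul_assoc, h6, mul_one] at h5
    exact h5
  -- A ramp that starts at a knot right of x vanishes at x, so by reproduction the kernel is
  -- orthogonal to it.
  · have hdec := abs_knot_succ_le (p := p) hi huc hus fun m hm _ => by
      have h3 := (isSpline_ramp hi m).reproduced hi x hx
      rw [max_eq_left (by have := hmono.monotone hm; linarith)] at h3
      exact h3
    have hdec' : ∀ d, p + d ≤ 2 ^ k + i →
        |u (knot k i (p + d))| ≤ (1 / 2) ^ d * (8 * 2 ^ k) := by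
      intro d
      induction d with
      | zero =>
        intro _
        have h3 : knot k i p ∈ Set.Icc (0 : ℝ) 1 :=
          ⟨hx.1.trans hxp, by rw [← knot_last hi]; exact hmono.monotone hpq⟩
        simpa using abs_franklinKernel_le hi hx h3
      | succ d ih =>
        intro hd
        have h3 := hdec (p + d) (by omega) (by omega)
        have h4 := ih (by omega)
        rw [pow_succ, ← add_assoc]
        linarith
    have hl1 := hdec' (l - p) (by omega)
    rw [show p + (l - p) = l by omega] at hl1
    have hl2 := hdec l hpl hl
    refine ((isSpline_iff_knot hi).1 hus l hl).abs_le ⟨htl.le, htl'⟩ hl1 ?_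
    have := abs_nonneg (u (knot k i l))
    linarith

/-- The peak 2^k is at most (d+2)/r when d counts the halvings, so the kernel is bounded by
8(d+2)2^(-d)/r, which tends to 0. -/
lemma exists_abs_franklinKernel_le {r ε : ℝ} (hr : 0 < r) (hε : 0 < ε) :
    ∃ J, ∀ j ≥ J, ∀ x ∈ Set.Icc (0 : ℝ) 1, ∀ t ∈ Set.Icc (0 : ℝ) 1, r ≤ |x - t| →
      |franklinKernel (j + 1) x t| ≤ ε := by
  have hlim : Tendsto (fun d : ℕ => ((d : ℝ) + 2) * (1 / 2) ^ d) atTop (𝓝 0) := by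
    have h1 := tendsto_self_mul_const_pow_of_lt_one (r := (1 / 2 : ℝ)) (by norm_num) (by norm_num)
    have h2 := (tendsto_pow_atTop_nhds_zero_of_lt_one (r := (1 / 2 : ℝ)) (by norm_num)
      (by norm_num)).const_mul 2
    simpa [add_mul] using h1.add h2
  obtain ⟨d₀, hd₀⟩ := eventually_atTop.1 (hlim.eventually_le_const
    (show 0 < ε * r / 8 by positivity))
  obtain ⟨K, hK⟩ := pow_unbounded_of_one_lt (((d₀ : ℝ) + 2) / r) (one_lt_two)
  have hmain : ∀ j ≥ 2 ^ K, ∀ x ∈ Set.Icc (0 : ℝ) 1, ∀ t ∈ Set.Icc (0 : ℝ) 1, r ≤ t - x →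
      |franklinKernel (j + 1) x t| ≤ ε := by
    intro j hj x hx t ht hxt
    obtain ⟨k, i, hi, rfl⟩ := exists_eq_two_pow_add (n := j) (by
      have : 0 < 2 ^ K := by positivity
      omega)
    have hKk : K ≤ k := by
      by_contra! hkm
      have := Nat.pow_le_pow_right (n := 2) (by norm_num) (show k + 1 ≤ K from hkm)
      rw [pow_succ] at this
      omega
    have hpow : (2 : ℝ) ^ K ≤ 2 ^ k := by
      gcongr
      norm_num
    have h1 : (d₀ : ℝ) + 2 < r * 2 ^ k := by
      rw [div_lt_iff₀ hr] at hK
      have := mul_le_mul_of_nonneg_right hpow hr.le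
      linarith
    have hd0 : (0 : ℝ) ≤ d₀ := Nat.cast_nonneg _
    obtain ⟨d, hd, hle⟩ := abs_franklinKernel_le_of_lt hi.le hx ht hxt (by linarith)
    have hdd : d₀ ≤ d := by
      have : (d₀ : ℝ) ≤ d := by linarith
      exact_mod_cast this
    refine hle.trans ?_
    have h3 := hd₀ d hdd
    have h4 : (2 : ℝ) ^ k ≤ (d + 2) / r := by
      rw [le_div_iff₀ hr]
      linarith
    calc (1 / 2 : ℝ) ^ d * (8 * 2 ^ k) ≤ (1 / 2) ^ d * (8 * ((d + 2) / r)) := by gcongr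
      _ = ((d + 2) * (1 / 2) ^ d) * (8 / r) := by ring
      _ ≤ (ε * r / 8) * (8 / r) := by gcongr
      _ = ε := by field_simp
  refine ⟨2 ^ K, fun j hj x hx t ht hxt => ?_⟩
  rcases le_total x t with h | h
  · rw [abs_of_nonpos (by linarith)] at hxt
    exact hmain j hj x hx t ht (by linarith)
  · rw [abs_of_nonneg (by linarith)] at hxt
    rw [franklinKernel_comm]
    exact hmain j hj t ht x hx (by linarith)

end Franklin

namespace ClassicalSystem

theorem localizing_franklin : franklin.Localizing := by
  refine Tame.localizing_of_kernel_small ⟨one_pos, fun k => ?_, fun k => ?_⟩ (fun j x hx => ?_)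
    fun r hr ε hε => ?_
  · exact Complex.measurable_ofReal.comp (continuous_franklin k).measurable
  · obtain ⟨B, hB⟩ := isCompact_Icc.exists_bound_of_continuousOn
      (s := Set.Icc (0 : ℝ) 1) (continuous_franklin k).continuousOn
    refine ⟨B, fun x hx => ?_⟩
    change ‖((OrthoDiv.franklin k x : ℝ) : ℂ)‖ ≤ _
    rw [Complex.norm_real]
    exact hB x hx
  · have h1 := (reproduced_schauder (Nat.succ_pos j)) x hx
    simp only [schauder_zero, mul_one, franklinKernel] at h1
    rw [intervalIntegral.integral_finsetSum fun k _ =>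
      Continuous.intervalIntegrable ((continuous_franklin k).const_mul _) _ _] at h1
    have hc : ∀ k, franklin.coeff (fun _ => 1) k =
        ((∫ t in (0 : ℝ)..1, OrthoDiv.franklin k t : ℝ) : ℂ) := by
      intro k
      rw [← intervalIntegral.integral_ofReal]
      change (∫ t in (0 : ℝ)..1, 1 * (starRingEnd ℂ) ((OrthoDiv.franklin k t : ℝ) : ℂ)) = _
      simp only [one_mul, Complex.conj_ofReal]
    rw [partialSum]
    simp only [hc]
    change ∑ k ∈ Finset.range (j + 1), ((∫ t in (0 : ℝ)..1, OrthoDiv.franklin k t : ℝ) : ℂ) *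
      ((OrthoDiv.franklin k x : ℝ) : ℂ) = 1
    simp only [intervalIntegral.integral_const_mul] at h1
    have h2 := congrArg (fun z : ℝ => (z : ℂ)) h1
    push_cast at h2
    rw [← h2]
    exact Finset.sum_congr rfl fun _ _ => mul_comm _ _
  · obtain ⟨J, hJ⟩ := exists_abs_franklinKernel_le hr hε
    refine ⟨J, fun j hj x hx t ht hxt => ?_⟩
    have h1 : franklin.kernel j x t = (franklinKernel (j + 1) x t : ℂ) := by
      rw [franklinKernel]
      push_cast
      simp only [kernel, fn, Complex.conj_ofReal, terms]
    rw [h1, Complex.norm_real]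
    exact hJ j hj x hx t ht (hxt.trans (min_le_left _ _))

end ClassicalSystem

/-! ### The Riemann–Lebesgue lemma, uniform in a parameter -/

section RiemannLebesgue

lemma exists_norm_integral_exp_le (f : ℝ → ℂ) (s : Set ℝ) (hs : MeasurableSet s) {ε : ℝ}
    (hε : 0 < ε) : ∃ W : ℝ, ∀ w : ℝ, W ≤ |w| →
      ‖∫ t in s, f t * Complex.exp (Complex.I * (w * t : ℝ))‖ ≤ ε := by
  have h1 := Real.tendsto_integral_exp_smul_cocompact (s.indicator f)
  have h2 : ∀ᶠ w in cocompact ℝ, ‖∫ v : ℝ, Real.fourierChar (-(v * w)) • s.indicator f v‖ < ε := by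
    simpa [dist_eq_norm] using Metric.tendsto_nhds.1 h1 ε hε
  rw [cocompact_eq_atBot_atTop, eventually_sup] at h2
  obtain ⟨a, ha⟩ := eventually_atBot.1 h2.1
  obtain ⟨b, hb⟩ := eventually_atTop.1 h2.2
  -- The Fourier character is exp(-2πi v·), so the frequency `w` here corresponds to -w/(2π) there.
  refine ⟨2 * Real.pi * max |a| |b|, fun w hw => ?_⟩
  have hpi : 0 < 2 * Real.pi := by positivity
  have h3 : ∫ t in s, f t * Complex.exp (Complex.I * (w * t : ℝ)) =
      ∫ v : ℝ, Real.fourierChar (-(v * (-w / (2 * Real.pi)))) • s.indicator f v := by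
    rw [← integral_indicator hs]
    congr 1
    funext t
    by_cases ht : t ∈ s
    · rw [Set.indicator_of_mem ht, Set.indicator_of_mem ht, Circle.smul_def, Real.fourierChar_apply,
        smul_eq_mul, mul_comm]
      congr 2
      have : 2 * Real.pi * -(t * (-w / (2 * Real.pi))) = w * t := by field_simp
      rw [this, mul_comm]
    · rw [Set.indicator_of_notMem ht, Set.indicator_of_notMem ht, smul_zero]
  rw [h3]
  have h4 : max |a| |b| ≤ |-w / (2 * Real.pi)| := by
    rw [abs_div, abs_neg, abs_of_pos hpi, le_div_iff₀ hpi, mul_comm]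
    exact hw
  rcases le_abs'.1 h4 with h | h
  · refine (ha _ (h.trans ?_)).le
    have := neg_abs_le a
    have := le_max_left |a| |b|
    linarith
  · exact (hb _ (((le_abs_self b).trans (le_max_right _ _)).trans h)).le

/-- The Riemann–Lebesgue lemma, uniformly over a Lipschitz family with bounded parameters. -/
lemma exists_norm_integral_exp_le_uniform {L C : ℝ} {A : Set ℝ} (hA : A ⊆ Set.Icc 0 L)
    (F : ℝ → ℝ → ℂ) (hF : ∀ x ∈ A, IntegrableOn (F x) (Set.Icc 0 L))
    (hC : ∀ x ∈ A, ∀ y ∈ A, ∀ t ∈ Set.Icc 0 L, ‖F x t - F y t‖ ≤ C * |x - y|) {ε : ℝ}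
    (hε : 0 < ε) : ∃ W : ℝ, ∀ w : ℝ, W ≤ |w| → ∀ x ∈ A,
      ‖∫ t in Set.Icc 0 L, F x t * Complex.exp (Complex.I * (w * t : ℝ))‖ ≤ ε := by
  set V := volume.real (Set.Icc 0 L) with hV
  have hV0 : 0 ≤ V := measureReal_nonneg
  set D : ℝ := (|C| + 1) * (V + 1) with hD
  have hD0 : 0 < D := by positivity
  have hexp : ∀ w t : ℝ, ‖Complex.exp (Complex.I * (w * t : ℝ))‖ = 1 := fun w t => by
    rw [mul_comm, Complex.norm_exp_ofReal_mul_I]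
  have hmul : ∀ (f : ℝ → ℂ) (w : ℝ), IntegrableOn f (Set.Icc 0 L) →
      IntegrableOn (fun t => f t * Complex.exp (Complex.I * (w * t : ℝ))) (Set.Icc 0 L) := by
    intro f w hf
    refine hf.mul_bdd (c := 1) ?_ (ae_of_all _ fun t => (hexp w t).le)
    exact Continuous.aestronglyMeasurable (by fun_prop)
  -- A finite net of parameters suffices: by the Lipschitz condition, passing to the nearest one
  -- changes the integral by at most ε/2. The added ones in `D` keep it positive.
  obtain ⟨T, hTA, hTfin, hT⟩ := (isCompact_Icc.totallyBounded.subset hA).exists_subset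
    (Metric.dist_mem_uniformity (show 0 < ε / 2 / D by positivity))
  choose W hW using fun y => exists_norm_integral_exp_le (F y) (Set.Icc 0 L) measurableSet_Icc
    (half_pos hε)
  obtain ⟨W₀, hW₀⟩ := (hTfin.image W).bddAbove
  refine ⟨W₀, fun w hw x hx => ?_⟩
  obtain ⟨y, hy, hxy⟩ := Set.mem_iUnion₂.1 (hT hx)
  have hxy' : |x - y| < ε / 2 / D := hxy
  have h1 := hW y w ((hW₀ ⟨y, hy, rfl⟩).trans hw)
  have h2 : ∫ t in Set.Icc 0 L, F x t * Complex.exp (Complex.I * (w * t : ℝ)) =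
      (∫ t in Set.Icc 0 L, (F x t - F y t) * Complex.exp (Complex.I * (w * t : ℝ))) +
      ∫ t in Set.Icc 0 L, F y t * Complex.exp (Complex.I * (w * t : ℝ)) := by
    rw [← integral_add (hmul (fun t => F x t - F y t) w ((hF x hx).sub (hF y (hTA hy)))) (hmul _ w (hF y (hTA hy)))]
    congr 1
    funext t
    ring
  have h3 : ‖∫ t in Set.Icc 0 L, (F x t - F y t) * Complex.exp (Complex.I * (w * t : ℝ))‖ ≤
      (|C| + 1) * (ε / 2 / D) * V := by
    refine norm_setIntegral_le_of_norm_le_const measure_Icc_lt_top fun t ht => ?_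
    rw [norm_mul, hexp, mul_one]
    refine (hC x hx y (hTA hy) t ht).trans ?_
    calc C * |x - y| ≤ (|C| + 1) * |x - y| := by
          gcongr; linarith [le_abs_self C]
      _ ≤ _ := by gcongr
  have h4 : (|C| + 1) * (ε / 2 / D) * V ≤ ε / 2 := by
    calc _ ≤ (|C| + 1) * (ε / 2 / D) * (V + 1) := by gcongr; linarith
      _ = ε / 2 := by rw [hD]; field_simp
  rw [h2]
  exact (norm_add_le _ _).trans (by linarith)

end RiemannLebesgue

/-! ### The trigonometric system and the Dirichlet kernel -/

section Trigonometric

lemma trig_odd (j : ℕ) (x : ℝ) : trig (2 * j + 1) x = Real.cos ((j + 1 : ℝ) * x) / √Real.pi := by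
  rw [trig, if_neg (by omega), if_pos (by omega), show (2 * j + 1 + 1) / 2 = j + 1 by omega]
  push_cast
  rfl

lemma trig_even (j : ℕ) (x : ℝ) : trig (2 * j + 2) x = Real.sin ((j + 1 : ℝ) * x) / √Real.pi := by
  rw [trig, if_neg (by omega), if_neg (by omega), show (2 * j + 2) / 2 = j + 1 by omega]
  push_cast
  rfl

lemma trig_zero (x : ℝ) : trig 0 x = 1 / √(2 * Real.pi) := by simp [trig]

lemma continuous_trig (n : ℕ) : Continuous (trig n) := by
  unfold trig
  split_ifs <;> fun_prop

lemma abs_trig_le (n : ℕ) (x : ℝ) : |trig n x| ≤ 1 := by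
  have h1 : (1 : ℝ) ≤ √Real.pi := by
    rw [Real.one_le_sqrt]; linarith [Real.pi_gt_three]
  have h2 : (1 : ℝ) ≤ √(2 * Real.pi) := by
    rw [Real.one_le_sqrt]; linarith [Real.pi_gt_three]
  have h3 : ∀ c s : ℝ, |c| ≤ 1 → 1 ≤ s → |c / s| ≤ 1 := by
    intro c s hc hs
    rw [abs_div, abs_of_pos (show 0 < s by linarith), div_le_one (by linarith)]
    linarith
  unfold trig
  split_ifs
  · exact h3 _ _ (by simp) h2
  · exact h3 _ _ (Real.abs_cos_le_one _) h1
  · exact h3 _ _ (Real.abs_sin_le_one _) h1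

/-- The kernel of the first `N` functions of the trigonometric system. -/
def trigKernel (N : ℕ) (x t : ℝ) : ℝ := ∑ n ∈ Finset.range N, trig n x * trig n t

/-- The closed form of the Dirichlet kernel. -/
lemma sin_mul_trigKernel (j : ℕ) (x t : ℝ) :
    2 * Real.pi * Real.sin ((x - t) / 2) * trigKernel (2 * j + 1) x t =
      Real.sin ((j + 1 / 2 : ℝ) * (x - t)) := by
  have hpi : 0 < Real.pi := Real.pi_pos
  induction j with
  | zero =>
    rw [trigKernel, Finset.sum_range_one, trig_zero, trig_zero, div_mul_div_comm,
      Real.mul_self_sqrt (by positivity)]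
    push_cast
    rw [show ((0 : ℝ) + 1 / 2) * (x - t) = (x - t) / 2 by ring]
    field_simp
  | succ j ih =>
    have h1 : trigKernel (2 * (j + 1) + 1) x t = trigKernel (2 * j + 1) x t +
        Real.cos ((j + 1 : ℝ) * (x - t)) / Real.pi := by
      rw [trigKernel, show 2 * (j + 1) + 1 = 2 * j + 1 + 1 + 1 by ring, Finset.sum_range_succ,
        Finset.sum_range_succ, ← trigKernel, trig_odd, trig_odd,
        show 2 * j + 1 + 1 = 2 * j + 2 by ring, trig_even, trig_even, div_mul_div_comm,
        div_mul_div_comm, Real.mul_self_sqrt hpi.le, mul_sub, Real.cos_sub]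
      ring
    rw [h1, mul_add, ih]
    have h2 : 2 * Real.pi * Real.sin ((x - t) / 2) * (Real.cos ((j + 1 : ℝ) * (x - t)) / Real.pi) =
        2 * Real.sin ((x - t) / 2) * Real.cos ((j + 1 : ℝ) * (x - t)) := by
      field_simp
    rw [h2, Real.two_mul_sin_mul_cos]
    push_cast
    rw [show (x - t) / 2 - ((j : ℝ) + 1) * (x - t) = -(((j : ℝ) + 1 / 2) * (x - t)) by ring,
      Real.sin_neg, show (x - t) / 2 + ((j : ℝ) + 1) * (x - t) = ((j : ℝ) + 1 + 1 / 2) * (x - t) by ring]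
    ring

/-- Jordan's inequality sin y ≥ 2y/π on [0, π/2], after reflection at π/2 if necessary. Circular
distance is needed because the sine also vanishes when |x - t| = 2π. -/
lemma div_pi_le_abs_sin {r x t : ℝ} (hr : 0 ≤ r) (h : r ≤ gap (2 * Real.pi) x t) :
    r / Real.pi ≤ |Real.sin ((x - t) / 2)| := by
  have hpi : 0 < Real.pi := Real.pi_pos
  have h1 : r ≤ |x - t| := h.trans (min_le_left _ _)
  have h2 : r ≤ 2 * Real.pi - |x - t| := h.trans (min_le_right _ _)
  have h3 : |Real.sin ((x - t) / 2)| = |Real.sin (|x - t| / 2)| := by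
    rcases abs_cases (x - t) with h | h <;> rw [h.1]
    rw [neg_div, Real.sin_neg, abs_neg]
  rw [h3]
  refine le_trans ?_ (le_abs_self _)
  rcases le_total (|x - t| / 2) (Real.pi / 2) with h4 | h4
  · refine le_trans ?_ (Real.mul_le_sin (by linarith) h4)
    rw [div_mul_eq_mul_div]
    gcongr
    linarith
  · rw [← Real.sin_pi_sub]
    refine le_trans ?_ (Real.mul_le_sin (by linarith) (by linarith))
    rw [div_mul_eq_mul_div]
    gcongr
    linarith

lemma trigKernel_eq {j : ℕ} {x t : ℝ} (h : Real.sin ((x - t) / 2) ≠ 0) :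
    trigKernel (2 * j + 1) x t =
      Real.sin ((j + 1 / 2 : ℝ) * (x - t)) / Real.sin ((x - t) / 2) / (2 * Real.pi) := by
  have hpi : 0 < Real.pi := Real.pi_pos
  rw [← sin_mul_trigKernel]
  field_simp

/-- An odd number of functions gives a Dirichlet kernel; a nonzero even number adds one product of
modulus at most 1. -/
lemma abs_trigKernel_le {r x t : ℝ} (hr : 0 < r) (h : r ≤ gap (2 * Real.pi) x t) (N : ℕ) :
    |trigKernel N x t| ≤ Real.pi / r + 1 := by
  have hpi : 0 < Real.pi := Real.pi_pos
  have hs := div_pi_le_abs_sin hr.le h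
  have hs0 : 0 < |Real.sin ((x - t) / 2)| := lt_of_lt_of_le (by positivity) hs
  have hodd : ∀ j, |trigKernel (2 * j + 1) x t| ≤ Real.pi / r := by
    intro j
    rw [trigKernel_eq (abs_pos.1 hs0), abs_div, abs_div, abs_of_pos (show 0 < 2 * Real.pi by positivity)]
    calc _ ≤ 1 / (r / Real.pi) / 1 := by
          gcongr
          · exact Real.abs_sin_le_one _
          · linarith [Real.pi_gt_three]
      _ = Real.pi / r := by field_simp
  rcases Nat.even_or_odd' N with ⟨c, rfl | rfl⟩
  · rcases c with _ | c
    · simp only [trigKernel, mul_zero, Finset.range_zero, Finset.sum_empty, abs_zero]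
      positivity
    · rw [trigKernel, show 2 * (c + 1) = 2 * c + 1 + 1 by ring, Finset.sum_range_succ, ← trigKernel]
      refine (abs_add_le _ _).trans (add_le_add (hodd c) ?_)
      rw [abs_mul]
      exact mul_le_one₀ (abs_trig_le _ _) (abs_nonneg _) (abs_trig_le _ _)
  · linarith [hodd c]

lemma integral_trig (n : ℕ) :
    ∫ t in (0 : ℝ)..2 * Real.pi, trig n t = if n = 0 then √(2 * Real.pi) else 0 := by
  have hpi : 0 < Real.pi := Real.pi_pos
  rcases Nat.even_or_odd' n with ⟨c, rfl | rfl⟩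
  · rcases c with _ | c
    · simp only [mul_zero, trig_zero, intervalIntegral.integral_const, sub_zero, smul_eq_mul, if_true]
      rw [mul_one_div, Real.div_sqrt]
    · rw [if_neg (by omega), show 2 * (c + 1) = 2 * c + 2 by ring]
      simp only [trig_even]
      rw [intervalIntegral.integral_div, intervalIntegral.integral_comp_mul_left
        (fun t => Real.sin t) (by positivity), integral_sin]
      have : Real.cos (((c : ℝ) + 1) * (2 * Real.pi)) = 1 := by
        exact_mod_cast Real.cos_nat_mul_two_pi (c + 1)
      rw [this]
      simp
  · rw [if_neg (by omega)]
    simp only [trig_odd]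
    rw [intervalIntegral.integral_div, intervalIntegral.integral_comp_mul_left
      (fun t => Real.cos t) (by positivity), integral_cos]
    have : Real.sin (((c : ℝ) + 1) * (2 * Real.pi)) = 0 := by
      have := Real.sin_nat_mul_pi (2 * (c + 1))
      push_cast at this
      rw [← this]
      ring_nf
    rw [this]
    simp

end Trigonometric

namespace ClassicalSystem

lemma tame_trigonometric : trigonometric.Tame where
  length_pos := Real.two_pi_pos
  measurable k := Complex.measurable_ofReal.comp (continuous_trig k).measurable
  bounded k := ⟨1, fun x _ => by
    change ‖((trig k x : ℝ) : ℂ)‖ ≤ _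
    rw [Complex.norm_real]
    exact abs_trig_le k x⟩

/-- The sum of the first `N` terms of the trigonometric Fourier series. -/
def trigSum (f : ℝ → ℂ) (x : ℝ) (N : ℕ) : ℂ :=
  ∑ k ∈ Finset.range N, trigonometric.coeff f k * (trig k x : ℂ)

lemma trigSum_one (x : ℝ) (N : ℕ) : trigSum (fun _ => 1) x (N + 1) = 1 := by
  have hc : ∀ k, trigonometric.coeff (fun _ => 1) k =
      if 0 = k then ((√(2 * Real.pi) : ℝ) : ℂ) else 0 := by
    intro k
    change (∫ t in (0 : ℝ)..2 * Real.pi, 1 * (starRingEnd ℂ) ((trig k t : ℝ) : ℂ)) = _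
    simp only [one_mul, Complex.conj_ofReal]
    rw [intervalIntegral.integral_ofReal, integral_trig]
    by_cases h : k = 0
    · simp [h]
    · simp [h, Ne.symm h]
  rw [trigSum]
  simp only [hc, ite_mul, zero_mul]
  rw [Finset.sum_ite_eq, if_pos (Finset.mem_range.2 (Nat.succ_pos N)), trig_zero,
    ← Complex.ofReal_mul, mul_one_div, div_self (by positivity), Complex.ofReal_one]

/-- Only cosine coefficients are needed: a sum with a nonzero even number of terms is a usual
partial sum followed by one cosine term. -/
lemma norm_coeff_trig_odd_le {g : ℝ → ℂ} (hg : Measurable g) (hg1 : ∀ t, ‖g t‖ ≤ 1) {ε : ℝ}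
    (hε : 0 < ε) : ∃ J : ℕ, ∀ j ≥ J, ‖trigonometric.coeff g (2 * j + 1)‖ ≤ ε := by
  obtain ⟨W, hW⟩ := exists_norm_integral_exp_le g (Set.Icc 0 (2 * Real.pi)) measurableSet_Icc hε
  obtain ⟨J, hJ⟩ := exists_nat_ge W
  refine ⟨J, fun j hj => ?_⟩
  have hpi : (1 : ℝ) ≤ √Real.pi := by
    rw [Real.one_le_sqrt]; linarith [Real.pi_gt_three]
  have hjW : W ≤ (j : ℝ) + 1 := by
    have : (J : ℝ) ≤ j := by exact_mod_cast hj
    linarith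
  have hj0 : (0 : ℝ) ≤ (j : ℝ) + 1 := by positivity
  have h1 := hW (j + 1) (by rwa [abs_of_nonneg hj0])
  have h2 := hW (-(j + 1)) (by rwa [abs_neg, abs_of_nonneg hj0])
  have hint : ∀ w : ℝ, IntegrableOn (fun t => g t * Complex.exp (Complex.I * (w * t : ℝ)))
      (Set.Icc 0 (2 * Real.pi)) := by
    intro w
    refine IntegrableOn.of_bound measure_Icc_lt_top
      (hg.mul (Continuous.measurable (by fun_prop))).aestronglyMeasurable 1 (ae_of_all _ fun t => ?_)
    rw [norm_mul, mul_comm Complex.I, Complex.norm_exp_ofReal_mul_I, mul_one]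
    exact hg1 t
  have h3 : trigonometric.coeff g (2 * j + 1) =
      ((∫ t in Set.Icc 0 (2 * Real.pi), g t * Complex.exp (Complex.I * ((j + 1 : ℝ) * t : ℝ))) +
      ∫ t in Set.Icc 0 (2 * Real.pi), g t * Complex.exp (Complex.I * (-(j + 1 : ℝ) * t : ℝ))) *
        (1 / (2 * √Real.pi) : ℝ) := by
    rw [tame_trigonometric.coeff_eq, ← integral_add (hint _) (hint _), ← integral_mul_const]
    refine setIntegral_congr_fun measurableSet_Icc fun t _ => ?_
    change g t * (starRingEnd ℂ) ((trig (2 * j + 1) t : ℝ) : ℂ) = _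
    rw [Complex.conj_ofReal, trig_odd, Complex.ofReal_div, Complex.ofReal_cos, Complex.cos]
    push_cast
    rw [mul_comm Complex.I, mul_comm Complex.I]
    simp only [neg_mul]
    field_simp
  rw [h3, norm_mul, Complex.norm_real, Real.norm_of_nonneg (by positivity)]
  calc _ ≤ (ε + ε) * (1 / (2 * √Real.pi)) := by
        gcongr
        exact norm_add_le_of_le h1 h2
    _ = ε / √Real.pi := by field_simp; ring
    _ ≤ ε := div_le_self hε.le hpi

/-- Off the diagonal the Dirichlet kernel is sin((j+1/2)(x-t)) divided by a function bounded away
from 0. Writing the numerator in exponentials and extracting the phases in x leaves Fourier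
integrals of g(t)/sin((x-t)/2), a Lipschitz family in x, to which the uniform Riemann–Lebesgue lemma
applies. -/
lemma trigSum_odd_le {g : ℝ → ℂ} (hg : Measurable g) (hg1 : ∀ t, ‖g t‖ ≤ 1) {r ε : ℝ}
    (hr : 0 < r) (hε : 0 < ε) :
    ∃ J, ∀ j ≥ J, ∀ x ∈ Set.Icc 0 (2 * Real.pi),
      (∀ t ∈ Set.Icc 0 (2 * Real.pi), gap (2 * Real.pi) x t < r → g t = 0) →
      ‖trigSum g x (2 * j + 1)‖ ≤ ε := by
  have hpi : 0 < Real.pi := Real.pi_pos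
  set A : Set ℝ := {x ∈ Set.Icc 0 (2 * Real.pi) |
    ∀ t ∈ Set.Icc 0 (2 * Real.pi), gap (2 * Real.pi) x t < r → g t = 0} with hA
  -- For x in `A` the zeros of the sine lie where `g` vanishes, so the quotient there is 0 and the
  -- family is bounded by π/r.
  let F : ℝ → ℝ → ℂ := fun x t => g t / (Real.sin ((x - t) / 2) : ℝ)
  have hFm : ∀ x, Measurable (F x) := fun x =>
    hg.div (Continuous.measurable (by fun_prop))
  have hfar : ∀ x ∈ A, ∀ t ∈ Set.Icc 0 (2 * Real.pi), g t ≠ 0 →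
      r / Real.pi ≤ |Real.sin ((x - t) / 2)| := by
    intro x hx t ht hgt
    refine div_pi_le_abs_sin hr.le ?_
    by_contra! h
    exact hgt (hx.2 t ht h)
  have hF : ∀ x ∈ A, IntegrableOn (F x) (Set.Icc 0 (2 * Real.pi)) := by
    intro x hx
    refine IntegrableOn.of_bound measure_Icc_lt_top (hFm x).aestronglyMeasurable (Real.pi / r) ?_
    filter_upwards [ae_restrict_mem measurableSet_Icc] with t ht
    by_cases hgt : g t = 0
    · simp only [F, hgt, zero_div, norm_zero]; positivity
    · have h1 := hfar x hx t ht hgt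
      simp only [F]
      rw [norm_div, Complex.norm_real, Real.norm_eq_abs]
      calc _ ≤ 1 / (r / Real.pi) := by gcongr; exact hg1 t
        _ = Real.pi / r := by field_simp
  have hC : ∀ x ∈ A, ∀ y ∈ A, ∀ t ∈ Set.Icc 0 (2 * Real.pi),
      ‖F x t - F y t‖ ≤ (Real.pi / r) ^ 2 * |x - y| := by
    intro x hx y hy t ht
    by_cases hgt : g t = 0
    · simp only [F, hgt, zero_div, sub_self, norm_zero]; positivity
    · have h1 := hfar x hx t ht hgt
      have h2 := hfar y hy t ht hgt
      have hrp : 0 < r / Real.pi := by positivity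
      have h1' := abs_pos.1 (hrp.trans_le h1)
      have h2' := abs_pos.1 (hrp.trans_le h2)
      have h3 : F x t - F y t = g t * ((Real.sin ((y - t) / 2) - Real.sin ((x - t) / 2)) /
          (Real.sin ((x - t) / 2) * Real.sin ((y - t) / 2)) : ℝ) := by
        simp only [F]
        have h1'' : (Real.sin ((x - t) / 2) : ℂ) ≠ 0 := by exact_mod_cast h1'
        have h2'' : (Real.sin ((y - t) / 2) : ℂ) ≠ 0 := by exact_mod_cast h2'
        rw [Complex.ofReal_div, Complex.ofReal_sub, Complex.ofReal_mul]
        field_simp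
      have h4 : |Real.sin ((y - t) / 2) - Real.sin ((x - t) / 2)| ≤ |x - y| := by
        have h5 := Real.abs_sin_sub_sin_le ((y - t) / 2) ((x - t) / 2)
        have h6 : |(y - t) / 2 - (x - t) / 2| = |x - y| / 2 := by
          rw [← sub_div, sub_sub_sub_cancel_right, abs_div, abs_two, abs_sub_comm]
        rw [h6] at h5
        linarith [abs_nonneg (x - y)]
      rw [h3, norm_mul, Complex.norm_real, Real.norm_eq_abs, abs_div, abs_mul]
      calc _ ≤ 1 * (|x - y| / (r / Real.pi * (r / Real.pi))) := by
            gcongr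
            exact hg1 t
        _ = (Real.pi / r) ^ 2 * |x - y| := by field_simp
  obtain ⟨W, hW⟩ := exists_norm_integral_exp_le_uniform (fun x hx => hx.1) F hF hC hε
  obtain ⟨J, hJ⟩ := exists_nat_ge W
  refine ⟨J, fun j hj x hx hgx => ?_⟩
  have hxA : x ∈ A := ⟨hx, hgx⟩
  set w : ℝ := (j : ℝ) + 1 / 2 with hw
  have hw0 : 0 ≤ w := by positivity
  have hwW : W ≤ w := by
    have : (J : ℝ) ≤ j := by exact_mod_cast hj
    rw [hw]; linarith
  have h1 := hW w (by rwa [abs_of_nonneg hw0]) x hxA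
  have h2 := hW (-w) (by rwa [abs_neg, abs_of_nonneg hw0]) x hxA
  have hint : ∀ w : ℝ, IntegrableOn (fun t => F x t * Complex.exp (Complex.I * (w * t : ℝ)))
      (Set.Icc 0 (2 * Real.pi)) := by
    intro w
    refine (hF x hxA).mul_bdd (c := 1) ?_ (ae_of_all _ fun t => ?_)
    · exact Continuous.aestronglyMeasurable (by fun_prop)
    · rw [mul_comm, Complex.norm_exp_ofReal_mul_I]
  have h3 : trigSum g x (2 * j + 1) = ∫ t in Set.Icc 0 (2 * Real.pi),
      g t * trigonometric.kernel j x t := tame_trigonometric.partialSum_eq hg hg1 x j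
  -- The factor i/(4π) combines the 1/(2π) of the kernel with sin y = (exp(-iy) - exp(iy)) i/2. The
  -- phases in x have modulus 1 and drop out of the estimate.
  have h4 : trigSum g x (2 * j + 1) = (Complex.I / (4 * Real.pi)) *
      (Complex.exp (-(w * x * Complex.I)) *
        ∫ t in Set.Icc 0 (2 * Real.pi), F x t * Complex.exp (Complex.I * (w * t : ℝ))) -
      (Complex.I / (4 * Real.pi)) * (Complex.exp (w * x * Complex.I) *
        ∫ t in Set.Icc 0 (2 * Real.pi), F x t * Complex.exp (Complex.I * (-w * t : ℝ))) := by
    rw [h3, ← integral_const_mul, ← integral_const_mul, ← integral_const_mul, ← integral_const_mul,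
      ← integral_sub (((hint _).const_mul _).const_mul _) (((hint _).const_mul _).const_mul _)]
    refine setIntegral_congr_fun measurableSet_Icc fun t ht => ?_
    by_cases hgt : g t = 0
    · simp [F, hgt]
    · have h5 := hfar x hxA t ht hgt
      have h5' := abs_pos.1 ((show 0 < r / Real.pi by positivity).trans_le h5)
      have h6 : trigonometric.kernel j x t = (trigKernel (2 * j + 1) x t : ℂ) := by
        rw [trigKernel]
        push_cast
        simp only [kernel, fn, Complex.conj_ofReal, terms]
      have h7 : ((Real.sin (w * (x - t)) : ℝ) : ℂ) =
          (Complex.exp (-(w * x * Complex.I)) * Complex.exp (Complex.I * (w * t : ℝ)) -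
          Complex.exp (w * x * Complex.I) * Complex.exp (Complex.I * (-w * t : ℝ))) *
            Complex.I / 2 := by
        rw [← Complex.exp_add, ← Complex.exp_add, Complex.ofReal_sin, Complex.sin]
        push_cast
        ring_nf
      rw [h6, trigKernel_eq h5', ← hw, Complex.ofReal_div, Complex.ofReal_div, h7]
      simp only [F]
      push_cast
      have hpc : (Real.pi : ℂ) ≠ 0 := by exact_mod_cast hpi.ne'
      have hsc : Complex.sin ((x - t) / 2) ≠ 0 := by exact_mod_cast h5'
      field_simp
      ring
  have hI : ‖(Complex.I / (4 * Real.pi) : ℂ)‖ ≤ 1 / 2 := by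
    rw [norm_div, Complex.norm_I, norm_mul, Complex.norm_real, Real.norm_of_nonneg hpi.le]
    norm_num
    rw [inv_mul_le_iff₀ hpi]
    linarith [Real.pi_gt_three]
  have he : ‖Complex.exp (w * x * Complex.I)‖ = 1 := by
    exact_mod_cast Complex.norm_exp_ofReal_mul_I (w * x)
  have he' : ‖Complex.exp (-(w * x * Complex.I))‖ = 1 := by
    rw [← neg_mul]
    exact_mod_cast Complex.norm_exp_ofReal_mul_I (-(w * x))
  rw [h4]
  calc _ ≤ 1 / 2 * (1 * ε) + 1 / 2 * (1 * ε) := by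
        refine (norm_sub_le _ _).trans (add_le_add ?_ ?_)
        · rw [norm_mul, norm_mul, he']
          gcongr
        · rw [norm_mul, norm_mul, he]
          gcongr
    _ = ε := by ring

lemma trigSum_le {g : ℝ → ℂ} (hg : Measurable g) (hg1 : ∀ t, ‖g t‖ ≤ 1) {r ε : ℝ}
    (hr : 0 < r) (hε : 0 < ε) :
    ∃ J, ∀ N ≥ J, ∀ x ∈ Set.Icc 0 (2 * Real.pi),
      (∀ t ∈ Set.Icc 0 (2 * Real.pi), gap (2 * Real.pi) x t < r → g t = 0) →
      ‖trigSum g x N‖ ≤ ε := by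
  obtain ⟨J₁, hJ₁⟩ := trigSum_odd_le hg hg1 hr (half_pos hε)
  obtain ⟨J₂, hJ₂⟩ := norm_coeff_trig_odd_le hg hg1 (half_pos hε)
  refine ⟨2 * (J₁ + J₂) + 2, fun N hN x hx hgx => ?_⟩
  rcases Nat.even_or_odd' N with ⟨c, rfl | rfl⟩
  · obtain ⟨c, rfl⟩ : ∃ d, c = d + 1 := ⟨c - 1, by omega⟩
    have h1 := hJ₁ c (by omega) x hx hgx
    have h2 := hJ₂ c (by omega)
    rw [trigSum, show 2 * (c + 1) = 2 * c + 1 + 1 by ring, Finset.sum_range_succ, ← trigSum]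
    refine (norm_add_le_of_le h1 (?_ : _ ≤ ε / 2)).trans_eq (add_halves ε)
    rw [norm_mul, Complex.norm_real]
    exact (mul_le_of_le_one_right (norm_nonneg _) (abs_trig_le _ _)).trans h2
  · exact (hJ₁ c (by omega) x hx hgx).trans (half_le_self hε.le)

/-- The trigonometric system is localizing, whichever of the initial segments of the Fourier
series are taken as partial sums. -/
lemma localizing_of_fn_eq_trig {Φ : ClassicalSystem} (hl : Φ.length = 2 * Real.pi)
    (hf : Φ.fn = trigonometric.fn) (ht : ∀ j, j + 1 ≤ Φ.terms j) : Φ.Localizing := by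
  have hsum : ∀ f x j, Φ.partialSum f x j = trigSum f x (Φ.terms j) := by
    intro f x j
    rw [partialSum, trigSum]
    simp only [coeff, hl, hf]
    rfl
  refine ⟨⟨hl ▸ Real.two_pi_pos, hf ▸ tame_trigonometric.measurable, ?_⟩, fun j x _ => ?_,
    fun r hr => ⟨Real.pi / r + 1, fun j x hx t ht hxt => ?_⟩, fun g hg hg1 r hr ε hε => ?_⟩
  · rw [hf, hl]
    exact tame_trigonometric.bounded
  · obtain ⟨N, hN⟩ := Nat.exists_eq_add_of_le (ht j)
    rw [hsum, hN, show j + 1 + N = j + N + 1 by ring, trigSum_one]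
  · have h1 : Φ.kernel j x t = (trigKernel (Φ.terms j) x t : ℂ) := by
      rw [trigKernel, kernel, hf]
      push_cast
      simp only [fn, Complex.conj_ofReal]
    rw [h1, Complex.norm_real]
    rw [hl] at hxt
    exact abs_trigKernel_le hr hxt _
  · obtain ⟨J, hJ⟩ := trigSum_le hg hg1 hr hε
    refine ⟨J, fun j hj x hx hgx => ?_⟩
    rw [hl] at hx hgx
    rw [hsum]
    exact hJ _ (hj.le.trans ((Nat.le_succ j).trans (ht j))) x hx hgx

/-! ### All the classical systems together -/

theorem localizing (Φ : ClassicalSystem) : Φ.Localizing := by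
  cases Φ with
  | trigonometric => exact localizing_of_fn_eq_trig rfl rfl fun j => by simp only [terms]; omega
  | trigonometricTermwise => exact localizing_of_fn_eq_trig rfl rfl fun j => le_rfl
  | walsh => exact localizing_walsh
  | haar => exact localizing_haar
  | franklin => exact localizing_franklin
  | vilenkin p hp => exact localizing_vilenkin p hp

end ClassicalSystem
end OrthoDiv
end

theorem mainTheorem2 (Φ : OrthoDiv.ClassicalSystem) (a : ℕ → ℕ → ℂ)
    (ha : OrthoDiv.IsRegularMethod a) (hK : OrthoDiv.HasIntegrableKernels Φ a)
    (E : Set ℝ) (hE : E ⊆ Set.Icc 0 Φ.length) (hE0 : volume E = 0) :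
    ∃ G : Set ℝ, G ⊆ Set.Icc 0 Φ.length ∧ MeasurableSet G ∧
      ∀ x ∈ E, ∃ σ : ℕ → ℂ,
        OrthoDiv.IsMeans a (Φ.partialSum (G.indicator fun _ => 1) x) σ ∧
        ¬ ∃ l : ℂ, Tendsto σ atTop (𝓝 l) :=
  Φ.localizing.exists_divergence ha hK hE hE0
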